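/- **Setting.** Let $H,\omega>0$, $0<\epsilon\le 1$, and use the slow variables $X=\epsilon x$, $Y=\epsilon^{1/2}y$, with $0<X<L$. The waveguide $-H\le z\le 0$ has reciprocal density $\gamma=\gamma_0(X,z)+\epsilon\gamma_1(X,Y,z)$ and squared wavenumber $\kappa^2=n_0^2(X,z)+\epsilon\nu(X,Y,z)$, both piecewise smooth, possibly discontinuous across the interface $z=h=h_0(X)+\epsilon h_1(X,Y)$, where $-H<h_0,h<0$ and $\gamma_0>0$; the pieces of $\gamma_0,n_0$ and of $\gamma_1,\nu$ on either side of the interface are continued smoothly in $z$, and the unperturbed interface is $z=h_0$. There are finitely many disjoint smooth vertical walls $Y=c_i(X)$, which cut the $(X,Y)$-plane into strips; some strips form the waveguide (it may be unbounded in $Y$). A wall between two strips of the waveguide is an interface, across which $h_1,\gamma_1,\nu$ may jump; a wall between a strip of the waveguide and its exterior is a (rigid or soft) boundary. Subscripts $X,Y,z$ denote derivatives and $f_\pm$ the limits of $f$ at $z=h_0$ from above and below. Let $\phi_j(X,z)$ (real) and $k_j(X)>0$, for $j$ in a finite set, be solutions of $$(\gamma_0\phi_z)_z+\gamma_0n_0^2\phi-\gamma_0k^2\phi=0,\quad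 \phi|_{z=0}=0,\quad \phi_z|_{z=-H}=0,\quad \phi_+=\phi_-,\quad(\gamma_0\phi_z)_+=(\gamma_0\phi_z)_-\ \text{at } z=h_0,$$ normalized by $\int_{-H}^0\gamma_0\phi_j^2\,dz=1$, with $k_j(X)\neq k_l(X)$ for $j\ne l$. Let $\theta_{j,X}=k_j$, $C_{jl}=\int_{-H}^0\gamma_0\phi_{jX}\phi_l\,dz$ and $$\begin{aligned}\alpha_{lj}={}&\int_{-H}^0\gamma_0\nu\phi_j\phi_l\,dz+\int_{-H}^0\gamma_1(n_0^2-k_j^2)\phi_j\phi_l\,dz-\int_{-H}^0\gamma_1\phi_{jz}\phi_{lz}\,dz-\mathrm ik_j(C_{lj}-C_{jl})\\&+\Big\{h_1\phi_l\big[((\gamma_0\phi_{jz})_z)_+-((\gamma_0\phi_{jz})_z)_-\big]-h_1\gamma_0^2\phi_{jz}\phi_{lz}\big[(1/\gamma_0)_+-(1/\gamma_0)_-\big]\Big\}\Big|_{z=h_0}.\end{aligned}$$ Let the amplitudes $A_j(X,Y)$, twice continuously differentiable up to the walls in each strip of the waveguide, solve there the coupled mode parabolic equations $$2\mathrm ik_lA_{l,X}+\mathrm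 ik_{l,X}A_l+A_{l,YY}+\sum_j\alpha_{lj}A_j\exp\Big(\tfrac{\mathrm i}{\epsilon}(\theta_j-\theta_l)\Big)=0,$$ with $A_j$ and $A_{j,Y}$ continuous across the vertical interfaces, $A_{j,Y}-\mathrm i\,c_{i,X}k_jA_j=0$ at the rigid boundaries $Y=c_i(X)$, and $A_j=0$ at the soft ones; in unbounded strips let $A_j,A_{j,X},A_{j,Y},A_{j,XX}$ be dominated, locally uniformly in $X$, by a square integrable function of $Y$. Write $\bar A_j(x,y)=A_j(\epsilon x,\epsilon^{1/2}y)$, $\bar\theta_j(x)=\theta_j(\epsilon x)/\epsilon$, put $$P=\sum_j\bar A_j\exp(\mathrm i\bar\theta_j)\,\phi_j$$ in the waveguide, $P=0$ outside of it, and define the time-averaged energy flux through the planes $x=\mathrm{const}$ by $$J(x)=\frac1{2\omega}\operatorname{Im}\int_{-\infty}^{\infty}\int_{-H}^0\gamma P_xP^*\,dz\,dy.$$ **Claim.** Assume $\operatorname{Im}\nu=0$. Then $dJ/dx=O(\epsilon^2)$, uniformly: for every $K$ there is a constant $C$, depending only on $K,H,\omega$, the number of walls and the number of modes, such that the following holds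 whenever $\epsilon\in(0,1]$ and these quantities are bounded by $K$: $|h_{0X}|,|h_1|,|h_{1X}|,|\gamma_0|,|\gamma_{0X}|,|\gamma_{0z}|,|\gamma_1|,|\gamma_{1X}|,|k_j|,|k_{j,X}|,|\phi_j|,|\phi_{jz}|,|\phi_{jX}|,|\phi_{jXX}|$; the integrals $\int\sum_j(|A_j|^2+|A_{j,X}|^2+|A_{j,XX}|^2)\,dy$ for each $x$; and $\epsilon^{-1/2}|c_{i,X}|(|A_j|^2+|A_{j,X}|^2)$ on each wall (from either side). 1. $|J(x_2)-J(x_1)|\le C\epsilon^2|x_2-x_1|$ for all $x_1,x_2\in(0,L/\epsilon)$. 2. $J$ is differentiable at $x$ and $|dJ/dx|\le C\epsilon^2$ at every $x\in(0,L/\epsilon)$ such that, at $X=\epsilon x$, one has $h_{1X}=0$ for almost every $Y$ with $h_1(X,Y)=0$. -/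

import Mathlib

namespace ModePE

/-- The two layers of the waveguide: above and below the (single) nearly horizontal interface. -/
inductive Layer
  | upper
  | lower

/-- Parameters of the medium in the slow variables `X = ε x`, `Y = √ε y`, and vertical coordinate
`z ∈ [-H, 0]`:
`n0² + ε ν` is the squared wavenumber, `γ0 + ε γ1` is the reciprocal of the density,
`h0 + ε h1` is the position of the interface between the two layers.
A function with a jump across the interface is given by its two smooth pieces (one for each
`Layer`).

The vertical (in `z`) walls are the `n` curves `Y = curve i X`, numbered from left to right. They
cut the `(X, Y)`-plane into `n + 1` strips; `wet` is the set of those strips which belong to the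
waveguide. A curve between two wet strips is a vertical interface, a curve between a wet strip and
a strip which is not wet is a boundary, soft if it belongs to `soft` and rigid otherwise. The
quantities `h1`, `γ1`, `ν` may jump across the vertical interfaces: they are given strip by strip. -/
structure Medium (n : ℕ) where
  h0 : ℝ → ℝ
  h1 : Fin (n + 1) → ℝ → ℝ → ℝ
  n0 : Layer → ℝ → ℝ → ℝ
  ν : Fin (n + 1) → Layer → ℝ → ℝ → ℝ → ℂ
  γ0 : Layer → ℝ → ℝ → ℝ
  γ1 : Fin (n + 1) → Layer → ℝ → ℝ → ℝ → ℝ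
  curve : Fin n → ℝ → ℝ
  wet : Set (Fin (n + 1))
  soft : Set (Fin n)

/-- Modes: eigenfunctions `φ` (by layers), wavenumbers `k` and phases `θ`. -/
structure Modes (ι : Type*) where
  φ : Layer → ι → ℝ → ℝ → ℝ
  k : ι → ℝ → ℝ
  θ : ι → ℝ → ℝ

namespace Medium

variable {n : ℕ} (W : Medium n)

/-- The strip number `p` at a given `X`: between the curves number `p - 1` and `p`
(unbounded to the left for `p = 0` and to the right for `p = n`). -/
def strip (p : Fin (n + 1)) (X : ℝ) : Set ℝ :=
  {Y | ∀ i : Fin n,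
    (i.castSucc < p → W.curve i X < Y) ∧ (p ≤ i.castSucc → Y < W.curve i X)}

/-- The interior of a layer of the unperturbed (`ε = 0`) medium at a given `X`. -/
def layerInterior (H : ℝ) (X : ℝ) : Layer → Set ℝ
  | .upper => Set.Ioo (W.h0 X) 0
  | .lower => Set.Ioo (-H) (W.h0 X)

/-- The same layer with its end points. -/
def layerClosed (H : ℝ) (X : ℝ) : Layer → Set ℝ
  | .upper => Set.Icc (W.h0 X) 0
  | .lower => Set.Icc (-H) (W.h0 X)

/-- `∫_{-H}^0 F dz` for a function `F` with a jump at `z = h0`. -/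
noncomputable def vint {E : Type*} [NormedAddCommGroup E] [NormedSpace ℝ E]
    (H : ℝ) (X : ℝ) (F : Layer → ℝ → E) : E :=
  (∫ z in (-H)..(W.h0 X), F .lower z) + ∫ z in (W.h0 X)..0, F .upper z

/-- The position `h = h0 + ε h1` of the interface in the strip `p`. -/
def h (ε : ℝ) (p : Fin (n + 1)) (X Y : ℝ) : ℝ := W.h0 X + ε * W.h1 p X Y

open Classical in
/-- The physical function `γ(x, y, z) = γ0 + ε γ1`, with its jump at `z = h`. -/
noncomputable def γ (ε : ℝ) (x y z : ℝ) : ℝ :=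
  let X := ε * x
  let Y := √ε * y
  ∑ p : Fin (n + 1),
    if Y ∈ W.strip p X then
      if W.h ε p X Y < z then W.γ0 .upper X z + ε * W.γ1 p .upper X Y z
      else W.γ0 .lower X z + ε * W.γ1 p .lower X Y z
    else 0

/-- Regularity and geometry of the medium for `0 < X < L`: piecewise smooth coefficients, `γ0 > 0`,
the interfaces `z = h0` and `z = h` inside the waveguide, the vertical walls disjoint. -/
structure Regular (H L ε : ℝ) : Prop where
  h0_smooth : ContDiffOn ℝ 1 W.h0 (Set.Ioo 0 L)
  h1_smooth : ∀ p, ContDiffOn ℝ 1 (fun q : ℝ × ℝ => W.h1 p q.1 q.2) (Set.Ioo 0 L ×ˢ Set.univ)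
  n0_cont : ∀ s, ContinuousOn (fun q : ℝ × ℝ => W.n0 s q.1 q.2) (Set.Ioo 0 L ×ˢ Set.univ)
  ν_cont : ∀ p s, ContinuousOn (fun q : ℝ × ℝ × ℝ => W.ν p s q.1 q.2.1 q.2.2)
    (Set.Ioo 0 L ×ˢ Set.univ)
  γ0_smooth : ∀ s, ContDiffOn ℝ 1 (fun q : ℝ × ℝ => W.γ0 s q.1 q.2) (Set.Ioo 0 L ×ˢ Set.univ)
  γ1_smooth : ∀ p s, ContDiffOn ℝ 1 (fun q : ℝ × ℝ × ℝ => W.γ1 p s q.1 q.2.1 q.2.2)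
    (Set.Ioo 0 L ×ˢ Set.univ)
  curve_smooth : ∀ i, ContDiffOn ℝ 1 (W.curve i) (Set.Ioo 0 L)
  curve_lt : ∀ X ∈ Set.Ioo 0 L, StrictMono fun i => W.curve i X
  h0_mem : ∀ X ∈ Set.Ioo 0 L, W.h0 X ∈ Set.Ioo (-H) 0
  h_mem : ∀ X ∈ Set.Ioo 0 L, ∀ p ∈ W.wet, ∀ Y ∈ W.strip p X, W.h ε p X Y ∈ Set.Ioo (-H) 0
  γ0_pos : ∀ s, ∀ X ∈ Set.Ioo 0 L, ∀ z ∈ Set.Icc (-H) 0, 0 < W.γ0 s X z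

/-- The medium parameters, in the slow variables, are of order one: they and their first derivatives
that matter are bounded by `K`. -/
structure BoundedBy (H L K : ℝ) : Prop where
  h0_bound : ∀ X ∈ Set.Ioo 0 L, |deriv W.h0 X| ≤ K
  h1_bound : ∀ X ∈ Set.Ioo 0 L, ∀ p ∈ W.wet, ∀ Y ∈ W.strip p X,
    |W.h1 p X Y| ≤ K ∧ |deriv (fun X' => W.h1 p X' Y) X| ≤ K
  γ0_bound : ∀ s, ∀ X ∈ Set.Ioo 0 L, ∀ z ∈ Set.Icc (-H) 0,
    |W.γ0 s X z| ≤ K ∧ |deriv (fun X' => W.γ0 s X' z) X| ≤ K ∧ |deriv (W.γ0 s X) z| ≤ K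
  γ1_bound : ∀ X ∈ Set.Ioo 0 L, ∀ p ∈ W.wet, ∀ Y ∈ W.strip p X, ∀ s, ∀ z ∈ Set.Icc (-H) 0,
    |W.γ1 p s X Y z| ≤ K ∧ |deriv (fun X' => W.γ1 p s X' Y z) X| ≤ K

/-- At the station `X` the interface `z = h` does not pass transversally (in the direction of `X`)
through its unperturbed position `z = h0` simultaneously on a set of `Y` of positive measure. -/
def NoCrossing (X : ℝ) : Prop :=
  ∀ p ∈ W.wet, ∀ᵐ Y : ℝ, Y ∈ W.strip p X → W.h1 p X Y = 0 → deriv (fun X' => W.h1 p X' Y) X = 0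

end Medium

namespace Modes

variable {n : ℕ} {ι : Type*} (D : Modes ι) (W : Medium n)

/-- `D` consists of normalized real solutions `(k_j², φ_j)`, `k_j > 0`, of the spectral problem
`(γ0 φ_z)_z + γ0 n0² φ - γ0 k² φ = 0`, with `φ = 0` at `z = 0`, `φ_z = 0` at `z = -H`, `φ` and
`γ0 φ_z` continuous at `z = h0`, with different `j` corresponding to different eigenvalues, and of
the phases `θ_j` with `dθ_j / dX = k_j`. -/
structure IsSpectral (H L : ℝ) : Prop where
  φ_smooth : ∀ s j, ContDiffOn ℝ 2 (fun q : ℝ × ℝ => D.φ s j q.1 q.2) (Set.Ioo 0 L ×ˢ Set.univ)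
  k_smooth : ∀ j, ContDiffOn ℝ 1 (D.k j) (Set.Ioo 0 L)
  k_pos : ∀ j, ∀ X ∈ Set.Ioo 0 L, 0 < D.k j X
  k_ne : ∀ X ∈ Set.Ioo 0 L, Function.Injective fun j => D.k j X
  θ_deriv : ∀ j, ∀ X ∈ Set.Ioo 0 L, HasDerivAt (D.θ j) (D.k j X) X
  equation : ∀ j, ∀ X ∈ Set.Ioo 0 L, ∀ s, ∀ z ∈ W.layerInterior H X s,
    deriv (fun z' => W.γ0 s X z' * deriv (D.φ s j X) z') z
      + W.γ0 s X z * W.n0 s X z ^ 2 * D.φ s j X z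
      - W.γ0 s X z * D.k j X ^ 2 * D.φ s j X z = 0
  top : ∀ j, ∀ X ∈ Set.Ioo 0 L, D.φ .upper j X 0 = 0
  bottom : ∀ j, ∀ X ∈ Set.Ioo 0 L, deriv (D.φ .lower j X) (-H) = 0
  continuous : ∀ j, ∀ X ∈ Set.Ioo 0 L, D.φ .upper j X (W.h0 X) = D.φ .lower j X (W.h0 X)
  flux_continuous : ∀ j, ∀ X ∈ Set.Ioo 0 L,
    W.γ0 .upper X (W.h0 X) * deriv (D.φ .upper j X) (W.h0 X)
      = W.γ0 .lower X (W.h0 X) * deriv (D.φ .lower j X) (W.h0 X)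
  normalized : ∀ j, ∀ X ∈ Set.Ioo 0 L, W.vint H X (fun s z => W.γ0 s X z * D.φ s j X z ^ 2) = 1

/-- The eigenfunctions and wavenumbers, as functions of `X` and `z`, are of order one. -/
structure BoundedBy (H L K : ℝ) : Prop where
  k_bound : ∀ j, ∀ X ∈ Set.Ioo 0 L, |D.k j X| ≤ K ∧ |deriv (D.k j) X| ≤ K
  φ_bound : ∀ s j, ∀ X ∈ Set.Ioo 0 L, ∀ z ∈ W.layerClosed H X s,
    |D.φ s j X z| ≤ K ∧ |deriv (D.φ s j X) z| ≤ K ∧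
    |deriv (fun X' => D.φ s j X' z) X| ≤ K ∧ |iteratedDeriv 2 (fun X' => D.φ s j X' z) X| ≤ K

/-- `C_{jl} = ∫_{-H}^0 γ0 φ_{jX} φ_l dz`. -/
noncomputable def C (H : ℝ) (j l : ι) (X : ℝ) : ℝ :=
  W.vint H X fun s z => W.γ0 s X z * deriv (fun X' => D.φ s j X' z) X * D.φ s l X z

/-- The coefficients `α_{lj}` of the coupled mode parabolic equations, in the strip `p`. -/
noncomputable def α (H : ℝ) (p : Fin (n + 1)) (l j : ι) (X Y : ℝ) : ℂ :=
  W.vint H X (fun s z =>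
      (W.γ0 s X z : ℂ) * W.ν p s X Y z * (D.φ s j X z : ℂ) * (D.φ s l X z : ℂ))
    + ((W.vint H X fun s z =>
        W.γ1 p s X Y z * (W.n0 s X z ^ 2 - D.k j X ^ 2) * D.φ s j X z * D.φ s l X z : ℝ) : ℂ)
    - ((W.vint H X fun s z =>
        W.γ1 p s X Y z * deriv (D.φ s j X) z * deriv (D.φ s l X) z : ℝ) : ℂ)
    - Complex.I * (D.k j X : ℂ) * ((D.C W H l j X - D.C W H j l X : ℝ) : ℂ)
    + ((W.h1 p X Y * D.φ .upper l X (W.h0 X) *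
          (deriv (fun z => W.γ0 .upper X z * deriv (D.φ .upper j X) z) (W.h0 X)
            - deriv (fun z => W.γ0 .lower X z * deriv (D.φ .lower j X) z) (W.h0 X))
        - W.h1 p X Y * (W.γ0 .upper X (W.h0 X) * deriv (D.φ .upper j X) (W.h0 X))
            * (W.γ0 .upper X (W.h0 X) * deriv (D.φ .upper l X) (W.h0 X))
            * (1 / W.γ0 .upper X (W.h0 X) - 1 / W.γ0 .lower X (W.h0 X)) : ℝ) : ℂ)

/-- The amplitudes `A p j` (strip `p`, mode `j`) are a classical solution, for `0 < X < L`, of the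
coupled mode parabolic equations in the wet strips with the conditions at the vertical interfaces
and boundaries, decaying at infinity if the waveguide is unbounded in `Y`. -/
structure IsSolution [Fintype ι] (H L ε : ℝ) (A : Fin (n + 1) → ι → ℝ → ℝ → ℂ) : Prop where
  smooth : ∀ p ∈ W.wet, ∀ j,
    ContDiffOn ℝ 2 (fun q : ℝ × ℝ => A p j q.1 q.2) (Set.Ioo 0 L ×ˢ Set.univ)
  equation : ∀ p ∈ W.wet, ∀ l, ∀ X ∈ Set.Ioo 0 L, ∀ Y ∈ W.strip p X,
    2 * Complex.I * (D.k l X : ℂ) * deriv (fun X' => A p l X' Y) X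
      + Complex.I * ((deriv (D.k l) X : ℝ) : ℂ) * A p l X Y
      + iteratedDeriv 2 (A p l X) Y
      + ∑ j, D.α W H p l j X Y * A p j X Y
          * Complex.exp (Complex.I / (ε : ℂ) * ((D.θ j X - D.θ l X : ℝ) : ℂ)) = 0
  /-- at an interface, the amplitude and its normal derivative are continuous -/
  interface : ∀ i : Fin n, i.castSucc ∈ W.wet → i.succ ∈ W.wet → ∀ j, ∀ X ∈ Set.Ioo 0 L,
    A i.castSucc j X (W.curve i X) = A i.succ j X (W.curve i X) ∧
    deriv (A i.castSucc j X) (W.curve i X) = deriv (A i.succ j X) (W.curve i X)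
  /-- at a rigid boundary, `A_Y - i (d curve / dX) k A = 0`; at a soft boundary, `A = 0` -/
  boundary : ∀ i : Fin n, ∀ p : Fin (n + 1),
    (p = i.castSucc ∧ i.succ ∉ W.wet ∨ p = i.succ ∧ i.castSucc ∉ W.wet) → p ∈ W.wet →
    ∀ j, ∀ X ∈ Set.Ioo 0 L,
      (i ∉ W.soft → deriv (A p j X) (W.curve i X)
        - Complex.I * ((deriv (W.curve i) X : ℝ) : ℂ) * (D.k j X : ℂ) * A p j X (W.curve i X) = 0) ∧
      (i ∈ W.soft → A p j X (W.curve i X) = 0)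
  /-- square integrability in `Y`, locally uniform in `X` -/
  decay : ∀ X₀ ∈ Set.Ioo 0 L, ∃ δ > 0, ∃ g : ℝ → ℝ, MeasureTheory.Integrable g ∧
    ∀ X ∈ Set.Ioo 0 L, |X - X₀| < δ → ∀ p ∈ W.wet, ∀ Y ∈ W.strip p X, ∀ j,
      ‖A p j X Y‖ ^ 2 + ‖deriv (fun X' => A p j X' Y) X‖ ^ 2 + ‖deriv (A p j X) Y‖ ^ 2
        + ‖iteratedDeriv 2 (fun X' => A p j X' Y) X‖ ^ 2 ≤ g Y

open Classical in
/-- The amplitude `Ā_j(x, y) = A_j(ε x, √ε y)` in the physical variables (zero outside of the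
waveguide). -/
noncomputable def physA (ε : ℝ) (A : Fin (n + 1) → ι → ℝ → ℝ → ℂ) (j : ι) (x y : ℝ) : ℂ :=
  ∑ p : Fin (n + 1),
    if p ∈ W.wet ∧ √ε * y ∈ W.strip p (ε * x) then A p j (ε * x) (√ε * y) else 0

/-- The eigenfunction `φ_j` at `X = ε x`. -/
noncomputable def physφ (ε : ℝ) (j : ι) (x z : ℝ) : ℝ :=
  if W.h0 (ε * x) < z then D.φ .upper j (ε * x) z else D.φ .lower j (ε * x) z

/-- The acoustic field `P = ∑ Ā_j exp(i θ̄_j) φ_j` with `θ̄_j(x) = θ_j(ε x) / ε`. -/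
noncomputable def P [Fintype ι] (ε : ℝ) (A : Fin (n + 1) → ι → ℝ → ℝ → ℂ) (x y z : ℝ) : ℂ :=
  ∑ j, physA W ε A j x y * Complex.exp (Complex.I * ((D.θ j (ε * x) / ε : ℝ) : ℂ))
    * (D.physφ W ε j x z : ℂ)

/-- The time averaged acoustic energy flux
`J(x) = (1 / 2ω) Im ∫_{-∞}^∞ ∫_{-H}^0 γ P_x P^* dz dy`. -/
noncomputable def J [Fintype ι] (H ω ε : ℝ) (A : Fin (n + 1) → ι → ℝ → ℝ → ℂ) (x : ℝ) : ℝ :=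
  1 / (2 * ω) * (∫ y : ℝ, ∫ z in (-H)..0,
    (W.γ ε x y z : ℂ) * deriv (fun x' => D.P W ε A x' y z) x
      * (starRingEnd ℂ) (D.P W ε A x y z)).im

open Classical in
/-- The amplitudes are slow functions and the field carries an energy of order one. The first
condition bounds the `L²(dy)` norms of the amplitudes and of their derivatives with respect to the
slow variable `X`. The second condition bounds the traces of the amplitudes on those vertical
walls which are inclined to the `x`-axis (the power of `ε` comes from `dY = √ε dy`). -/
structure AmplitudeBound [Fintype ι] (L ε K : ℝ) (A : Fin (n + 1) → ι → ℝ → ℝ → ℂ) : Prop where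
  bulk : ∀ x ∈ Set.Ioo 0 (L / ε),
    (∫ y : ℝ, ∑ p : Fin (n + 1), if p ∈ W.wet ∧ √ε * y ∈ W.strip p (ε * x) then
      ∑ j, (‖A p j (ε * x) (√ε * y)‖ ^ 2
        + ‖deriv (fun X => A p j X (√ε * y)) (ε * x)‖ ^ 2
        + ‖iteratedDeriv 2 (fun X => A p j X (√ε * y)) (ε * x)‖ ^ 2) else 0) ≤ K
  walls : ∀ X ∈ Set.Ioo 0 L, ∀ i : Fin n, ∀ p ∈ W.wet, (p = i.castSucc ∨ p = i.succ) → ∀ j,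
    |deriv (W.curve i) X| * (‖A p j X (W.curve i X)‖ ^ 2
      + ‖deriv (fun X' => A p j X' (W.curve i X)) X‖ ^ 2) ≤ K * √ε

end Modes

end ModePE

/-! Since `θ_{j,X} = k_j`, the field satisfies `P_x = ∑ ((i k_j A_j + ε A_{j,X}) φ_j + ε A_j φ_{jX})
exp(i θ_j / ε)`. Integration over the depth and the substitution `Y = √ε y` give `J(x) = F(εx) /
(2ω√ε)`, where `F(X)` is the integral over `Y` of a density built from the products of the
amplitudes with `∫ γ φ_j φ_l dz` and `∫ γ φ_{jX} φ_l dz`. The amplitudes have squared `L²(dY)` norm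
`O(√ε)`, so it suffices that `F'` is `O(ε)` relative to this norm: the powers `ε^{-1/2} · ε ·
ε^{3/2}` then multiply to `ε²`.

By orthonormality of the modes `∫ γ φ_j φ_l dz = δ_{jl} + ε m_{jl} + O(ε²)`, hence the density is `∑
k_j |A_j|² + O(ε)`. The `O(ε)` part still matters, because an `X`-derivative falling on `exp(i(θ_j -
θ_l)/ε)` costs `1/ε`. The order-one slope therefore has two sources. The diagonal part yields, by
the mode parabolic equations, minus the `Y`-derivative of the transversal flux `∑ Im(A_j^*
A_{j,Y})`, minus the coupling terms with `α_{lj}`. The oscillating part yields terms with `k_j (k_j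
- k_l) m_{jl}` and `(k_j - k_l) C_{jl}`. Summed over `j, l` the coupling and oscillating terms
cancel by antisymmetry. Indeed, for real `ν`, the part of `α_{lj}` without the `C` becomes symmetric
after adding `k_j (k_j - k_l) m_{jl}`: by the mode equation at the interface its only asymmetric
piece is `-k_j² m_{jl}`. The `C` terms combine to `k_j C_{lj} - k_l C_{jl}`. This is
`Modes.IsSpectral.exists_α_eq` together with `slopeBound_fluxDensity`.

Integration over a strip with moving walls leaves `c_X · (density) - (transversal flux)` at the
walls. At an interface the leading terms agree from both sides, at a boundary they cancel by the
boundary condition. What remains is `O(ε)` times `|c_X|` times the squared traces, which the wall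
hypothesis makes `O(ε^{3/2})` (`Modes.Admissible.abs_wall_le`).

One obstacle shapes the whole argument. Both `γ` and `φ_{jX}` jump, the former at `z = h` and the
latter at `z = h0`, so `∫ γ φ_{jX} φ_l dz` has a corner in `X` whenever `h` passes through `h0`. The
flux need not be differentiable there. Derivatives are therefore replaced by `SlopeBound f d b`,
where `b` bounds the size of the corner. This notion obeys a product rule, a Leibniz rule and a mean
value inequality, which gives the Lipschitz estimate everywhere. Where corners are absent for almost
every `Y`, dominated convergence restores differentiability. -/

open Filter Topology Set MeasureTheory
open scoped Interval ComplexConjugate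

/-! ### Calculus of functions with corners: slope bounds. -/

namespace ModePE

/-- Near `x₀` the increments of `f` are those of a linear function with slope `d`, up to an error
whose slope is asymptotically at most `b`. -/
def SlopeBound (f : ℝ → ℝ) (d b x₀ : ℝ) : Prop :=
  ∀ η > 0, ∀ᶠ x in 𝓝 x₀, |f x - f x₀ - d * (x - x₀)| ≤ (b + η) * |x - x₀|

theorem slopeBound_zero_iff {f : ℝ → ℝ} {d x₀ : ℝ} :
    SlopeBound f d 0 x₀ ↔ HasDerivAt f d x₀ := by
  rw [hasDerivAt_iff_isLittleO, Asymptotics.isLittleO_iff]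
  simp only [SlopeBound, zero_add, Real.norm_eq_abs, smul_eq_mul, mul_comm]

theorem _root_.HasDerivAt.slopeBound {f : ℝ → ℝ} {d x₀ : ℝ} (h : HasDerivAt f d x₀) :
    SlopeBound f d 0 x₀ := slopeBound_zero_iff.2 h

namespace SlopeBound

variable {f g : ℝ → ℝ} {d e b c x₀ : ℝ}

theorem mono (h : SlopeBound f d b x₀) (hbc : b ≤ c) : SlopeBound f d c x₀ := fun η hη =>
  (h η hη).mono fun x hx => hx.trans (by gcongr)

theorem congr (h : SlopeBound f d b x₀) (hg : g =ᶠ[𝓝 x₀] f) : SlopeBound g d b x₀ := by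
  intro η hη
  filter_upwards [h η hη, hg] with x hx hgx
  rwa [hgx, hg.eq_of_nhds]

theorem add (hf : SlopeBound f d b x₀) (hg : SlopeBound g e c x₀) :
    SlopeBound (fun x => f x + g x) (d + e) (b + c) x₀ := by
  intro η hη
  filter_upwards [hf (η / 2) (by positivity), hg (η / 2) (by positivity)] with x h1 h2
  calc |f x + g x - (f x₀ + g x₀) - (d + e) * (x - x₀)|
      = |(f x - f x₀ - d * (x - x₀)) + (g x - g x₀ - e * (x - x₀))| := by ring_nf
    _ ≤ _ := abs_add_le _ _
    _ ≤ (b + η / 2) * |x - x₀| + (c + η / 2) * |x - x₀| := add_le_add h1 h2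
    _ = _ := by ring

theorem sum {ι : Type*} (s : Finset ι) {f : ι → ℝ → ℝ} {d b : ι → ℝ}
    (h : ∀ i ∈ s, SlopeBound (f i) (d i) (b i) x₀) :
    SlopeBound (fun x => ∑ i ∈ s, f i x) (∑ i ∈ s, d i) (∑ i ∈ s, b i) x₀ := by
  classical
  induction s using Finset.induction_on with
  | empty => simpa using (hasDerivAt_const x₀ (0 : ℝ)).slopeBound
  | insert i s hi ih =>
    simp only [Finset.sum_insert hi]
    exact (h i (by simp)).add (ih fun j hj => h j (by simp [hj]))

/-- Replaces an unknown slope by a prescribed one and moves the discrepancy into the error. This is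
how the slope of the flux density is traded for minus the derivative of the transversal flux. -/
theorem change_slope (hf : SlopeBound f d b x₀) (e : ℝ) :
    SlopeBound f e (|d - e| + b) x₀ := by
  intro η hη
  filter_upwards [hf η hη] with x hx
  calc |f x - f x₀ - e * (x - x₀)|
      = |(f x - f x₀ - d * (x - x₀)) + (d - e) * (x - x₀)| := by ring_nf
    _ ≤ _ := abs_add_le _ _
    _ ≤ (b + η) * |x - x₀| + |d - e| * |x - x₀| := by rw [abs_mul]; gcongr
    _ = _ := by ring

theorem abs_sub_le (hf : SlopeBound f d b x₀) {r : ℝ} (hr : |d| + b < r) :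
    ∀ᶠ x in 𝓝 x₀, |f x - f x₀| ≤ r * |x - x₀| := by
  filter_upwards [hf (r - (|d| + b)) (by linarith)] with x hx
  calc |f x - f x₀| = |(f x - f x₀ - d * (x - x₀)) + d * (x - x₀)| := by ring_nf
    _ ≤ _ := abs_add_le _ _
    _ ≤ (b + (r - (|d| + b))) * |x - x₀| + |d| * |x - x₀| := by rw [abs_mul d]; gcongr
    _ = _ := by ring

theorem continuousAt (hf : SlopeBound f d b x₀) : ContinuousAt f x₀ := by
  have h := hf.abs_sub_le (lt_add_one _)
  rw [ContinuousAt, tendsto_iff_norm_sub_tendsto_zero]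
  refine squeeze_zero' (Eventually.of_forall fun _ => norm_nonneg _) h ?_
  have : ContinuousAt (fun x => (|d| + b + 1) * |x - x₀|) x₀ := by fun_prop
  simpa [ContinuousAt] using this

theorem mul_hasDerivAt {u : ℝ → ℝ} {u' : ℝ} (hu : HasDerivAt u u' x₀)
    (hf : SlopeBound f d b x₀) (hb : 0 ≤ b) :
    SlopeBound (fun x => u x * f x) (u' * f x₀ + u x₀ * d) (|u x₀| * b) x₀ := by
  intro η hη
  -- The increment of the product is `u₀ δf + f₀ δu + δu δf`. `M` collects the factors of the error
  -- `δ` in these three terms, the last one being the local Lipschitz constant of `f`.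
  set M := |u x₀| + |f x₀| + (|d| + b + 1) with hM
  have hM0 : 0 < M := by positivity
  set δ := η / M with hδ
  have hδ0 : 0 < δ := by positivity
  have hδM : M * δ = η := by rw [hδ]; field_simp
  have hcont : ∀ᶠ x in 𝓝 x₀, |u x - u x₀| < δ := by
    have := hu.continuousAt.tendsto
    rw [Metric.tendsto_nhds] at this
    exact this δ hδ0
  filter_upwards [hf δ hδ0, hu.slopeBound δ hδ0, hcont, hf.abs_sub_le (lt_add_one _)]
    with x h1 h2 h3 h4
  calc |u x * f x - u x₀ * f x₀ - (u' * f x₀ + u x₀ * d) * (x - x₀)|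
      = |u x₀ * (f x - f x₀ - d * (x - x₀)) + f x₀ * (u x - u x₀ - u' * (x - x₀))
          + (u x - u x₀) * (f x - f x₀)| := by ring_nf
    _ ≤ |u x₀ * (f x - f x₀ - d * (x - x₀))| + |f x₀ * (u x - u x₀ - u' * (x - x₀))|
          + |(u x - u x₀) * (f x - f x₀)| := abs_add_three _ _ _
    _ ≤ |u x₀| * ((b + δ) * |x - x₀|) + |f x₀| * ((0 + δ) * |x - x₀|)
          + δ * ((|d| + b + 1) * |x - x₀|) := by
        rw [abs_mul, abs_mul, abs_mul]; gcongr
    _ = (|u x₀| * b + M * δ) * |x - x₀| := by rw [hM]; ring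
    _ = _ := by rw [hδM]

theorem const_mul (hf : SlopeBound f d b x₀) (hb : 0 ≤ b) (a : ℝ) :
    SlopeBound (fun x => a * f x) (a * d) (|a| * b) x₀ := by
  simpa using hf.mul_hasDerivAt (hasDerivAt_const x₀ a) hb

theorem comp_mul_left {ε : ℝ} (hε : 0 < ε) (hf : SlopeBound f d b (ε * x₀)) :
    SlopeBound (fun x => f (ε * x)) (ε * d) (ε * b) x₀ := by
  intro η hη
  have ht : Tendsto (fun x => ε * x) (𝓝 x₀) (𝓝 (ε * x₀)) :=
    (continuous_const.mul continuous_id).tendsto x₀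
  filter_upwards [ht.eventually (hf (η / ε) (by positivity))] with x hx
  calc |f (ε * x) - f (ε * x₀) - ε * d * (x - x₀)|
      = |f (ε * x) - f (ε * x₀) - d * (ε * x - ε * x₀)| := by ring_nf
    _ ≤ (b + η / ε) * |ε * x - ε * x₀| := hx
    _ = (b + η / ε) * (ε * |x - x₀|) := by rw [← mul_sub, abs_mul, abs_of_pos hε]
    _ = _ := by field_simp

/-- A function which everywhere takes the value of one of two differentiable functions. -/
theorem of_eq_or_eq {f₁ f₂ : ℝ → ℝ} {d₁ d₂ : ℝ} (h : ∀ᶠ x in 𝓝 x₀, f x = f₁ x ∨ f x = f₂ x)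
    (h1 : HasDerivAt f₁ d₁ x₀) (h2 : HasDerivAt f₂ d₂ x₀) (h1' : f x₀ = f₁ x₀)
    (h2' : f x₀ = f₂ x₀) : SlopeBound f d₁ |d₂ - d₁| x₀ := by
  intro η hη
  filter_upwards [h, h1.slopeBound η hη, (h2.slopeBound.change_slope d₁) η hη] with x hx h3 h4
  rcases hx with hx | hx
  · rw [hx, h1']
    exact h3.trans (by gcongr; positivity)
  · rw [hx, h2']
    simpa using h4

/-- Mean value inequality. -/
theorem abs_image_sub_le {s : Set ℝ} (hs : OrdConnected s)
    (h : ∀ x ∈ s, ∃ d b, SlopeBound f d b x ∧ |d| + b ≤ c) {x y : ℝ} (hx : x ∈ s) (hy : y ∈ s) :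
    |f y - f x| ≤ c * |y - x| := by
  wlog hxy : x ≤ y generalizing x y
  · rw [abs_sub_comm (f y), abs_sub_comm y]
    exact this hy hx (le_of_not_ge hxy)
  have hsub : Icc x y ⊆ s := hs.out hx hy
  refine le_of_forall_pos_le_add fun η hη => ?_
  -- The barrier in the fencing lemma must be strictly steeper than the function, hence the slope `c
  -- + r`. The `+ 1` in the denominator covers `x = y`.
  obtain ⟨r, hr0, hr⟩ : ∃ r > 0, r * (y - x) ≤ η := by
    refine ⟨η / (y - x + 1), by have := sub_nonneg.2 hxy; positivity, ?_⟩
    have := sub_nonneg.2 hxy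
    rw [div_mul_eq_mul_div, div_le_iff₀ (by linarith)]
    nlinarith
  have key := image_norm_le_of_liminf_right_slope_norm_lt_deriv_boundary
    (f := fun t => f t - f x) (a := x) (b := y) (f' := fun _ => c)
    (B := fun t => (c + r) * (t - x)) (B' := fun _ => c + r)
    (fun t ht => by
      obtain ⟨d, b, hdb, -⟩ := h t (hsub ht)
      exact (hdb.continuousAt.sub continuousAt_const).continuousWithinAt)
    (fun t ht q hq => by
      obtain ⟨d, b, hdb, hle⟩ := h t (hsub ⟨ht.1, ht.2.le⟩)
      obtain ⟨q', hq', hq''⟩ := exists_between hq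
      have h1 := hdb.abs_sub_le (hle.trans_lt hq')
      have h2 : ∀ᶠ z in 𝓝[>] t, |f z - f t| ≤ q' * |z - t| ∧ t < z :=
        (h1.filter_mono nhdsWithin_le_nhds).and self_mem_nhdsWithin
      refine (h2.mono ?_).frequently
      rintro z ⟨hz, hz'⟩
      rw [slope_def_field, div_lt_iff₀ (sub_pos.2 hz')]
      calc (norm ∘ fun t => f t - f x) z - (norm ∘ fun t => f t - f x) t
          ≤ |(f z - f x) - (f t - f x)| := by
            simpa using abs_sub_abs_le_abs_sub (f z - f x) (f t - f x)
        _ = |f z - f t| := by ring_nf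
        _ ≤ q' * |z - t| := hz
        _ < q * (z - t) := by
            rw [abs_of_pos (sub_pos.2 hz')]
            exact mul_lt_mul_of_pos_right hq'' (sub_pos.2 hz'))
    (by simp) (by fun_prop)
    (fun t _ => by
      simpa using (((hasDerivAt_id t).sub_const x).const_mul (c + r)).hasDerivWithinAt)
    (fun t _ _ => by linarith) (right_mem_Icc.2 hxy)
  rw [abs_of_nonneg (sub_nonneg.2 hxy)]
  calc |f y - f x| ≤ (c + r) * (y - x) := key
    _ = c * (y - x) + r * (y - x) := by ring
    _ ≤ _ := by gcongr

end SlopeBound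

end ModePE

/-! ### Leibniz rules for integrals of functions with slope bounds. -/

namespace ModePE

/-- Differentiation under the integral sign for functions with slope bounds, where for `x ≠ x₀` a
vanishing part `S \ R x` of the domain is left out. -/
theorem eventually_abs_setIntegral_sub_le {S : Set ℝ} {R : ℝ → Set ℝ} {x₀ : ℝ}
    (hS : MeasurableSet S) (hR : ∀ x, MeasurableSet (R x)) (hRS : ∀ x, R x ⊆ S)
    (hev : ∀ Y ∈ S, ∀ᶠ x in 𝓝 x₀, Y ∈ R x) {f : ℝ → ℝ → ℝ} {g q b : ℝ → ℝ}
    (hg : IntegrableOn g S) (hq : AEStronglyMeasurable q (volume.restrict S))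
    (hb : IntegrableOn b S)
    (hmeas : ∀ᶠ x in 𝓝 x₀, AEStronglyMeasurable (f x) (volume.restrict S))
    (hlip : ∀ᶠ x in 𝓝 x₀, ∀ Y ∈ R x, |f x Y - f x₀ Y| ≤ g Y * |x - x₀|)
    (hslope : ∀ᵐ Y, Y ∈ S → SlopeBound (fun x => f x Y) (q Y) (b Y) x₀) :
    IntegrableOn q S ∧ ∀ η > 0, ∀ᶠ x in 𝓝 x₀,
      |(∫ Y in R x, (f x Y - f x₀ Y)) - (∫ Y in S, q Y) * (x - x₀)|
        ≤ ((∫ Y in S, b Y) + η) * |x - x₀| := by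
  have hslope' : ∀ᵐ Y ∂(volume.restrict S), Y ∈ S ∧
      SlopeBound (fun x => f x Y) (q Y) (b Y) x₀ := by
    rw [ae_restrict_iff' hS]
    filter_upwards [hslope] with Y hY hYS using ⟨hYS, hY hYS⟩
  -- Integrability of `q` is not assumed but follows: a slope is at most the Lipschitz constant plus
  -- the slope error.
  have hqle : ∀ᵐ Y ∂(volume.restrict S), ‖q Y‖ ≤ g Y + b Y := by
    filter_upwards [hslope'] with Y hY
    refine le_of_forall_pos_le_add fun η hη => ?_
    have h1 : ∀ᶠ x in 𝓝[≠] x₀, Y ∈ R x ∧ (∀ Y ∈ R x, |f x Y - f x₀ Y| ≤ g Y * |x - x₀|) ∧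
        |f x Y - f x₀ Y - q Y * (x - x₀)| ≤ (b Y + η) * |x - x₀| :=
      nhdsWithin_le_nhds ((hev Y hY.1).and (hlip.and (hY.2 η hη)))
    obtain ⟨x, ⟨h2, h3, h4⟩, hx⟩ := (h1.and self_mem_nhdsWithin).exists
    have hx0 : 0 < |x - x₀| := abs_pos.2 (sub_ne_zero.2 hx)
    refine le_of_mul_le_mul_right ?_ hx0
    rw [Real.norm_eq_abs, ← abs_mul]
    calc |q Y * (x - x₀)| = |(f x Y - f x₀ Y) - (f x Y - f x₀ Y - q Y * (x - x₀))| := by ring_nf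
      _ ≤ _ := abs_sub _ _
      _ ≤ g Y * |x - x₀| + (b Y + η) * |x - x₀| := add_le_add (h3 Y h2) h4
      _ = _ := by ring
  have hqint : IntegrableOn q S := (hg.add hb).mono' hq hqle
  refine ⟨hqint, ?_⟩
  set Δ : ℝ → ℝ → ℝ := fun x => (R x).indicator fun Y => f x Y - f x₀ Y with hΔ
  -- The excess of the slope error over `b`, cut off at zero because only a one-sided bound is
  -- available. It tends to zero pointwise and is dominated, so its integral tends to zero. The
  -- increment is extended by zero off `R x`, which is harmless since each point of `S` eventually
  -- lies in `R x`.
  set ρ : ℝ → ℝ → ℝ := fun x Y => max (|Δ x Y - q Y * (x - x₀)| / |x - x₀| - b Y) 0 with hρ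
  have hm0 := hmeas.self_of_nhds
  have hΔmeas : ∀ᶠ x in 𝓝 x₀, AEStronglyMeasurable (Δ x) (volume.restrict S) := by
    filter_upwards [hmeas] with x hx
    exact (hx.sub hm0).indicator (hR x)
  have hgnn : ∀ᵐ Y ∂(volume.restrict S), 0 ≤ g Y := by
    filter_upwards [hslope'] with Y hY
    have h1 : ∀ᶠ x in 𝓝[≠] x₀, Y ∈ R x ∧ (∀ Y ∈ R x, |f x Y - f x₀ Y| ≤ g Y * |x - x₀|) :=
      nhdsWithin_le_nhds ((hev Y hY.1).and hlip)
    obtain ⟨x, ⟨h2, h3⟩, hx⟩ := (h1.and self_mem_nhdsWithin).exists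
    have hx0 : 0 < |x - x₀| := abs_pos.2 (sub_ne_zero.2 hx)
    have := (abs_nonneg _).trans (h3 Y h2)
    exact nonneg_of_mul_nonneg_left this hx0
  have hΔle : ∀ᶠ x in 𝓝 x₀, ∀ᵐ Y ∂(volume.restrict S), |Δ x Y| ≤ g Y * |x - x₀| := by
    filter_upwards [hlip] with x hx
    filter_upwards [hgnn] with Y hY
    by_cases h : Y ∈ R x
    · simpa [hΔ, h] using hx Y h
    · simp only [hΔ, h, not_false_eq_true, indicator_of_notMem, abs_zero]
      positivity
  have hΔint : ∀ᶠ x in 𝓝 x₀, IntegrableOn (Δ x) S := by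
    filter_upwards [hΔmeas, hΔle] with x h1 h2
    exact (hg.mul_const _).mono' h1 h2
  have hρmeas : ∀ᶠ x in 𝓝 x₀, AEStronglyMeasurable (ρ x) (volume.restrict S) := by
    filter_upwards [hΔmeas] with x hx
    have h1 := (((hx.sub (hq.mul_const (x - x₀))).norm.mul_const |x - x₀|⁻¹).sub
      hb.aestronglyMeasurable)
    exact (h1.sup (aestronglyMeasurable_const (b := (0 : ℝ))))
  have hρle : ∀ᶠ x in 𝓝[≠] x₀, ∀ᵐ Y ∂(volume.restrict S), ‖ρ x Y‖ ≤ g Y + |q Y| + |b Y| := by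
    filter_upwards [nhdsWithin_le_nhds hΔle, self_mem_nhdsWithin] with x hx hxne
    filter_upwards [hx, hgnn] with Y hY hgY
    have hx0 : 0 < |x - x₀| := abs_pos.2 (sub_ne_zero.2 hxne)
    rw [Real.norm_eq_abs, abs_of_nonneg (le_max_right _ _)]
    refine max_le ?_ (by positivity)
    have h1 : |Δ x Y - q Y * (x - x₀)| / |x - x₀| ≤ g Y + |q Y| := by
      rw [div_le_iff₀ hx0, add_mul, ← abs_mul]
      exact (abs_sub _ _).trans (by gcongr)
    have := neg_abs_le (b Y)
    linarith
  have hρint : ∀ᶠ x in 𝓝[≠] x₀, IntegrableOn (ρ x) S := by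
    filter_upwards [hρle, nhdsWithin_le_nhds hρmeas] with x h1 h2
    exact ((hg.add hqint.abs).add hb.abs).mono' h2 h1
  have hρlim : Tendsto (fun x => ∫ Y in S, ρ x Y) (𝓝[≠] x₀) (𝓝 (∫ _ in S, (0 : ℝ))) := by
    refine tendsto_integral_filter_of_dominated_convergence (fun Y => g Y + |q Y| + |b Y|)
      (nhdsWithin_le_nhds hρmeas) hρle ((hg.add hqint.abs).add hb.abs) ?_
    filter_upwards [hslope'] with Y hY
    rw [Metric.tendsto_nhds]
    intro η hη
    have h1 : ∀ᶠ x in 𝓝[≠] x₀, Y ∈ R x ∧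
        |f x Y - f x₀ Y - q Y * (x - x₀)| ≤ (b Y + η / 2) * |x - x₀| :=
      nhdsWithin_le_nhds ((hev Y hY.1).and (hY.2 (η / 2) (by positivity)))
    filter_upwards [h1, self_mem_nhdsWithin] with x hx hxne
    have hx0 : 0 < |x - x₀| := abs_pos.2 (sub_ne_zero.2 hxne)
    rw [dist_zero_right, Real.norm_eq_abs, abs_of_nonneg (le_max_right _ _)]
    refine max_lt ?_ hη
    have : |Δ x Y - q Y * (x - x₀)| / |x - x₀| ≤ b Y + η / 2 := by
      rw [div_le_iff₀ hx0]
      simpa [hΔ, hx.1] using hx.2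
    linarith
  rw [integral_zero] at hρlim
  intro η hη
  have hsmall : ∀ᶠ x in 𝓝[≠] x₀, (∫ Y in S, ρ x Y) < η := (tendsto_order.1 hρlim).2 η hη
  have main : ∀ᶠ x in 𝓝[≠] x₀,
      |(∫ Y in R x, (f x Y - f x₀ Y)) - (∫ Y in S, q Y) * (x - x₀)|
        ≤ ((∫ Y in S, b Y) + η) * |x - x₀| := by
    filter_upwards [hsmall, hρint, nhdsWithin_le_nhds hΔint, self_mem_nhdsWithin]
      with x h1 h2 h3 hxne
    have hx0 : 0 < |x - x₀| := abs_pos.2 (sub_ne_zero.2 hxne)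
    have e1 : (∫ Y in R x, (f x Y - f x₀ Y)) = ∫ Y in S, Δ x Y := by
      rw [hΔ, setIntegral_indicator (hR x), inter_eq_right.2 (hRS x)]
    have hqx : IntegrableOn (fun Y => q Y * (x - x₀)) S := hqint.mul_const _
    rw [e1, ← integral_mul_const, ← integral_sub h3 hqx]
    calc |∫ Y in S, (Δ x Y - q Y * (x - x₀))|
        ≤ ∫ Y in S, |Δ x Y - q Y * (x - x₀)| := abs_integral_le_integral_abs
      _ ≤ ∫ Y in S, (b Y + ρ x Y) * |x - x₀| := by
          refine integral_mono (h3.sub hqx).abs ((hb.add h2).mul_const _) fun Y => ?_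
          have : |Δ x Y - q Y * (x - x₀)| / |x - x₀| - b Y ≤ ρ x Y := le_max_left _ _
          rw [sub_le_iff_le_add, div_le_iff₀ hx0, add_comm] at this
          exact this
      _ = ((∫ Y in S, b Y) + ∫ Y in S, ρ x Y) * |x - x₀| := by
          rw [integral_mul_const, integral_add hb h2]
      _ ≤ _ := by gcongr
  rw [eventually_nhdsWithin_iff] at main
  filter_upwards [main] with x hx
  by_cases h : x = x₀
  · simp [h]
  · exact hx h

/-- Integral over a fixed domain. -/
theorem SlopeBound.setIntegral {S : Set ℝ} {x₀ : ℝ} (hS : MeasurableSet S) {f : ℝ → ℝ → ℝ}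
    {g q b : ℝ → ℝ} (hg : IntegrableOn g S) (hq : AEStronglyMeasurable q (volume.restrict S))
    (hb : IntegrableOn b S) (hint : ∀ᶠ x in 𝓝 x₀, IntegrableOn (f x) S)
    (hlip : ∀ᶠ x in 𝓝 x₀, ∀ Y ∈ S, |f x Y - f x₀ Y| ≤ g Y * |x - x₀|)
    (hslope : ∀ᵐ Y, Y ∈ S → SlopeBound (fun x => f x Y) (q Y) (b Y) x₀) :
    IntegrableOn q S ∧
      SlopeBound (fun x => ∫ Y in S, f x Y) (∫ Y in S, q Y) (∫ Y in S, b Y) x₀ := by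
  obtain ⟨h1, h2⟩ := eventually_abs_setIntegral_sub_le (R := fun _ => S) hS (fun _ => hS)
    (fun _ => subset_rfl) (fun Y hY => by simp [hY]) hg hq hb
    (hint.mono fun x hx => hx.aestronglyMeasurable) hlip hslope
  refine ⟨h1, fun η hη => ?_⟩
  filter_upwards [h2 η hη, hint] with x hx hix
  rwa [integral_sub hix hint.self_of_nhds] at hx

theorem abs_intervalIntegral_sub_le {u : ℝ → ℝ} (hu : Continuous u) {a b v η : ℝ}
    (h : ∀ y ∈ uIcc a b, |u y - v| ≤ η) : |(∫ y in a..b, u y) - (b - a) * v| ≤ η * |b - a| := by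
  have : (∫ y in a..b, u y) - (b - a) * v = ∫ y in a..b, (u y - v) := by
    rw [intervalIntegral.integral_sub (hu.intervalIntegrable _ _)
      (continuous_const.intervalIntegrable _ _)]
    simp
  rw [this, ← Real.norm_eq_abs]
  exact intervalIntegral.norm_integral_le_of_norm_le_const fun y hy =>
    h y (uIoc_subset_uIcc hy)

/-- Integral over an interval with one moving end; the slope bounds of the integrand are only
required where they hold all along the way from `x₀` to `x`. -/
theorem SlopeBound.intervalIntegral {m x₀ e' : ℝ} {e : ℝ → ℝ} (he : HasDerivAt e e' x₀)
    (hm : m < e x₀) {f : ℝ → ℝ → ℝ} {g q b : ℝ → ℝ}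
    (hg : IntegrableOn g (Ioo m (e x₀)))
    (hq : AEStronglyMeasurable q (volume.restrict (Ioo m (e x₀))))
    (hb : IntegrableOn b (Ioo m (e x₀)))
    (hcont : ∀ᶠ x in 𝓝 x₀, Continuous (f x))
    (hcont' : ContinuousAt (fun p : ℝ × ℝ => f p.1 p.2) (x₀, e x₀))
    (hlip : ∀ᶠ x in 𝓝 x₀, ∀ Y, m < Y → (∀ x' ∈ uIcc x₀ x, Y < e x') →
      |f x Y - f x₀ Y| ≤ g Y * |x - x₀|)
    (hslope : ∀ᵐ Y, Y ∈ Ioo m (e x₀) → SlopeBound (fun x => f x Y) (q Y) (b Y) x₀) :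
    IntegrableOn q (Ioo m (e x₀)) ∧
      SlopeBound (fun x => ∫ Y in m..e x, f x Y)
        ((∫ Y in Ioo m (e x₀), q Y) + e' * f x₀ (e x₀)) (∫ Y in Ioo m (e x₀), b Y) x₀ := by
  set Λ := |e'| + 1 with hΛ
  have hΛ0 : 0 < Λ := by positivity
  have hLip : ∀ᶠ x in 𝓝 x₀, |e x - e x₀| ≤ Λ * |x - x₀| :=
    he.slopeBound.abs_sub_le (by simp [hΛ])
  have hLip' : ∀ᶠ x in 𝓝 x₀, ∀ x' ∈ uIcc x₀ x, |e x' - e x₀| ≤ Λ * |x' - x₀| := by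
    obtain ⟨δ, hδ, hball⟩ := Metric.eventually_nhds_iff_ball.1 hLip
    filter_upwards [Metric.ball_mem_nhds x₀ hδ] with x hx x' hx'
    refine hball x' ?_
    rw [Metric.mem_ball, Real.dist_eq] at hx ⊢
    have := abs_sub_left_of_mem_uIcc hx'
    exact (this.trans_lt (by simpa using hx))
  -- Points left of `r x` stay left of the moving end at all times between `x₀` and `x`, so the
  -- Lipschitz bound applies to them. The leftover band has width `O(|x - x₀|)`, and continuity at
  -- the end point suffices there.
  set r : ℝ → ℝ := fun x => e x₀ - Λ * |x - x₀| with hr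
  have hrc : Continuous r := by fun_prop
  have hr0 : r x₀ = e x₀ := by simp [hr]
  have hrm : ∀ᶠ x in 𝓝 x₀, m < r x :=
    hrc.continuousAt.eventually_const_lt (by rwa [hr0])
  have hrle : ∀ x, r x ≤ e x₀ := fun x => by
    have : 0 ≤ Λ * |x - x₀| := by positivity
    simp only [hr]; linarith
  obtain ⟨h1, h2⟩ := eventually_abs_setIntegral_sub_le (R := fun x => Ioo m (r x)) (x₀ := x₀)
    (f := f) measurableSet_Ioo (fun _ => measurableSet_Ioo)
    (fun x => Ioo_subset_Ioo_right (hrle x))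
    (fun Y hY => by
      filter_upwards [hrc.continuousAt.eventually_const_lt (show Y < r x₀ by rw [hr0]; exact hY.2)]
        with x hx using ⟨hY.1, hx⟩) hg hq hb
    (hcont.mono fun x hx => hx.aestronglyMeasurable)
    (by
      filter_upwards [hlip, hLip'] with x hx hx' Y hY
      refine hx Y hY.1 fun x' hx'' => ?_
      have h3 := hx' x' hx''
      have h4 : |x' - x₀| ≤ |x - x₀| := abs_sub_left_of_mem_uIcc hx''
      have h5 := neg_le_of_abs_le h3
      have h6 : Λ * |x' - x₀| ≤ Λ * |x - x₀| := by gcongr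
      have h7 := hY.2
      simp only [hr] at h7
      linarith) hslope
  refine ⟨h1, fun η hη => ?_⟩
  -- The error budget: `κ` from the part left of `r x`, `2Λκ` and `Λκ` from the bands up to `e x`
  -- and `e x₀`, and `κ` from linearizing `e`.
  set κ := η / (2 + 3 * Λ) with hκ
  have hκ0 : 0 < κ := by positivity
  have hκη : κ * (2 + 3 * Λ) = η := by rw [hκ]; field_simp
  rw [Metric.continuousAt_iff] at hcont'
  obtain ⟨δ, hδ, hcδ⟩ := hcont' κ hκ0
  have hnear : ∀ᶠ x in 𝓝 x₀, |x - x₀| < δ ∧ Λ * |x - x₀| < δ := by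
    have c1 : ContinuousAt (fun x => |x - x₀|) x₀ := by fun_prop
    have c2 : ContinuousAt (fun x => Λ * |x - x₀|) x₀ := by fun_prop
    exact (c1.eventually_lt_const (by simpa using hδ)).and
      (c2.eventually_lt_const (by simpa using hδ))
  set v := f x₀ (e x₀) with hv
  have hev := he.slopeBound (κ / (|v| + 1)) (by positivity)
  filter_upwards [h2 κ hκ0, hcont, hrm, hLip, hnear, hev] with x hx hcx hmx hex hxδ hevx
  have hc0 := hcont.self_of_nhds
  have hclose : ∀ x', |x' - x₀| ≤ |x - x₀| → ∀ Y, |Y - e x₀| ≤ Λ * |x - x₀| →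
      |f x' Y - f x₀ (e x₀)| ≤ κ := fun x' hx' Y hY => by
    have := @hcδ (x', Y) (by
      rw [Prod.dist_eq, Real.dist_eq, Real.dist_eq]
      exact max_lt (hx'.trans_lt hxδ.1) (hY.trans_lt hxδ.2))
    exact this.le
  have hrabs : |r x - e x₀| ≤ Λ * |x - x₀| := by
    simp only [hr, sub_sub_cancel_left, abs_neg]
    rw [abs_of_nonneg (by positivity)]
  have hcvx : ∀ t, |t - e x₀| ≤ Λ * |x - x₀| → ∀ Y ∈ uIcc (r x) t,
      |Y - e x₀| ≤ Λ * |x - x₀| := fun t ht Y hY => by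
    have hsub : uIcc (r x) t ⊆ Metric.closedBall (e x₀) (Λ * |x - x₀|) := by
      rw [Real.closedBall_eq_Icc, ← uIcc_of_le (by
        have : 0 ≤ Λ * |x - x₀| := by positivity
        linarith)]
      refine uIcc_subset_uIcc ?_ ?_ <;>
      · rw [uIcc_of_le (by
          have : 0 ≤ Λ * |x - x₀| := by positivity
          linarith), ← Real.closedBall_eq_Icc, Metric.mem_closedBall, Real.dist_eq]
        assumption
    have := hsub hY
    rwa [Metric.mem_closedBall, Real.dist_eq] at this
  have i1 := abs_intervalIntegral_sub_le hcx (a := r x) (b := e x) (v := v) (η := κ)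
    fun Y hY => hclose x le_rfl Y (hcvx _ hex Y hY)
  have i2 := abs_intervalIntegral_sub_le hc0 (a := r x) (b := e x₀) (v := v) (η := κ)
    fun Y hY => hclose x₀ (by simp) Y (hcvx _ (by simpa using by positivity) Y hY)
  have s1 : (∫ Y in m..e x, f x Y) = (∫ Y in m..r x, f x Y) + ∫ Y in r x..e x, f x Y :=
    (intervalIntegral.integral_add_adjacent_intervals (hcx.intervalIntegrable _ _)
      (hcx.intervalIntegrable _ _)).symm
  have s2 : (∫ Y in m..e x₀, f x₀ Y) = (∫ Y in m..r x, f x₀ Y) + ∫ Y in r x..e x₀, f x₀ Y :=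
    (intervalIntegral.integral_add_adjacent_intervals (hc0.intervalIntegrable _ _)
      (hc0.intervalIntegrable _ _)).symm
  have s3 : (∫ Y in Ioo m (r x), (f x Y - f x₀ Y))
      = (∫ Y in m..r x, f x Y) - ∫ Y in m..r x, f x₀ Y := by
    rw [← intervalIntegral.integral_sub (hcx.intervalIntegrable _ _)
      (hc0.intervalIntegrable _ _), intervalIntegral.integral_of_le hmx.le,
      integral_Ioc_eq_integral_Ioo]
  have i3 : |v| * |e x - e x₀ - e' * (x - x₀)| ≤ κ * |x - x₀| := by
    calc |v| * |e x - e x₀ - e' * (x - x₀)|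
        ≤ (|v| + 1) * ((0 + κ / (|v| + 1)) * |x - x₀|) := by gcongr; linarith
      _ = κ * |x - x₀| := by field_simp; ring
  have i4 : |e x - r x| ≤ 2 * Λ * |x - x₀| := by
    calc |e x - r x| = |(e x - e x₀) - (r x - e x₀)| := by ring_nf
      _ ≤ _ := abs_sub _ _
      _ ≤ Λ * |x - x₀| + Λ * |x - x₀| := add_le_add hex hrabs
      _ = _ := by ring
  have i5 : |e x₀ - r x| ≤ Λ * |x - x₀| := by rwa [abs_sub_comm]
  have i6 : κ * |e x - r x| ≤ κ * (2 * Λ * |x - x₀|) := by gcongr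
  have i7 : κ * |e x₀ - r x| ≤ κ * (Λ * |x - x₀|) := by gcongr
  rw [s3] at hx
  rw [s1, s2]
  set a₁ := (∫ Y in m..r x, f x Y) - (∫ Y in m..r x, f x₀ Y)
    - (∫ Y in Ioo m (e x₀), q Y) * (x - x₀) with ha₁
  set a₂ := (∫ Y in r x..e x, f x Y) - (e x - r x) * v with ha₂
  set a₃ := (∫ Y in r x..e x₀, f x₀ Y) - (e x₀ - r x) * v with ha₃
  set a₄ := v * (e x - e x₀ - e' * (x - x₀)) with ha₄
  rw [← abs_mul] at i3
  calc _ = |(a₁ + a₂) - a₃ + a₄| := by rw [ha₁, ha₂, ha₃, ha₄]; ring_nf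
    _ ≤ |a₁| + |a₂| + |a₃| + |a₄| := by
        have j1 := abs_add_le (a₁ + a₂ - a₃) a₄
        have j2 := abs_sub (a₁ + a₂) a₃
        have j3 := abs_add_le a₁ a₂
        linarith
    _ ≤ ((∫ Y in Ioo m (e x₀), b Y) + κ) * |x - x₀| + κ * (2 * Λ * |x - x₀|)
          + κ * (Λ * |x - x₀|) + κ * |x - x₀| := by gcongr <;> linarith
    _ = ((∫ Y in Ioo m (e x₀), b Y) + κ * (2 + 3 * Λ)) * |x - x₀| := by ring
    _ = _ := by rw [hκη]

end ModePE

/-! ### Smooth functions on `(0, L) × ℝ` and classical Leibniz rules. -/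

namespace ModePE

/-- `w` is of class `C^n` on `(0, L) × ℝ`. -/
def SmoothStrip {E : Type*} [NormedAddCommGroup E] [NormedSpace ℝ E] (n : WithTop ℕ∞) (L : ℝ)
    (w : ℝ → ℝ → E) : Prop :=
  ContDiffOn ℝ n (fun q : ℝ × ℝ => w q.1 q.2) (Ioo 0 L ×ˢ univ)

theorem isOpen_strip (L : ℝ) : IsOpen (Ioo 0 L ×ˢ univ : Set (ℝ × ℝ)) :=
  isOpen_Ioo.prod isOpen_univ

/-- The derivative with respect to the first variable. -/
noncomputable def dX {E : Type*} [NormedAddCommGroup E] [NormedSpace ℝ E]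
    (w : ℝ → ℝ → E) (X z : ℝ) : E := deriv (fun X' => w X' z) X

namespace SmoothStrip

variable {E : Type*} [NormedAddCommGroup E] [NormedSpace ℝ E] {L X z : ℝ} {w v : ℝ → ℝ → E}
  {n : WithTop ℕ∞}

theorem continuousOn (hw : SmoothStrip n L w) :
    ContinuousOn (fun q : ℝ × ℝ => w q.1 q.2) (Ioo 0 L ×ˢ univ) := ContDiffOn.continuousOn hw

theorem of_le {m : WithTop ℕ∞} (hw : SmoothStrip n L w) (h : m ≤ n) : SmoothStrip m L w :=
  ContDiffOn.of_le hw h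

theorem contDiffAt (hw : SmoothStrip n L w) (hX : X ∈ Ioo 0 L) (z : ℝ) :
    ContDiffAt ℝ n (fun q : ℝ × ℝ => w q.1 q.2) (X, z) :=
  ContDiffOn.contDiffAt hw ((isOpen_strip L).mem_nhds ⟨hX, mem_univ _⟩)

theorem contDiffAt_fst (hw : SmoothStrip n L w) (hX : X ∈ Ioo 0 L) (z : ℝ) :
    ContDiffAt ℝ n (fun X => w X z) X :=
  ContDiffAt.comp X (f := fun X => (X, z)) (hw.contDiffAt hX z)
    (contDiffAt_id.prodMk contDiffAt_const)

theorem contDiff_snd (hw : SmoothStrip n L w) (hX : X ∈ Ioo 0 L) : ContDiff ℝ n (w X) :=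
  contDiff_iff_contDiffAt.2 fun z =>
    ContDiffAt.comp z (f := fun z => (X, z)) (hw.contDiffAt hX z)
      (contDiffAt_const.prodMk contDiffAt_id)

theorem hasDerivAt_fst (hw : SmoothStrip n L w) (hn : 1 ≤ n) (hX : X ∈ Ioo 0 L) (z : ℝ) :
    HasDerivAt (fun X => w X z) (dX w X z) X :=
  ((hw.contDiffAt_fst hX z).differentiableAt (by positivity)).hasDerivAt

theorem hasDerivAt_snd (hw : SmoothStrip n L w) (hn : 1 ≤ n) (hX : X ∈ Ioo 0 L) (z : ℝ) :
    HasDerivAt (w X) (deriv (w X) z) z :=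
  ((hw.contDiff_snd hX).differentiable (by positivity) z).hasDerivAt

theorem continuous_snd (hw : SmoothStrip n L w) (hX : X ∈ Ioo 0 L) : Continuous (w X) :=
  (hw.contDiff_snd hX).continuous

theorem dX {m : WithTop ℕ∞} (hw : SmoothStrip n L w) (hmn : m + 1 ≤ n) :
    SmoothStrip m L (dX w) := by
  have h1 : ContDiffOn ℝ m (fun q => fderiv ℝ (fun q : ℝ × ℝ => w q.1 q.2) q (1, 0))
      (Ioo 0 L ×ˢ univ) :=
    (ContDiffOn.fderiv_of_isOpen hw (isOpen_strip L) hmn).clm_apply contDiffOn_const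
  refine ContDiffOn.congr h1 fun q hq => ?_
  have hn : n ≠ 0 := by
    rintro rfl
    have := le_add_self.trans hmn
    simp at this
  have hd : HasFDerivAt (fun q : ℝ × ℝ => w q.1 q.2)
      (fderiv ℝ (fun q : ℝ × ℝ => w q.1 q.2) q) (q.1, q.2) :=
    ((hw.contDiffAt hq.1 q.2).differentiableAt hn).hasFDerivAt
  exact (HasFDerivAt.comp_hasDerivAt q.1 (f := fun X => (X, q.2)) hd
    ((hasDerivAt_id q.1).prodMk (hasDerivAt_const _ _))).deriv

theorem deriv_snd {m : WithTop ℕ∞} (hw : SmoothStrip n L w) (hmn : m + 1 ≤ n) :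
    SmoothStrip m L (fun X z => deriv (w X) z) := by
  have h1 : ContDiffOn ℝ m (fun q => fderiv ℝ (fun q : ℝ × ℝ => w q.1 q.2) q (0, 1))
      (Ioo 0 L ×ˢ univ) :=
    (ContDiffOn.fderiv_of_isOpen hw (isOpen_strip L) hmn).clm_apply contDiffOn_const
  refine ContDiffOn.congr h1 fun q hq => ?_
  have hn : n ≠ 0 := by
    rintro rfl
    have := le_add_self.trans hmn
    simp at this
  have hd : HasFDerivAt (fun q : ℝ × ℝ => w q.1 q.2)
      (fderiv ℝ (fun q : ℝ × ℝ => w q.1 q.2) q) (q.1, q.2) :=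
    ((hw.contDiffAt hq.1 q.2).differentiableAt hn).hasFDerivAt
  exact (HasFDerivAt.comp_hasDerivAt q.2 (f := fun z => (q.1, z)) hd
    ((hasDerivAt_const _ _).prodMk (hasDerivAt_id q.2))).deriv

theorem continuous_dX (hw : SmoothStrip n L w) (hn : 1 ≤ n) (hX : X ∈ Ioo 0 L) :
    Continuous (ModePE.dX w X) :=
  (hw.dX (m := 0) (by simpa using hn)).continuous_snd hX

theorem sub (hw : SmoothStrip n L w) (hv : SmoothStrip n L v) :
    SmoothStrip n L (fun X z => w X z - v X z) := ContDiffOn.sub hw hv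

theorem add (hw : SmoothStrip n L w) (hv : SmoothStrip n L v) :
    SmoothStrip n L (fun X z => w X z + v X z) := ContDiffOn.add hw hv

theorem mul {w v : ℝ → ℝ → ℝ} (hw : SmoothStrip n L w) (hv : SmoothStrip n L v) :
    SmoothStrip n L (fun X z => w X z * v X z) := ContDiffOn.mul hw hv

theorem const_mul {w : ℝ → ℝ → ℝ} (hw : SmoothStrip n L w) (c : ℝ) :
    SmoothStrip n L (fun X z => c * w X z) := ContDiffOn.mul contDiffOn_const hw

/-- Leibniz rule for an integral with a moving end. -/
theorem hasDerivAt_integral {w : ℝ → ℝ → ℝ} (hw : SmoothStrip 1 L w) (hX : X ∈ Ioo 0 L) (m : ℝ)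
    {e : ℝ → ℝ} {e' : ℝ} (he : HasDerivAt e e' X) :
    HasDerivAt (fun X => ∫ z in m..e X, w X z)
      ((∫ z in m..e X, ModePE.dX w X z) + e' * w X (e X)) X := by
  have hdX := hw.dX (m := 0) (by simp)
  obtain ⟨δ, hδ, hball⟩ := Metric.isOpen_iff.1 isOpen_Ioo X hX
  have hcb : Metric.closedBall X (δ / 2) ⊆ Ioo 0 L :=
    (Metric.closedBall_subset_ball (by linarith)).trans hball
  have hcpt : IsCompact (Metric.closedBall X (δ / 2) ×ˢ uIcc m (e X)) :=
    (isCompact_closedBall X (δ / 2)).prod isCompact_uIcc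
  obtain ⟨Cb, hCb⟩ := hcpt.exists_bound_of_continuousOn
    (hdX.continuousOn.mono (prod_mono hcb (subset_univ _)))
  have hnear : ∀ᶠ x in 𝓝 X, x ∈ Ioo 0 L := isOpen_Ioo.mem_nhds hX
  have h1 := (intervalIntegral.hasDerivAt_integral_of_dominated_loc_of_deriv_le
    (F := w) (F' := ModePE.dX w) (μ := volume) (a := m) (b := e X) (x₀ := X)
    (bound := fun _ => Cb) (Metric.closedBall_mem_nhds X (half_pos hδ))
    (hnear.mono fun x hx => (hw.continuous_snd hx).aestronglyMeasurable)
    ((hw.continuous_snd hX).intervalIntegrable _ _)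
    (hw.continuous_dX le_rfl hX).aestronglyMeasurable
    (Eventually.of_forall fun t ht x hx => hCb (x, t) ⟨hx, uIoc_subset_uIcc ht⟩)
    (by simp)
    (Eventually.of_forall fun t ht x hx => hw.hasDerivAt_fst le_rfl (hcb hx) t)).2
  have hc : ContinuousAt (fun q : ℝ × ℝ => w q.1 q.2) (X, e X) :=
    (hw.contDiffAt hX _).continuousAt
  -- On the short interval from `e X` to `e x` the integrand equals its value at `(X, e X)` up to
  -- `o(1)`, by joint continuity, and the length of the interval is `O(x - X)`.
  have h2 : HasDerivAt (fun x => ∫ z in e X..e x, w x z) (e' * w X (e X)) X := by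
    have h3 : (fun x => (∫ z in e X..e x, w x z) - (e x - e X) * w X (e X))
        =o[𝓝 X] fun x => x - X := by
      refine Asymptotics.IsLittleO.trans_isBigO (g := fun x => e x - e X) ?_ he.isBigO_sub
      rw [Asymptotics.isLittleO_iff]
      intro κ hκ
      rw [Metric.continuousAt_iff] at hc
      obtain ⟨η, hη, hcη⟩ := hc κ hκ
      have hen : ∀ᶠ x in 𝓝 X, e x ∈ Metric.ball (e X) η :=
        he.continuousAt.eventually (Metric.ball_mem_nhds _ hη)
      filter_upwards [hen, Metric.ball_mem_nhds X hη, hnear] with x hx1 hx2 hx3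
      refine abs_intervalIntegral_sub_le (hw.continuous_snd hx3) fun y hy => ?_
      refine (@hcη (x, y) ?_).le
      rw [Prod.dist_eq]
      refine max_lt hx2 ?_
      rw [Real.dist_eq]
      exact (abs_sub_left_of_mem_uIcc hy).trans_lt hx1
    have h4 := (he.sub_const (e X)).mul_const (w X (e X))
    rw [hasDerivAt_iff_isLittleO] at h4 ⊢
    refine (h3.add h4).congr_left fun x => ?_
    simp
  refine (h1.add h2).congr_of_eventuallyEq ?_
  filter_upwards [hnear] with x hx
  exact (intervalIntegral.integral_add_adjacent_intervals
    ((hw.continuous_snd hx).intervalIntegrable _ _)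
    ((hw.continuous_snd hx).intervalIntegrable _ _)).symm

/-- Leibniz rule for an integral with two moving ends. -/
theorem hasDerivAt_integral₂ {w : ℝ → ℝ → ℝ} (hw : SmoothStrip 1 L w) (hX : X ∈ Ioo 0 L)
    {a e : ℝ → ℝ} {a' e' : ℝ} (ha : HasDerivAt a a' X) (he : HasDerivAt e e' X) :
    HasDerivAt (fun X => ∫ z in a X..e X, w X z)
      (e' * w X (e X) - a' * w X (a X) + ∫ z in a X..e X, ModePE.dX w X z) X := by
  have hnear : ∀ᶠ x in 𝓝 X, x ∈ Ioo 0 L := isOpen_Ioo.mem_nhds hX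
  have h := (hw.hasDerivAt_integral hX 0 he).sub (hw.hasDerivAt_integral hX 0 ha)
  have hi := fun a b => (hw.continuous_dX le_rfl hX).intervalIntegrable (μ := volume) a b
  have hval : e' * w X (e X) - a' * w X (a X) + ∫ z in a X..e X, ModePE.dX w X z
      = ((∫ z in 0..e X, ModePE.dX w X z) + e' * w X (e X))
        - ((∫ z in 0..a X, ModePE.dX w X z) + a' * w X (a X)) := by
    rw [← intervalIntegral.integral_add_adjacent_intervals (hi (a X) 0) (hi 0 (e X)),
      intervalIntegral.integral_symm 0 (a X)]
    ring
  rw [hval]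
  refine h.congr_of_eventuallyEq ?_
  filter_upwards [hnear] with x hx
  have hi := fun a b => (hw.continuous_snd hx).intervalIntegrable (μ := volume) a b
  rw [← intervalIntegral.integral_add_adjacent_intervals (hi (a x) 0) (hi 0 (e x)),
    intervalIntegral.integral_symm 0 (a x)]
  simp only [Pi.sub_apply]
  ring

end SmoothStrip

/-- Continuity of an integral with a parameter and moving ends. -/
theorem continuousOn_intervalIntegral {T : Type*} [TopologicalSpace T] [FirstCountableTopology T]
    {U : Set T} {w : T → ℝ → ℝ} {a e : T → ℝ}
    (hw : ContinuousOn (fun q : T × ℝ => w q.1 q.2) (U ×ˢ univ))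
    (ha : ContinuousOn a U) (he : ContinuousOn e U) :
    ContinuousOn (fun t => ∫ z in a t..e t, w t z) U := by
  rw [continuousOn_iff_continuous_domRestrict] at ha he ⊢
  have hw' : Continuous (Function.uncurry fun (t : U) (z : ℝ) => w t z) := by
    have := hw.comp_continuous (f := fun q : U × ℝ => ((q.1 : T), q.2)) (by fun_prop)
      (fun q => ⟨q.1.2, mem_univ _⟩)
    exact this
  have h1 := (intervalIntegral.continuous_parametric_intervalIntegral_of_continuous (a₀ := 0)
    (μ := volume) hw' he).sub (intervalIntegral.continuous_parametric_intervalIntegral_of_continuous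
      (a₀ := 0) (μ := volume) hw' ha)
  refine h1.congr fun t => ?_
  have hc : Continuous (w t) := hw'.comp (f := fun z => (t, z)) (by fun_prop)
  have hi := fun a b => hc.intervalIntegrable (μ := volume) a b
  simp only [domRestrict_apply, Pi.sub_apply]
  rw [← intervalIntegral.integral_add_adjacent_intervals (hi (a t) 0) (hi 0 (e t)),
    intervalIntegral.integral_symm 0 (a t)]
  ring

end ModePE

/-! ### Integration over the depth with jumps at two nearby levels. -/

namespace ModePE

theorem intervalIntegral_congr_of_le {E : Type*} [NormedAddCommGroup E] [NormedSpace ℝ E]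
    {f g : ℝ → E} {a b : ℝ} (hab : a ≤ b) (hg : Continuous g) (h : ∀ z ∈ Ioc a b, f z = g z) :
    IntervalIntegrable f volume a b ∧ ∫ z in a..b, f z = ∫ z in a..b, g z := by
  have h' : ∀ z ∈ Ι a b, f z = g z := by rwa [uIoc_of_le hab]
  refine ⟨(hg.intervalIntegrable a b).congr_ae ?_,
    intervalIntegral.integral_congr_ae (Eventually.of_forall h')⟩
  rw [EventuallyEq, ae_restrict_iff' measurableSet_uIoc]
  exact Eventually.of_forall fun z hz => (h' z hz).symm

theorem intervalIntegral_of_three_pieces {E : Type*} [NormedAddCommGroup E] [NormedSpace ℝ E]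
    {f g₁ g₂ g₃ : ℝ → E} {a b c d : ℝ} (hab : a ≤ b) (hbc : b ≤ c) (hcd : c ≤ d)
    (hg₁ : Continuous g₁) (hg₂ : Continuous g₂) (hg₃ : Continuous g₃)
    (h₁ : ∀ z ∈ Ioc a b, f z = g₁ z) (h₂ : ∀ z ∈ Ioc b c, f z = g₂ z)
    (h₃ : ∀ z ∈ Ioc c d, f z = g₃ z) :
    IntervalIntegrable f volume a d ∧
      ∫ z in a..d, f z = (∫ z in a..b, g₁ z) + (∫ z in b..c, g₂ z) + ∫ z in c..d, g₃ z := by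
  obtain ⟨i₁, e₁⟩ := intervalIntegral_congr_of_le hab hg₁ h₁
  obtain ⟨i₂, e₂⟩ := intervalIntegral_congr_of_le hbc hg₂ h₂
  obtain ⟨i₃, e₃⟩ := intervalIntegral_congr_of_le hcd hg₃ h₃
  refine ⟨(i₁.trans i₂).trans i₃, ?_⟩
  rw [← intervalIntegral.integral_add_adjacent_intervals (i₁.trans i₂) i₃,
    ← intervalIntegral.integral_add_adjacent_intervals i₁ i₂, e₁, e₂, e₃]

/-- The layer of the unperturbed medium which contains the points between the unperturbed position
`a` and the position `e` of the interface. -/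
noncomputable def side (a e : ℝ) : Layer := open Classical in if a ≤ e then .upper else .lower

/-- The integral of the function `w` (given by its two pieces) from `a` to `e`, where the upper
piece is used above `a` and the lower one below. -/
noncomputable def tail (a e : ℝ) (w : Layer → ℝ → ℝ) : ℝ :=
  (∫ z in a..max a e, w .upper z) + ∫ z in a..min a e, w .lower z

/-- One of the two integrals in `tail` is over a degenerate interval. The form with `max` and `min`
shows continuity in the parameters, while this form, with a single piece, serves for estimates. -/
theorem tail_eq (a e : ℝ) (w : Layer → ℝ → ℝ) : tail a e w = ∫ z in a..e, w (side a e) z := by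
  rcases le_or_gt a e with h | h
  · simp [tail, side, h]
  · simp [tail, side, h.le, not_le.2 h]

theorem tail_self (a : ℝ) (w : Layer → ℝ → ℝ) : tail a a w = 0 := by simp [tail]

theorem tail_of_le {a e : ℝ} (h : a ≤ e) (w : Layer → ℝ → ℝ) :
    tail a e w = ∫ z in a..e, w .upper z := by simp [tail, h]

theorem tail_of_ge {a e : ℝ} (h : e ≤ a) (w : Layer → ℝ → ℝ) :
    tail a e w = ∫ z in a..e, w .lower z := by simp [tail, h]

/-- Away from `a = e` the relevant piece is locally constant and the Leibniz rule applies. At `a =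
e` both pieces give the value zero, so the function switches between two differentiable branches,
and the corner is the difference of their derivatives. There the integral of `dX` vanishes, and only
the jump of `w` times the relative speed `e' - a'` remains. -/
theorem slopeBound_tail {L X : ℝ} {w : Layer → ℝ → ℝ → ℝ} (hw : ∀ s, SmoothStrip 1 L (w s))
    (hX : X ∈ Ioo 0 L) {a e : ℝ → ℝ} {a' e' : ℝ} (ha : HasDerivAt a a' X)
    (he : HasDerivAt e e' X) :
    SlopeBound (fun x => tail (a x) (e x) fun s => w s x)
      (e' * w (side (a X) (e X)) X (e X) - a' * w (side (a X) (e X)) X (a X)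
        + ∫ z in a X..e X, dX (w (side (a X) (e X))) X z)
      (if a X = e X then |(w .lower X (a X) - w .upper X (a X)) * (e' - a')| else 0) X := by
  have hd := fun s => (hw s).hasDerivAt_integral₂ hX ha he
  rcases lt_trichotomy (a X) (e X) with h | h | h
  · have hs : side (a X) (e X) = .upper := by simp [side, h.le]
    rw [if_neg h.ne, hs]
    refine (hd .upper).slopeBound.congr ?_
    filter_upwards [ha.continuousAt.eventually_lt he.continuousAt h] with x hx
      using tail_of_le hx.le _
  · have hs : side (a X) (e X) = .upper := by simp [side, h]
    rw [if_pos h, hs]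
    have key := SlopeBound.of_eq_or_eq (f := fun x => tail (a x) (e x) fun s => w s x)
      (Eventually.of_forall fun x => ?_) (hd .upper) (hd .lower) ?_ ?_
    · convert key using 2
      simp only [h, intervalIntegral.integral_same]
      ring
    · rcases le_total (a x) (e x) with hx | hx
      · exact Or.inl (tail_of_le hx _)
      · exact Or.inr (tail_of_ge hx _)
    · simp [h, tail_self]
    · simp [h, tail_self]
  · have hs : side (a X) (e X) = .lower := by simp [side, not_le.2 h]
    rw [if_neg h.ne', hs]
    refine (hd .lower).slopeBound.congr ?_
    filter_upwards [he.continuousAt.eventually_lt ha.continuousAt h] with x hx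
      using tail_of_ge hx.le _

namespace Medium

variable {n : ℕ} (W : Medium n) {H L X : ℝ}

theorem layerClosed_subset {s : Layer} (h0 : W.h0 X ∈ Ioo (-H) 0) :
    W.layerClosed H X s ⊆ Icc (-H) 0 := by
  cases s
  · exact Icc_subset_Icc_left h0.1.le
  · exact Icc_subset_Icc_right h0.2.le

theorem h0_mem_layerClosed (s : Layer) (h0 : W.h0 X ∈ Ioo (-H) 0) :
    W.h0 X ∈ W.layerClosed H X s := by
  cases s
  · exact left_mem_Icc.2 h0.2.le
  · exact right_mem_Icc.2 h0.1.le

theorem uIcc_subset_layerClosed {e : ℝ} (he : e ∈ Icc (-H) 0) :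
    uIcc (W.h0 X) e ⊆ W.layerClosed H X (side (W.h0 X) e) := by
  rcases le_or_gt (W.h0 X) e with h | h
  · simp only [side, h, if_true, uIcc_of_le h]
    exact Icc_subset_Icc_right he.2
  · simp only [side, not_le.2 h, if_false, uIcc_of_ge h.le]
    exact Icc_subset_Icc_left he.1

theorem abs_vint_le {F : Layer → ℝ → ℝ} {B : ℝ} (h0 : W.h0 X ∈ Ioo (-H) 0)
    (hF : ∀ s, ∀ z ∈ W.layerClosed H X s, |F s z| ≤ B) : |W.vint H X F| ≤ H * B := by
  have h1 : ‖∫ z in (-H)..(W.h0 X), F .lower z‖ ≤ B * |W.h0 X - -H| :=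
    intervalIntegral.norm_integral_le_of_norm_le_const fun z hz => by
      rw [uIoc_of_le h0.1.le] at hz
      exact hF .lower z (Ioc_subset_Icc_self hz)
  have h2 : ‖∫ z in (W.h0 X)..0, F .upper z‖ ≤ B * |0 - W.h0 X| :=
    intervalIntegral.norm_integral_le_of_norm_le_const fun z hz => by
      rw [uIoc_of_le h0.2.le] at hz
      exact hF .upper z (Ioc_subset_Icc_self hz)
  rw [abs_of_pos (by linarith [h0.1])] at h1
  rw [abs_of_pos (by linarith [h0.2])] at h2
  calc |W.vint H X F| ≤ _ := abs_add_le _ _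
    _ ≤ B * (W.h0 X - -H) + B * (0 - W.h0 X) := add_le_add h1 h2
    _ = _ := by ring

theorem vint_add {E : Type*} [NormedAddCommGroup E] [NormedSpace ℝ E] {F G : Layer → ℝ → E}
    (hF : ∀ s, Continuous (F s)) (hG : ∀ s, Continuous (G s)) :
    W.vint H X (fun s z => F s z + G s z) = W.vint H X F + W.vint H X G := by
  simp only [vint]
  rw [intervalIntegral.integral_add ((hF _).intervalIntegrable _ _)
    ((hG _).intervalIntegrable _ _), intervalIntegral.integral_add
    ((hF _).intervalIntegrable _ _) ((hG _).intervalIntegrable _ _)]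
  abel

theorem vint_sub {F G : Layer → ℝ → ℝ}
    (hF : ∀ s, Continuous (F s)) (hG : ∀ s, Continuous (G s)) :
    W.vint H X (fun s z => F s z - G s z) = W.vint H X F - W.vint H X G := by
  simp only [vint]
  rw [intervalIntegral.integral_sub ((hF _).intervalIntegrable _ _)
    ((hG _).intervalIntegrable _ _), intervalIntegral.integral_sub
    ((hF _).intervalIntegrable _ _) ((hG _).intervalIntegrable _ _)]
  ring

theorem vint_const_mul (c : ℝ) (F : Layer → ℝ → ℝ) :
    W.vint H X (fun s z => c * F s z) = c * W.vint H X F := by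
  simp only [vint, intervalIntegral.integral_const_mul]
  ring

theorem hasDerivAt_vint {w : Layer → ℝ → ℝ → ℝ} (hw : ∀ s, SmoothStrip 1 L (w s))
    (hX : X ∈ Ioo 0 L) {h0' : ℝ} (h0 : HasDerivAt W.h0 h0' X) :
    HasDerivAt (fun x => W.vint H x fun s => w s x)
      (W.vint H X (fun s => dX (w s) X)
        + h0' * (w .lower X (W.h0 X) - w .upper X (W.h0 X))) X := by
  have h1 := (hw .lower).hasDerivAt_integral₂ hX (hasDerivAt_const X (-H)) h0
  have h2 := (hw .upper).hasDerivAt_integral₂ hX h0 (hasDerivAt_const X 0)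
  have h3 := h1.add h2
  have e : W.vint H X (fun s => dX (w s) X) + h0' * (w .lower X (W.h0 X) - w .upper X (W.h0 X))
      = (h0' * w .lower X (W.h0 X) - 0 * w .lower X (-H)
          + ∫ z in -H..W.h0 X, dX (w .lower) X z)
        + (0 * w .upper X 0 - h0' * w .upper X (W.h0 X)
          + ∫ z in W.h0 X..0, dX (w .upper) X z) := by
    simp only [vint]; ring
  rw [e]
  exact h3

/-- The integral over the depth of a product of two functions, of which one jumps at the
perturbed interface and the other one at the unperturbed interface. -/
theorem integral_mul_of_jumps {g u : Layer → ℝ → ℝ} (hg : ∀ s, Continuous (g s))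
    (hu : ∀ s, Continuous (u s)) {e : ℝ} (h0 : W.h0 X ∈ Ioo (-H) 0) (he : e ∈ Ioo (-H) 0) :
    IntervalIntegrable (fun z => (if e < z then g .upper z else g .lower z)
        * (if W.h0 X < z then u .upper z else u .lower z)) volume (-H) 0 ∧
    ∫ z in (-H)..0, (if e < z then g .upper z else g .lower z)
        * (if W.h0 X < z then u .upper z else u .lower z)
      = W.vint H X (fun s z => g s z * u s z)
        + tail (W.h0 X) e (fun s z => (g .lower z - g .upper z) * u s z) := by
  have hc : ∀ s t, Continuous fun z => g s z * u t z := fun s t => (hg s).mul (hu t)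
  have hi : ∀ s t a b, IntervalIntegrable (fun z => g s z * u t z) volume a b :=
    fun s t a b => (hc s t).intervalIntegrable a b
  -- Between `h0` and `e` exactly one of the two factors has already switched its piece. The error
  -- against the unperturbed integral is the jump of `g` times the piece of `u` there; with signed
  -- integrals the two orders of `h0` and `e` give the same formula.
  rcases le_total (W.h0 X) e with h | h
  · obtain ⟨i, e1⟩ := intervalIntegral_of_three_pieces (a := -H) (b := W.h0 X) (c := e) (d := 0)
      (f := fun z => (if e < z then g .upper z else g .lower z)
        * (if W.h0 X < z then u .upper z else u .lower z)) h0.1.le h he.2.le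
      (hc .lower .lower) (hc .lower .upper) (hc .upper .upper)
      (fun z hz => by simp [not_lt.2 hz.2, not_lt.2 (hz.2.trans h)])
      (fun z hz => by simp [not_lt.2 hz.2, hz.1])
      (fun z hz => by simp [hz.1, h.trans_lt hz.1])
    refine ⟨i, ?_⟩
    rw [e1, tail_of_le h, vint]
    simp only [sub_mul]
    rw [intervalIntegral.integral_sub (hi _ _ _ _) (hi _ _ _ _),
      ← intervalIntegral.integral_add_adjacent_intervals (hi .upper .upper (W.h0 X) e)
        (hi .upper .upper e 0)]
    ring
  · obtain ⟨i, e1⟩ := intervalIntegral_of_three_pieces (a := -H) (b := e) (c := W.h0 X) (d := 0)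
      (f := fun z => (if e < z then g .upper z else g .lower z)
        * (if W.h0 X < z then u .upper z else u .lower z)) he.1.le h h0.2.le
      (hc .lower .lower) (hc .upper .lower) (hc .upper .upper)
      (fun z hz => by simp [not_lt.2 hz.2, not_lt.2 (hz.2.trans h)])
      (fun z hz => by simp [not_lt.2 hz.2, hz.1])
      (fun z hz => by simp [hz.1, h.trans_lt hz.1])
    refine ⟨i, ?_⟩
    rw [e1, tail_of_ge h, vint]
    simp only [sub_mul]
    rw [intervalIntegral.integral_sub (hi _ _ _ _) (hi _ _ _ _),
      ← intervalIntegral.integral_add_adjacent_intervals (hi .lower .lower (-H) e)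
        (hi .lower .lower e (W.h0 X)), intervalIntegral.integral_symm e (W.h0 X),
      intervalIntegral.integral_symm e (W.h0 X)]
    ring

end Medium

end ModePE

/-! ### Perturbation of the depth integrals by `γ1` and by the displacement of the interface. -/

namespace ModePE
namespace Medium

variable {n : ℕ} (W : Medium n) {H L ε K X Y : ℝ} {p : Fin (n + 1)}

/-- The reciprocal density in the strip `p`, continued to all `Y` and `z`. -/
def γtot (ε : ℝ) (p : Fin (n + 1)) (Y : ℝ) (s : Layer) (X z : ℝ) : ℝ :=
  W.γ0 s X z + ε * W.γ1 p s X Y z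

/-- The jump of the reciprocal density, times a function with a jump at the unperturbed
interface. -/
def jumpMul (ε : ℝ) (p : Fin (n + 1)) (u : Layer → ℝ → ℝ → ℝ) (Y : ℝ) (s : Layer) (X z : ℝ) : ℝ :=
  (W.γtot ε p Y .lower X z - W.γtot ε p Y .upper X z) * u s X z

/-- The difference between `∫ γ u dz` and `∫ γ0 u dz`. -/
noncomputable def corr (H ε : ℝ) (p : Fin (n + 1)) (u : Layer → ℝ → ℝ → ℝ) (X Y : ℝ) : ℝ :=
  ε * W.vint H X (fun s z => W.γ1 p s X Y z * u s X z)
    + tail (W.h0 X) (W.h ε p X Y) (fun s z => W.jumpMul ε p u Y s X z)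

/-- The leading term of `corr`, divided by `ε`. -/
noncomputable def corrLead (H : ℝ) (p : Fin (n + 1)) (u : Layer → ℝ → ℝ → ℝ) (X Y : ℝ) : ℝ :=
  W.vint H X (fun s z => W.γ1 p s X Y z * u s X z)
    + W.h1 p X Y * ((W.γ0 .lower X (W.h0 X) - W.γ0 .upper X (W.h0 X)) * u .upper X (W.h0 X))

variable {W}

theorem Regular.smooth_γ0 (hW : W.Regular H L ε) (s : Layer) : SmoothStrip 1 L (W.γ0 s) :=
  hW.γ0_smooth s

theorem Regular.smooth_γ1 (hW : W.Regular H L ε) (p : Fin (n + 1)) (s : Layer) (Y : ℝ) :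
    SmoothStrip 1 L (fun X z => W.γ1 p s X Y z) :=
  ContDiffOn.comp (hW.γ1_smooth p s) (f := fun q : ℝ × ℝ => (q.1, Y, q.2))
    (contDiff_fst.prodMk (contDiff_const.prodMk contDiff_snd)).contDiffOn
    fun _ hq => ⟨hq.1, mem_univ _⟩

theorem Regular.smooth_γtot (hW : W.Regular H L ε) (p : Fin (n + 1)) (s : Layer) (Y : ℝ) :
    SmoothStrip 1 L (W.γtot ε p Y s) :=
  (hW.smooth_γ0 s).add ((hW.smooth_γ1 p s Y).const_mul ε)

theorem Regular.smooth_jumpMul (hW : W.Regular H L ε) (p : Fin (n + 1)) (Y : ℝ)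
    {u : Layer → ℝ → ℝ → ℝ} (hu : ∀ s, SmoothStrip 1 L (u s)) (s : Layer) :
    SmoothStrip 1 L (W.jumpMul ε p u Y s) :=
  ((hW.smooth_γtot p .lower Y).sub (hW.smooth_γtot p .upper Y)).mul (hu s)

theorem Regular.hasDerivAt_h0 (hW : W.Regular H L ε) (hX : X ∈ Ioo 0 L) :
    HasDerivAt W.h0 (deriv W.h0 X) X :=
  ((hW.h0_smooth.contDiffAt (isOpen_Ioo.mem_nhds hX)).differentiableAt one_ne_zero).hasDerivAt

theorem Regular.hasDerivAt_h1 (hW : W.Regular H L ε) (hX : X ∈ Ioo 0 L) (p : Fin (n + 1)) (Y : ℝ) :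
    HasDerivAt (fun X => W.h1 p X Y) (dX (W.h1 p) X Y) X :=
  SmoothStrip.hasDerivAt_fst (hW.h1_smooth p) le_rfl hX Y

theorem Regular.hasDerivAt_h (hW : W.Regular H L ε) (hX : X ∈ Ioo 0 L) (p : Fin (n + 1)) (Y : ℝ) :
    HasDerivAt (fun X => W.h ε p X Y) (deriv W.h0 X + ε * dX (W.h1 p) X Y) X :=
  (hW.hasDerivAt_h0 hX).add ((hW.hasDerivAt_h1 hX p Y).const_mul ε)

/-- Separates the unperturbed integral, to which orthonormality or the definition of `C` applies,
from the correction `corr`, which is of order `ε` for bounded data. -/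
theorem integral_γ_mul (hW : W.Regular H L ε) (hX : X ∈ Ioo 0 L)
    (hp : p ∈ W.wet) (hY : Y ∈ W.strip p X) {u : Layer → ℝ → ℝ → ℝ}
    (hu : ∀ s, Continuous (u s X)) :
    IntervalIntegrable (fun z => (if W.h ε p X Y < z then W.γtot ε p Y .upper X z
        else W.γtot ε p Y .lower X z)
        * (if W.h0 X < z then u .upper X z else u .lower X z)) volume (-H) 0 ∧
    ∫ z in (-H)..0, (if W.h ε p X Y < z then W.γtot ε p Y .upper X z
        else W.γtot ε p Y .lower X z) * (if W.h0 X < z then u .upper X z else u .lower X z)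
      = W.vint H X (fun s z => W.γ0 s X z * u s X z) + W.corr H ε p u X Y := by
  have hg := fun s => (hW.smooth_γtot p s Y).continuous_snd hX
  obtain ⟨i, e⟩ := W.integral_mul_of_jumps (g := fun s z => W.γtot ε p Y s X z)
    (u := fun s z => u s X z) hg hu (hW.h0_mem X hX) (hW.h_mem X hX p hp Y hY)
  refine ⟨i, e.trans ?_⟩
  rw [corr, ← add_assoc]
  congr 1
  rw [← W.vint_const_mul, ← W.vint_add]
  · congr 1
    funext s z
    simp only [γtot]
    ring
  · exact fun s => ((hW.smooth_γ0 s).continuous_snd hX).mul (hu s)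
  · exact fun s => continuous_const.mul (((hW.smooth_γ1 p s Y).continuous_snd hX).mul (hu s))

theorem continuousOn_corr (hW : W.Regular H L ε) (p : Fin (n + 1)) {u : Layer → ℝ → ℝ → ℝ}
    (hu : ∀ s, ContinuousOn (fun q : ℝ × ℝ => u s q.1 q.2) (Ioo 0 L ×ˢ univ)) :
    ContinuousOn (fun q : ℝ × ℝ => W.corr H ε p u q.1 q.2) (Ioo 0 L ×ˢ univ) := by
  have hh0 : ContinuousOn (fun q : ℝ × ℝ => W.h0 q.1) (Ioo 0 L ×ˢ univ) :=
    hW.h0_smooth.continuousOn.comp continuousOn_fst fun _ hq => hq.1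
  have hh : ContinuousOn (fun q : ℝ × ℝ => W.h ε p q.1 q.2) (Ioo 0 L ×ˢ univ) :=
    hh0.add (continuousOn_const.mul (hW.h1_smooth p).continuousOn)
  have hu' : ∀ s, ContinuousOn (fun t : (ℝ × ℝ) × ℝ => u s t.1.1 t.2)
      ((Ioo 0 L ×ˢ univ) ×ˢ univ) := fun s =>
    (hu s).comp (f := fun t : (ℝ × ℝ) × ℝ => (t.1.1, t.2)) (by fun_prop)
      fun t ht => ⟨ht.1.1, mem_univ _⟩
  have hγ0 : ∀ s, ContinuousOn (fun t : (ℝ × ℝ) × ℝ => W.γ0 s t.1.1 t.2)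
      ((Ioo 0 L ×ˢ univ) ×ˢ univ) := fun s =>
    (hW.γ0_smooth s).continuousOn.comp (f := fun t : (ℝ × ℝ) × ℝ => (t.1.1, t.2)) (by fun_prop)
      fun t ht => ⟨ht.1.1, mem_univ _⟩
  have hγ1 : ∀ s, ContinuousOn (fun t : (ℝ × ℝ) × ℝ => W.γ1 p s t.1.1 t.1.2 t.2)
      ((Ioo 0 L ×ˢ univ) ×ˢ univ) := fun s =>
    (hW.γ1_smooth p s).continuousOn.comp (f := fun t : (ℝ × ℝ) × ℝ => (t.1.1, t.1.2, t.2))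
      (by fun_prop) fun t ht => ⟨ht.1.1, mem_univ _⟩
  have hγ : ∀ s, ContinuousOn (fun t : (ℝ × ℝ) × ℝ => W.γtot ε p t.1.2 s t.1.1 t.2)
      ((Ioo 0 L ×ˢ univ) ×ˢ univ) := fun s =>
    (hγ0 s).add (continuousOn_const.mul (hγ1 s))
  have hj : ∀ s, ContinuousOn (fun t : (ℝ × ℝ) × ℝ => W.jumpMul ε p u t.1.2 s t.1.1 t.2)
      ((Ioo 0 L ×ˢ univ) ×ˢ univ) := fun s => ((hγ _).sub (hγ _)).mul (hu' s)
  have hmax : ContinuousOn (fun q : ℝ × ℝ => max (W.h0 q.1) (W.h ε p q.1 q.2))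
    (Ioo 0 L ×ˢ univ) := hh0.sup hh
  have hmin : ContinuousOn (fun q : ℝ × ℝ => min (W.h0 q.1) (W.h ε p q.1 q.2))
    (Ioo 0 L ×ˢ univ) := hh0.inf hh
  exact (continuousOn_const.mul
    ((continuousOn_intervalIntegral (w := fun (q : ℝ × ℝ) z => W.γ1 p .lower q.1 q.2 z
        * u .lower q.1 z) ((hγ1 _).mul (hu' _)) continuousOn_const hh0).add
      (continuousOn_intervalIntegral (w := fun (q : ℝ × ℝ) z => W.γ1 p .upper q.1 q.2 z
        * u .upper q.1 z) ((hγ1 _).mul (hu' _)) hh0 continuousOn_const))).add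
    ((continuousOn_intervalIntegral (w := fun (q : ℝ × ℝ) z => W.jumpMul ε p u q.2 .upper q.1 z)
        (hj _) hh0 hmax).add
      (continuousOn_intervalIntegral (w := fun (q : ℝ × ℝ) z => W.jumpMul ε p u q.2 .lower q.1 z)
        (hj _) hh0 hmin))

end Medium
end ModePE

/-! ### Size, slope and leading term of the perturbation. -/

namespace ModePE

namespace SmoothStrip

variable {L X : ℝ} {w v : ℝ → ℝ → ℝ}

theorem dX_mul (hw : SmoothStrip 1 L w) (hv : SmoothStrip 1 L v) (hX : X ∈ Ioo 0 L) (z : ℝ) :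
    ModePE.dX (fun X z => w X z * v X z) X z
      = ModePE.dX w X z * v X z + w X z * ModePE.dX v X z :=
  ((hw.hasDerivAt_fst le_rfl hX z).mul (hv.hasDerivAt_fst le_rfl hX z)).deriv

theorem dX_sub (hw : SmoothStrip 1 L w) (hv : SmoothStrip 1 L v) (hX : X ∈ Ioo 0 L) (z : ℝ) :
    ModePE.dX (fun X z => w X z - v X z) X z = ModePE.dX w X z - ModePE.dX v X z :=
  ((hw.hasDerivAt_fst le_rfl hX z).sub (hv.hasDerivAt_fst le_rfl hX z)).deriv

theorem dX_add_const_mul (hw : SmoothStrip 1 L w) (hv : SmoothStrip 1 L v) (hX : X ∈ Ioo 0 L)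
    (c z : ℝ) : ModePE.dX (fun X z => w X z + c * v X z) X z
      = ModePE.dX w X z + c * ModePE.dX v X z :=
  ((hw.hasDerivAt_fst le_rfl hX z).add ((hv.hasDerivAt_fst le_rfl hX z).const_mul c)).deriv

end SmoothStrip

theorem abs_mul_le_of_le {a b A B : ℝ} (ha : |a| ≤ A) (hb : |b| ≤ B) : |a * b| ≤ A * B := by
  rw [abs_mul]
  exact mul_le_mul ha hb (abs_nonneg _) ((abs_nonneg _).trans ha)

theorem abs_add_le_of_le {a b A B : ℝ} (ha : |a| ≤ A) (hb : |b| ≤ B) : |a + b| ≤ A + B :=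
  (abs_add_le a b).trans (add_le_add ha hb)

theorem abs_sub_le_of_le {a b A B : ℝ} (ha : |a| ≤ A) (hb : |b| ≤ B) : |a - b| ≤ A + B :=
  (abs_sub a b).trans (add_le_add ha hb)

namespace Medium

variable {n : ℕ} {W : Medium n} {H L ε K X Y B U : ℝ} {p : Fin (n + 1)}
  {u : Layer → ℝ → ℝ → ℝ}

/-- As `ε ≤ 1`, the total reciprocal density and its `X`-derivative are at most `2B`, hence their
jumps at most `4B`. The product rule doubles the constant for the derivative. -/
theorem abs_jumpMul_le (hW : W.Regular H L ε) (hB : W.BoundedBy H L K) (hε : 0 < ε) (hε1 : ε ≤ 1)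
    (hKB : K ≤ B) (hX : X ∈ Ioo 0 L) (hp : p ∈ W.wet) (hY : Y ∈ W.strip p X)
    (hu : ∀ s, SmoothStrip 1 L (u s))
    (hU : ∀ s, ∀ z ∈ W.layerClosed H X s, |u s X z| ≤ U ∧ |dX (u s) X z| ≤ U) :
    ∀ s, ∀ z ∈ W.layerClosed H X s, |W.jumpMul ε p u Y s X z| ≤ 4 * B * U ∧
      |dX (W.jumpMul ε p u Y s) X z| ≤ 8 * B * U := by
  intro s z hz
  have hz' := W.layerClosed_subset (hW.h0_mem X hX) hz
  have h0 := fun s => hB.γ0_bound s X hX z hz'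
  have h1 := fun s => hB.γ1_bound X hX p hp Y hY s z hz'
  have hB0 : 0 ≤ B := ((abs_nonneg _).trans (h0 .upper).1).trans hKB
  have hg : ∀ s, |W.γtot ε p Y s X z| ≤ 2 * B := fun s => by
    calc |W.γtot ε p Y s X z| ≤ B + 1 * B :=
          abs_add_le_of_le ((h0 s).1.trans hKB) (abs_mul_le_of_le (by rwa [abs_of_pos hε])
            ((h1 s).1.trans hKB))
      _ = _ := by ring
  have hgX : ∀ s, |dX (W.γtot ε p Y s) X z| ≤ 2 * B := fun s => by
    have := SmoothStrip.dX_add_const_mul (hW.smooth_γ0 s) (hW.smooth_γ1 p s Y) hX ε z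
    rw [show dX (W.γtot ε p Y s) X z = _ from this]
    calc _ ≤ B + 1 * B :=
          abs_add_le_of_le ((h0 s).2.1.trans hKB) (abs_mul_le_of_le (by rwa [abs_of_pos hε])
            ((h1 s).2.trans hKB))
      _ = _ := by ring
  have hj : |W.γtot ε p Y .lower X z - W.γtot ε p Y .upper X z| ≤ 4 * B :=
    (abs_sub_le_of_le (hg _) (hg _)).trans_eq (by ring)
  refine ⟨abs_mul_le_of_le hj (hU s z hz).1, ?_⟩
  have e1 := SmoothStrip.dX_mul ((hW.smooth_γtot p .lower Y).sub (hW.smooth_γtot p .upper Y))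
    (hu s) hX z
  have e2 := SmoothStrip.dX_sub (hW.smooth_γtot p .lower Y) (hW.smooth_γtot p .upper Y) hX z
  rw [show dX (W.jumpMul ε p u Y s) X z = _ from e1, e2]
  calc _ ≤ (2 * B + 2 * B) * U + 4 * B * U :=
        abs_add_le_of_le (abs_mul_le_of_le (abs_sub_le_of_le (hgX _) (hgX _)) (hU s z hz).1)
          (abs_mul_le_of_le hj (hU s z hz).2)
    _ = _ := by ring

theorem abs_vint_γ1_le (hW : W.Regular H L ε) (hB : W.BoundedBy H L K)
    (hKB : K ≤ B) (hX : X ∈ Ioo 0 L) (hp : p ∈ W.wet) (hY : Y ∈ W.strip p X)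
    (hU : ∀ s, ∀ z ∈ W.layerClosed H X s, |u s X z| ≤ U) :
    |W.vint H X (fun s z => W.γ1 p s X Y z * u s X z)| ≤ H * (B * U) := by
  refine W.abs_vint_le (hW.h0_mem X hX) fun s z hz => ?_
  have hz' := W.layerClosed_subset (hW.h0_mem X hX) hz
  exact abs_mul_le_of_le ((hB.γ1_bound X hX p hp Y hY s z hz').1.trans hKB) (hU s z hz)

theorem abs_vint_slope_le (hW : W.Regular H L ε) (hB : W.BoundedBy H L K)
    (hKB : K ≤ B) (hX : X ∈ Ioo 0 L) {w : Layer → ℝ → ℝ → ℝ} {c c' : ℝ}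
    (hw : ∀ s, ∀ z ∈ W.layerClosed H X s, |w s X z| ≤ c ∧ |dX (w s) X z| ≤ c') :
    |W.vint H X (fun s => dX (w s) X)
        + deriv W.h0 X * (w .lower X (W.h0 X) - w .upper X (W.h0 X))| ≤ H * c' + B * (2 * c) := by
  have h0 := fun s => W.h0_mem_layerClosed s (hW.h0_mem X hX)
  refine abs_add_le_of_le (W.abs_vint_le (hW.h0_mem X hX) fun s z hz => (hw s z hz).2)
    (abs_mul_le_of_le ((hB.h0_bound X hX).trans hKB) ?_)
  exact (abs_sub_le_of_le (hw _ _ (h0 _)).1 (hw _ _ (h0 _)).1).trans_eq (by ring)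

/-- Bounds for `corr` and for its slope. -/
theorem corr_bounds (hH : 0 < H) (hW : W.Regular H L ε) (hB : W.BoundedBy H L K)
    (hε : 0 < ε) (hε1 : ε ≤ 1) (hKB : K ≤ B) (hB1 : 1 ≤ B) (hX : X ∈ Ioo 0 L) (hp : p ∈ W.wet)
    (hY : Y ∈ W.strip p X) (hu : ∀ s, SmoothStrip 1 L (u s))
    (hU : ∀ s, ∀ z ∈ W.layerClosed H X s, |u s X z| ≤ U ∧ |dX (u s) X z| ≤ U) :
    |W.corr H ε p u X Y| ≤ (2 * H + 30) * B ^ 3 * U * ε ∧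
    ∃ d b, SlopeBound (fun X => W.corr H ε p u X Y) d b X ∧ 0 ≤ b ∧
      |d| ≤ (2 * H + 30) * B ^ 3 * U ∧ b ≤ (2 * H + 30) * B ^ 3 * U * ε ∧
      ((W.h1 p X Y = 0 → dX (W.h1 p) X Y = 0) → b = 0) ∧
      (u .upper X (W.h0 X) = u .lower X (W.h0 X) →
        (∀ s, ∀ z ∈ W.layerClosed H X s, |deriv (u s X) z| ≤ U) →
        b = 0 ∧ |d| ≤ (2 * H + 30) * B ^ 3 * U * ε ∧
        |W.corr H ε p u X Y - ε * W.corrLead H p u X Y| ≤ (2 * H + 30) * B ^ 3 * U * ε ^ 2) := by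
  have h0mem := hW.h0_mem X hX
  have hmem := hW.h_mem X hX p hp Y hY
  obtain ⟨hh1, hh1X⟩ := hB.h1_bound X hX p hp Y hY
  have hh0X := (hB.h0_bound X hX).trans hKB
  replace hh1 := hh1.trans hKB
  replace hh1X : |dX (W.h1 p) X Y| ≤ B := hh1X.trans hKB
  have hεa : |ε| ≤ ε := (abs_of_pos hε).le
  have hB0 : 0 ≤ B := by linarith
  have hU0 : 0 ≤ U := (abs_nonneg _).trans (hU .upper _ (W.h0_mem_layerClosed _ h0mem)).1
  have hBU : 0 ≤ B * U := by positivity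
  have hBB : B ≤ B ^ 2 := by nlinarith
  have hBB' : B ^ 2 ≤ B ^ 3 := by nlinarith [sq_nonneg B]
  have hB2U : B * U ≤ B ^ 2 * U := by gcongr
  have hB3U : B ^ 2 * U ≤ B ^ 3 * U := by gcongr
  have hHB : H * (B * U) ≤ H * (B ^ 2 * U) := by gcongr
  have hHB' : H * (B ^ 2 * U) ≤ H * (B ^ 3 * U) := by gcongr
  set c := (2 * H + 30) * B ^ 3 * U with hc
  have hP2 : 0 ≤ B ^ 2 * U := by positivity
  have hP3 : 0 ≤ B ^ 3 * U := by positivity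
  have hHP : 0 ≤ H * (B ^ 3 * U) := by positivity
  have hcexp : c = 2 * (H * (B ^ 3 * U)) + 30 * (B ^ 3 * U) := by rw [hc]; ring
  have hw := abs_jumpMul_le hW hB hε hε1 hKB hX hp hY hu hU
  set s := side (W.h0 X) (W.h ε p X Y) with hs
  have hseg := W.uIcc_subset_layerClosed (X := X) (H := H) (e := W.h ε p X Y)
    ⟨hmem.1.le, hmem.2.le⟩
  -- The domain of the tail integrals has length `O(ε)`, and this is what makes them small.
  have hlen : |W.h ε p X Y - W.h0 X| ≤ ε * B := by
    rw [h, add_sub_cancel_left]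
    exact abs_mul_le_of_le hεa hh1
  have hVγ1 : ∀ s, ∀ z ∈ W.layerClosed H X s, |W.γ1 p s X Y z * u s X z| ≤ B * U ∧
      |dX (fun X z => W.γ1 p s X Y z * u s X z) X z| ≤ 2 * (B * U) := fun s z hz => by
    have h1 := hB.γ1_bound X hX p hp Y hY s z (W.layerClosed_subset h0mem hz)
    refine ⟨abs_mul_le_of_le (h1.1.trans hKB) (hU s z hz).1, ?_⟩
    rw [SmoothStrip.dX_mul (hW.smooth_γ1 p s Y) (hu s) hX]
    exact (abs_add_le_of_le (abs_mul_le_of_le (h1.2.trans hKB) (hU s z hz).1)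
      (abs_mul_le_of_le (h1.1.trans hKB) (hU s z hz).2)).trans_eq (by ring)
  have hV := abs_vint_γ1_le hW hB hKB hX hp hY fun s z hz => (hU s z hz).1
  have hT : |tail (W.h0 X) (W.h ε p X Y) (fun s z => W.jumpMul ε p u Y s X z)|
      ≤ 4 * B * U * (ε * B) := by
    rw [tail_eq, ← Real.norm_eq_abs]
    refine (intervalIntegral.norm_integral_le_of_norm_le_const fun z hz =>
      (hw s z (hseg (uIoc_subset_uIcc hz))).1).trans ?_
    gcongr
  have hTd : |∫ z in W.h0 X..W.h ε p X Y, dX (W.jumpMul ε p u Y s) X z|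
      ≤ 8 * B * U * (ε * B) := by
    rw [← Real.norm_eq_abs]
    refine (intervalIntegral.norm_integral_le_of_norm_le_const fun z hz =>
      (hw s z (hseg (uIoc_subset_uIcc hz))).2).trans ?_
    gcongr
  have hsl1 := (W.hasDerivAt_vint (H := H) (w := fun s X z => W.γ1 p s X Y z * u s X z)
    (fun s => (hW.smooth_γ1 p s Y).mul (hu s)) hX (hW.hasDerivAt_h0 hX)).const_mul ε
  have hsl1b := abs_vint_slope_le hW hB hKB hX (w := fun s X z => W.γ1 p s X Y z * u s X z) hVγ1
  set d1 := W.vint H X (fun s => dX (fun X z => W.γ1 p s X Y z * u s X z) X)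
    + deriv W.h0 X * (W.γ1 p .lower X Y (W.h0 X) * u .lower X (W.h0 X)
      - W.γ1 p .upper X Y (W.h0 X) * u .upper X (W.h0 X)) with hd1
  have hsl2 := slopeBound_tail (fun s => hW.smooth_jumpMul p Y hu s) hX (hW.hasDerivAt_h0 hX)
    (hW.hasDerivAt_h hX p Y)
  rw [← hs] at hsl2
  have hwe := (hw s _ (hseg right_mem_uIcc)).1
  have hwa := (hw s _ (hseg left_mem_uIcc)).1
  refine ⟨?_, _, _, hsl1.slopeBound.add hsl2, ?_, ?_, ?_, ?_, ?_⟩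
  · calc |W.corr H ε p u X Y| ≤ ε * (H * (B * U)) + 4 * B * U * (ε * B) :=
          abs_add_le_of_le (abs_mul_le_of_le hεa hV) hT
      _ = (H * (B * U) + 4 * (B ^ 2 * U)) * ε := by ring
      _ ≤ c * ε := by gcongr; linarith
  · split_ifs <;> positivity
  -- Without control of `∂u/∂z` the two end contributions of the tail are estimated separately, so
  -- the slope is only of order one. This is enough for `u = φ_{jX} φ_l`, whose matrix element
  -- enters the flux with a factor `ε`.
  · have hhX : |deriv W.h0 X + ε * dX (W.h1 p) X Y| ≤ B + 1 * B :=
      abs_add_le_of_le hh0X (abs_mul_le_of_le (hεa.trans hε1) hh1X)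
    calc _ ≤ 1 * (H * (2 * (B * U)) + B * (2 * (B * U)))
          + ((B + 1 * B) * (4 * B * U) + B * (4 * B * U) + 8 * B * U * (ε * B)) :=
        abs_add_le_of_le (abs_mul_le_of_le (hεa.trans hε1) hsl1b)
          (abs_add_le_of_le (abs_sub_le_of_le (abs_mul_le_of_le hhX hwe)
            (abs_mul_le_of_le hh0X hwa)) hTd)
      _ ≤ 1 * (H * (2 * (B * U)) + B * (2 * (B * U)))
          + ((B + 1 * B) * (4 * B * U) + B * (4 * B * U) + 8 * B * U * (1 * B)) := by gcongr
      _ = 2 * (H * (B * U)) + 22 * (B ^ 2 * U) := by ring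
      _ ≤ c := by rw [hcexp]; linarith
  · rw [zero_add]
    split_ifs with heq
    · have k1 := (hw .lower _ (W.h0_mem_layerClosed _ h0mem)).1
      have k2 := (hw .upper _ (W.h0_mem_layerClosed _ h0mem)).1
      rw [add_sub_cancel_left]
      calc _ ≤ (4 * B * U + 4 * B * U) * (ε * B) :=
            abs_mul_le_of_le (abs_sub_le_of_le k1 k2) (abs_mul_le_of_le hεa hh1X)
        _ = 8 * (B ^ 2 * U) * ε := by ring
        _ ≤ c * ε := by
            gcongr
            rw [hcexp]
            linarith
    · positivity
  · intro hnc
    rw [zero_add]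
    split_ifs with heq
    · have : W.h1 p X Y = 0 := by
        have : ε * W.h1 p X Y = 0 := by simpa [h] using heq
        exact (mul_eq_zero.1 this).resolve_left hε.ne'
      simp [hnc this]
    · rfl
  -- For `u` continuous across `h0`, as for `u = φ_j φ_l`, the jump of the density times `u` has the
  -- same value in both pieces at `h0`, so there is no corner. It also varies by only `O(ε)` between
  -- `h0` and `h`, so that the contributions of `h0_X` at the two ends nearly cancel and the slope
  -- gains a factor `ε`.
  · intro hcont hUz
    have hUz' : ∀ z ∈ uIcc (W.h0 X) (W.h ε p X Y), |deriv (u s X) z| ≤ U :=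
      fun z hz => hUz s z (hseg hz)
    -- the part of the integrand which is of order one
    set w0 : ℝ → ℝ := fun z => (W.γ0 .lower X z - W.γ0 .upper X z) * u s X z with hw0
    set w1 : ℝ → ℝ := fun z => (W.γ1 p .lower X Y z - W.γ1 p .upper X Y z) * u s X z with hw1
    have hdec : ∀ z, W.jumpMul ε p u Y s X z = w0 z + ε * w1 z := fun z => by
      simp only [jumpMul, γtot, hw0, hw1]; ring
    have hw1b : ∀ z ∈ uIcc (W.h0 X) (W.h ε p X Y), |ε * w1 z| ≤ 2 * (B * U) * ε := fun z hz => by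
      have hz' := W.layerClosed_subset h0mem (hseg hz)
      have h1 := fun s => (hB.γ1_bound X hX p hp Y hY s z hz').1.trans hKB
      exact (abs_mul_le_of_le hεa (abs_mul_le_of_le (abs_sub_le_of_le (h1 _) (h1 _))
        (hU s z (hseg hz)).1)).trans_eq (by ring)
    have hw0lip : ∀ z ∈ uIcc (W.h0 X) (W.h ε p X Y), |w0 z - w0 (W.h0 X)|
        ≤ 4 * (B ^ 2 * U) * ε := fun z hz => by
      have hder : ∀ t, HasDerivAt w0 ((deriv (W.γ0 .lower X) t - deriv (W.γ0 .upper X) t)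
          * u s X t + (W.γ0 .lower X t - W.γ0 .upper X t) * deriv (u s X) t) t := fun t =>
        (((hW.smooth_γ0 .lower).hasDerivAt_snd le_rfl hX t).sub
          ((hW.smooth_γ0 .upper).hasDerivAt_snd le_rfl hX t)).mul
            ((hu s).hasDerivAt_snd le_rfl hX t)
      have := (convex_uIcc (W.h0 X) (W.h ε p X Y)).norm_image_sub_le_of_norm_hasDerivWithin_le
        (f := w0) (C := 4 * (B * U)) (fun t _ => (hder t).hasDerivWithinAt)
        (fun t ht => by
          have h0 := fun s => hB.γ0_bound s X hX t (W.layerClosed_subset h0mem (hseg ht))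
          exact (abs_add_le_of_le (abs_mul_le_of_le (abs_sub_le_of_le
            ((h0 .lower).2.2.trans hKB) ((h0 .upper).2.2.trans hKB)) (hU s t (hseg ht)).1)
            (abs_mul_le_of_le (abs_sub_le_of_le ((h0 .lower).1.trans hKB)
              ((h0 .upper).1.trans hKB)) (hUz' t ht))).trans_eq (by ring)) left_mem_uIcc hz
      calc |w0 z - w0 (W.h0 X)| ≤ 4 * (B * U) * |z - W.h0 X| := this
        _ ≤ 4 * (B * U) * (ε * B) := by
            gcongr
            exact (abs_sub_left_of_mem_uIcc hz).trans hlen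
        _ = _ := by ring
    have hwdiff : |W.jumpMul ε p u Y s X (W.h ε p X Y) - W.jumpMul ε p u Y s X (W.h0 X)|
        ≤ 8 * (B ^ 2 * U) * ε := by
      rw [hdec, hdec]
      calc _ = |(w0 (W.h ε p X Y) - w0 (W.h0 X)) + (ε * w1 (W.h ε p X Y) - ε * w1 (W.h0 X))| := by
            ring_nf
        _ ≤ 4 * (B ^ 2 * U) * ε + (2 * (B * U) * ε + 2 * (B * U) * ε) :=
            abs_add_le_of_le (hw0lip _ right_mem_uIcc)
              (abs_sub_le_of_le (hw1b _ right_mem_uIcc) (hw1b _ left_mem_uIcc))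
        _ = (4 * (B ^ 2 * U) + 4 * (B * U)) * ε := by ring
        _ ≤ 8 * (B ^ 2 * U) * ε := by gcongr; linarith
    refine ⟨?_, ?_, ?_⟩
    · rw [zero_add]
      split_ifs with heq
      · have : W.jumpMul ε p u Y .lower X (W.h0 X) = W.jumpMul ε p u Y .upper X (W.h0 X) := by
          simp only [jumpMul, hcont]
        simp [this]
      · rfl
    · have e : (deriv W.h0 X + ε * dX (W.h1 p) X Y) * W.jumpMul ε p u Y s X (W.h ε p X Y)
          - deriv W.h0 X * W.jumpMul ε p u Y s X (W.h0 X)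
          = deriv W.h0 X * (W.jumpMul ε p u Y s X (W.h ε p X Y)
              - W.jumpMul ε p u Y s X (W.h0 X))
            + ε * dX (W.h1 p) X Y * W.jumpMul ε p u Y s X (W.h ε p X Y) := by ring
      rw [e]
      calc _ ≤ ε * (H * (2 * (B * U)) + B * (2 * (B * U)))
            + (B * (8 * (B ^ 2 * U) * ε) + ε * B * (4 * B * U) + 8 * B * U * (ε * B)) :=
          abs_add_le_of_le (abs_mul_le_of_le hεa hsl1b)
            (abs_add_le_of_le (abs_add_le_of_le (abs_mul_le_of_le hh0X hwdiff)
              (abs_mul_le_of_le (abs_mul_le_of_le hεa hh1X) hwe)) hTd)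
        _ = (2 * (H * (B * U)) + 14 * (B ^ 2 * U) + 8 * (B ^ 3 * U)) * ε := by ring
        _ ≤ c * ε := by gcongr; rw [hcexp]; linarith
    · have hu0 : w0 (W.h0 X)
          = (W.γ0 .lower X (W.h0 X) - W.γ0 .upper X (W.h0 X)) * u .upper X (W.h0 X) := by
        have : u s X (W.h0 X) = u .upper X (W.h0 X) := by
          cases s
          · rfl
          · exact hcont.symm
        simp only [hw0, this]
      -- The `γ1` integrals cancel, and since `h - h0 = ε h1` the difference is the error of
      -- freezing the integrand at `h0` over a length `O(ε)`: altogether `O(ε²)`.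
      have key : W.corr H ε p u X Y - ε * W.corrLead H p u X Y
          = (∫ z in W.h0 X..W.h ε p X Y, W.jumpMul ε p u Y s X z)
            - (W.h ε p X Y - W.h0 X) * w0 (W.h0 X) := by
        rw [corr, corrLead, tail_eq, ← hs, hu0, h]
        ring
      rw [key]
      refine (abs_intervalIntegral_sub_le ((hW.smooth_jumpMul p Y hu s).continuous_snd hX)
        (η := (4 * (B ^ 2 * U) + 2 * (B * U)) * ε) fun z hz => ?_).trans ?_
      · rw [hdec]
        calc _ = |(w0 z - w0 (W.h0 X)) + ε * w1 z| := by ring_nf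
          _ ≤ _ := abs_add_le_of_le (hw0lip z hz) (hw1b z hz)
          _ = _ := by ring
      · calc _ ≤ (4 * (B ^ 2 * U) + 2 * (B * U)) * ε * (ε * B) := by gcongr
          _ = (4 * (B ^ 3 * U) + 2 * (B ^ 2 * U)) * ε ^ 2 := by ring
          _ ≤ c * ε ^ 2 := by
              gcongr
              rw [hcexp]
              linarith

end Medium
end ModePE

/-! ### Orthonormality of the modes and symmetry of the coupling matrix. -/

namespace ModePE
namespace Modes

variable {n : ℕ} {ι : Type*} {D : Modes ι} {W : Medium n} {H L ε K X Y : ℝ} {p : Fin (n + 1)}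

/-- The products `φ_j φ_l`, as functions with a jump of the derivatives at the interface. -/
def φφ (D : Modes ι) (j l : ι) (s : Layer) (X z : ℝ) : ℝ := D.φ s j X z * D.φ s l X z

/-- The products `φ_{jX} φ_l`. -/
noncomputable def φXφ (D : Modes ι) (j l : ι) (s : Layer) (X z : ℝ) : ℝ :=
  dX (D.φ s j) X z * D.φ s l X z

theorem IsSpectral.smooth (hD : D.IsSpectral W H L) (s : Layer) (j : ι) :
    SmoothStrip 2 L (D.φ s j) := hD.φ_smooth s j

theorem IsSpectral.smooth_one (hD : D.IsSpectral W H L) (s : Layer) (j : ι) :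
    SmoothStrip 1 L (D.φ s j) := (hD.smooth s j).of_le one_le_two

theorem IsSpectral.smooth_dX (hD : D.IsSpectral W H L) (s : Layer) (j : ι) :
    SmoothStrip 1 L (dX (D.φ s j)) := (hD.smooth s j).dX (by norm_num)

theorem IsSpectral.smooth_φφ (hD : D.IsSpectral W H L) (j l : ι) (s : Layer) :
    SmoothStrip 1 L (D.φφ j l s) := (hD.smooth_one s j).mul (hD.smooth_one s l)

theorem IsSpectral.smooth_φXφ (hD : D.IsSpectral W H L) (j l : ι) (s : Layer) :
    SmoothStrip 1 L (D.φXφ j l s) := (hD.smooth_dX s j).mul (hD.smooth_one s l)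

theorem IsSpectral.contDiff_flux (hD : D.IsSpectral W H L) (hW : W.Regular H L ε)
    (hX : X ∈ Ioo 0 L) (s : Layer) (j : ι) :
    ContDiff ℝ 1 (fun z => W.γ0 s X z * deriv (D.φ s j X) z) :=
  ((hW.smooth_γ0 s).mul ((hD.smooth s j).deriv_snd (m := 1) (by norm_num))).contDiff_snd hX

/-- The equation for the modes holds up to the ends of the layers. -/
theorem IsSpectral.equation_closed (hD : D.IsSpectral W H L) (hW : W.Regular H L ε)
    (hX : X ∈ Ioo 0 L) (s : Layer) (j : ι) {z : ℝ} (hz : z ∈ W.layerClosed H X s) :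
    deriv (fun z' => W.γ0 s X z' * deriv (D.φ s j X) z') z
      = W.γ0 s X z * (D.k j X ^ 2 - W.n0 s X z ^ 2) * D.φ s j X z := by
  -- The equation is given inside the layers only. It passes to the closure by continuity, and the
  -- one-sided values at `h0` are needed for the brackets in `α`.
  have hcl : z ∈ closure (W.layerInterior H X s) := by
    have h0 := hW.h0_mem X hX
    cases s
    · rw [Medium.layerInterior, closure_Ioo h0.2.ne]; exact hz
    · rw [Medium.layerInterior, closure_Ioo h0.1.ne]; exact hz
  have hn0 : Continuous (W.n0 s X) :=
    (hW.n0_cont s).comp_continuous (f := fun z => (X, z)) (by fun_prop) fun _ => ⟨hX, mem_univ _⟩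
  have c1 := (hD.contDiff_flux hW hX s j).continuous_deriv le_rfl
  have c2 := (hW.smooth_γ0 s).continuous_snd hX
  have c3 := (hD.smooth s j).continuous_snd hX
  have hclosed : IsClosed {z | deriv (fun z' => W.γ0 s X z' * deriv (D.φ s j X) z') z
      = W.γ0 s X z * (D.k j X ^ 2 - W.n0 s X z ^ 2) * D.φ s j X z} :=
    isClosed_eq c1 ((c2.mul (continuous_const.sub (hn0.pow 2))).mul c3)
  refine closure_minimal (fun z hz => ?_) hclosed hcl
  have := hD.equation j X hX s z hz
  simp only [mem_ofPred_eq]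
  linear_combination this

/-- The Lagrange identity: the bracket `γ0 φ_{jz} φ_l - γ0 φ_{lz} φ_j` has derivative `(k_j² - k_l²)
γ0 φ_j φ_l`, vanishes at the surface and at the bottom, and is continuous across `h0`. For `j ≠ l`
the factor `k_j² - k_l²` is nonzero because the wavenumbers are positive and distinct. -/
theorem IsSpectral.orthonormal [DecidableEq ι] (hD : D.IsSpectral W H L) (hW : W.Regular H L ε)
    (hX : X ∈ Ioo 0 L) (j l : ι) :
    W.vint H X (fun s z => W.γ0 s X z * D.φφ j l s X z) = if j = l then 1 else 0 := by
  split_ifs with hjl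
  · subst hjl
    refine Eq.trans ?_ (hD.normalized j X hX)
    congr 1
    funext s z
    simp only [φφ]
    ring
  have h0 := hW.h0_mem X hX
  set F : Layer → ℝ → ℝ := fun s z => W.γ0 s X z * deriv (D.φ s j X) z * D.φ s l X z
    - W.γ0 s X z * deriv (D.φ s l X) z * D.φ s j X z with hF
  have hder : ∀ s, ∀ z ∈ W.layerClosed H X s, HasDerivAt (F s)
      ((D.k j X ^ 2 - D.k l X ^ 2) * (W.γ0 s X z * D.φφ j l s X z)) z := fun s z hz => by
    have hf := fun j => ((hD.contDiff_flux hW hX s j).differentiable one_ne_zero z).hasDerivAt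
    have hφ := fun j => (hD.smooth_one s j).hasDerivAt_snd le_rfl hX z
    have h := ((hf j).mul (hφ l)).sub ((hf l).mul (hφ j))
    rw [hD.equation_closed hW hX s j hz, hD.equation_closed hW hX s l hz] at h
    refine HasDerivAt.congr_deriv (f := F s) h ?_
    simp only [φφ]
    ring
  have hc : ∀ s, Continuous fun z => (D.k j X ^ 2 - D.k l X ^ 2)
      * (W.γ0 s X z * D.φφ j l s X z) := fun s => continuous_const.mul
    (((hW.smooth_γ0 s).continuous_snd hX).mul ((hD.smooth_φφ j l s).continuous_snd hX))
  have e1 := intervalIntegral.integral_eq_sub_of_hasDerivAt (a := -H) (b := W.h0 X)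
    (fun z hz => hder .lower z (by rwa [uIcc_of_le h0.1.le] at hz))
    ((hc .lower).intervalIntegrable _ _)
  have e2 := intervalIntegral.integral_eq_sub_of_hasDerivAt (a := W.h0 X) (b := 0)
    (fun z hz => hder .upper z (by rwa [uIcc_of_le h0.2.le] at hz))
    ((hc .upper).intervalIntegrable _ _)
  have b1 : F .lower (-H) = 0 := by simp [hF, hD.bottom _ X hX]
  have b2 : F .upper 0 = 0 := by simp [hF, hD.top _ X hX]
  have b3 : F .lower (W.h0 X) = F .upper (W.h0 X) := by
    simp only [hF, hD.flux_continuous _ X hX, hD.continuous _ X hX]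
  have key : (D.k j X ^ 2 - D.k l X ^ 2) * W.vint H X (fun s z => W.γ0 s X z * D.φφ j l s X z)
      = 0 := by
    rw [← W.vint_const_mul, Medium.vint, e1, e2, b1, b2, b3]
    ring
  refine (mul_eq_zero.1 key).resolve_left fun h => ?_
  have hk : D.k j X ≠ D.k l X := fun h => hjl (hD.k_ne X hX h)
  have h1 := hD.k_pos j X hX
  have h2 := hD.k_pos l X hX
  rcases mul_eq_zero.1 (show (D.k j X - D.k l X) * (D.k j X + D.k l X) = 0 by linarith) with h | h
  · exact hk (sub_eq_zero.1 h)
  · linarith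

/-- The structure of the matrix `α` for real `ν`. -/
theorem IsSpectral.exists_α_eq (hD : D.IsSpectral W H L) (hW : W.Regular H L ε)
    (hX : X ∈ Ioo 0 L) (hν : ∀ s, ∀ z ∈ Icc (-H) 0, (W.ν p s X Y z).im = 0) :
    ∃ a : ι → ι → ℝ,
      (∀ l j, D.α W H p l j X Y
        = (a l j : ℂ) - Complex.I * D.k j X * ((D.C W H l j X - D.C W H j l X : ℝ) : ℂ)) ∧
      ∀ l j, a l j + D.k j X * (D.k j X - D.k l X) * W.corrLead H p (D.φφ j l) X Y
        = a j l + D.k l X * (D.k l X - D.k j X) * W.corrLead H p (D.φφ l j) X Y := by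
  have h0 := hW.h0_mem X hX
  have hn0 : ∀ s, Continuous (W.n0 s X) := fun s =>
    (hW.n0_cont s).comp_continuous (f := fun z => (X, z)) (by fun_prop) fun _ => ⟨hX, mem_univ _⟩
  have hνre : ∀ l j, W.vint H X (fun s z =>
      (W.γ0 s X z : ℂ) * W.ν p s X Y z * (D.φ s j X z : ℂ) * (D.φ s l X z : ℂ))
      = ((W.vint H X fun s z =>
          W.γ0 s X z * (W.ν p s X Y z).re * D.φ s j X z * D.φ s l X z : ℝ) : ℂ) := fun l j => by
    have hpt : ∀ s, ∀ z ∈ Icc (-H) 0,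
        (W.γ0 s X z : ℂ) * W.ν p s X Y z * (D.φ s j X z : ℂ) * (D.φ s l X z : ℂ)
        = ((W.γ0 s X z * (W.ν p s X Y z).re * D.φ s j X z * D.φ s l X z : ℝ) : ℂ) :=
      fun s z hz => by
        have : W.ν p s X Y z = ((W.ν p s X Y z).re : ℂ) :=
          Complex.ext (by simp) (by simpa using hν s z hz)
        rw [this]
        push_cast
        simp
    simp only [Medium.vint]
    push_cast
    rw [← intervalIntegral.integral_ofReal, ← intervalIntegral.integral_ofReal]
    congr 1
    · refine intervalIntegral.integral_congr fun z hz => hpt _ z ?_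
      rw [uIcc_of_le h0.1.le] at hz
      exact ⟨hz.1, hz.2.trans h0.2.le⟩
    · refine intervalIntegral.integral_congr fun z hz => hpt _ z ?_
      rw [uIcc_of_le h0.2.le] at hz
      exact ⟨h0.1.le.trans hz.1, hz.2⟩
  -- The witness is `α` without its `C` term, with `ν` replaced by its real part.
  refine ⟨fun l j => (W.vint H X fun s z =>
          W.γ0 s X z * (W.ν p s X Y z).re * D.φ s j X z * D.φ s l X z)
      + (W.vint H X fun s z =>
        W.γ1 p s X Y z * (W.n0 s X z ^ 2 - D.k j X ^ 2) * D.φ s j X z * D.φ s l X z)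
      - (W.vint H X fun s z =>
        W.γ1 p s X Y z * deriv (D.φ s j X) z * deriv (D.φ s l X) z)
      + (W.h1 p X Y * D.φ .upper l X (W.h0 X) *
          (deriv (fun z => W.γ0 .upper X z * deriv (D.φ .upper j X) z) (W.h0 X)
            - deriv (fun z => W.γ0 .lower X z * deriv (D.φ .lower j X) z) (W.h0 X))
        - W.h1 p X Y * (W.γ0 .upper X (W.h0 X) * deriv (D.φ .upper j X) (W.h0 X))
            * (W.γ0 .upper X (W.h0 X) * deriv (D.φ .upper l X) (W.h0 X))
            * (1 / W.γ0 .upper X (W.h0 X) - 1 / W.γ0 .lower X (W.h0 X))),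
    fun l j => ?_, fun l j => ?_⟩
  · rw [α, hνre]
    simp only [Complex.ofReal_add, Complex.ofReal_sub (_ + _)]
    ring
  · have hφ := fun s j => (hD.smooth_one s j).continuous_snd hX
    have hγ1 := fun s => (hW.smooth_γ1 p s Y).continuous_snd hX
    -- Isolates `k_j²` in the `γ1` integral. By the mode equation at `h0` the bracket with `(γ0
    -- φ_{jz})_z` equals `h1 φ_j φ_l` times the jump of `γ0 (k_j² - n0²)`. Together the two `k_j²`
    -- contributions are `-k_j²` times `corrLead`; every other term is symmetric in `j, l`.
    have hR : ∀ l j, (W.vint H X fun s z =>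
          W.γ1 p s X Y z * (W.n0 s X z ^ 2 - D.k j X ^ 2) * D.φ s j X z * D.φ s l X z)
        = (W.vint H X fun s z => W.γ1 p s X Y z * W.n0 s X z ^ 2 * (D.φ s j X z * D.φ s l X z))
          - D.k j X ^ 2 * W.vint H X fun s z => W.γ1 p s X Y z * D.φφ j l s X z := fun l j => by
      rw [← W.vint_const_mul, ← W.vint_sub]
      · congr 1
        funext s z
        simp only [φφ]
        ring
      · exact fun s => ((hγ1 s).mul ((hn0 s).pow 2)).mul ((hφ s j).mul (hφ s l))
      · exact fun s => continuous_const.mul ((hγ1 s).mul ((hφ s j).mul (hφ s l)))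
    have hs1 : (W.vint H X fun s z =>
          W.γ0 s X z * (W.ν p s X Y z).re * D.φ s j X z * D.φ s l X z)
        = W.vint H X fun s z =>
          W.γ0 s X z * (W.ν p s X Y z).re * D.φ s l X z * D.φ s j X z := by
      simp only [mul_right_comm]
    have hs2 : (W.vint H X fun s z =>
          W.γ1 p s X Y z * deriv (D.φ s j X) z * deriv (D.φ s l X) z)
        = W.vint H X fun s z =>
          W.γ1 p s X Y z * deriv (D.φ s l X) z * deriv (D.φ s j X) z := by
      simp only [mul_right_comm]
    have hs3 : (W.vint H X fun s z =>
          W.γ1 p s X Y z * W.n0 s X z ^ 2 * (D.φ s j X z * D.φ s l X z))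
        = W.vint H X fun s z =>
          W.γ1 p s X Y z * W.n0 s X z ^ 2 * (D.φ s l X z * D.φ s j X z) := by
      simp only [mul_comm (D.φ _ j X _)]
    have hs4 : (W.vint H X fun s z => W.γ1 p s X Y z * D.φφ j l s X z)
        = W.vint H X fun s z => W.γ1 p s X Y z * D.φφ l j s X z := by
      simp only [φφ, mul_comm (D.φ _ j X _)]
    simp only [hR, Medium.corrLead,
      fun s j => hD.equation_closed hW hX s j (W.h0_mem_layerClosed s h0)]
    rw [hs1, hs2, hs3, hs4]
    simp only [φφ, ← hD.continuous _ X hX]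
    ring

end Modes
end ModePE

/-! ### Slope of the flux density: cancellation of the terms of order one. -/

namespace ModePE

theorem _root_.HasDerivAt.complex_im {f : ℝ → ℂ} {f' : ℂ} {x : ℝ} (h : HasDerivAt f f' x) :
    HasDerivAt (fun x => (f x).im) f'.im x :=
  Complex.imCLM.hasFDerivAt.comp_hasDerivAt x h

theorem _root_.HasDerivAt.complex_conj {f : ℝ → ℂ} {f' : ℂ} {x : ℝ} (h : HasDerivAt f f' x) :
    HasDerivAt (fun x => conj (f x)) (conj f') x := h.star

theorem sum_sum_eq_zero_of_antisymm {ι : Type*} [Fintype ι] {F : ι → ι → ℝ}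
    (h : ∀ j l, F j l = -F l j) : ∑ j, ∑ l, F j l = 0 := by
  have h1 : ∑ j, ∑ l, F j l = -∑ j, ∑ l, F j l := by
    conv_lhs => rw [Finset.sum_comm]
    rw [← Finset.sum_neg_distrib]
    refine Finset.sum_congr rfl fun j _ => ?_
    rw [← Finset.sum_neg_distrib]
    exact Finset.sum_congr rfl fun l _ => h l j
  linarith

theorem abs_sum_sum_le {ι : Type*} [Fintype ι] {F : ι → ι → ℝ} {c : ℝ}
    (h : ∀ j l, |F j l| ≤ c) : |∑ j, ∑ l, F j l| ≤ (Fintype.card ι : ℝ) ^ 2 * c := by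
  have h1 : ∀ j, |∑ l, F j l| ≤ Fintype.card ι * c := fun j => by
    refine (Finset.abs_sum_le_sum_abs _ _).trans ?_
    simpa using Finset.sum_le_sum fun l (_ : l ∈ Finset.univ) => h j l
  refine (Finset.abs_sum_le_sum_abs _ _).trans ?_
  have := Finset.sum_le_sum fun j (_ : j ∈ Finset.univ) => h1 j
  simp only [Finset.sum_const, Finset.card_univ, nsmul_eq_mul] at this
  calc _ ≤ _ := this
    _ = _ := by ring

theorem abs_sum_le {ι : Type*} [Fintype ι] {F : ι → ℝ} {c : ℝ}
    (h : ∀ j, |F j| ≤ c) : |∑ j, F j| ≤ Fintype.card ι * c := by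
  refine (Finset.abs_sum_le_sum_abs _ _).trans ?_
  simpa using Finset.sum_le_sum fun l (_ : l ∈ Finset.univ) => h l

/-- The density (with respect to `Y`) of the energy flux, in terms of the wavenumbers `k`, the
amplitudes `A`, their derivatives `B`, the oscillating exponentials `e`, and the matrix elements
`δ_{jl} + m j l = ∫ γ φ_j φ_l dz` and `N j l = ∫ γ φ_{jX} φ_l dz`. -/
noncomputable def fluxDensity {ι : Type*} [Fintype ι] (ε : ℝ) (k : ι → ℝ) (A B e : ι → ℂ)
    (m N : ι → ι → ℝ) : ℝ :=
  ∑ j, (conj (A j) * (Complex.I * k j * A j + ε * B j)).im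
    + ∑ j, ∑ l, ((conj (A l * e l) * ((Complex.I * k j * A j + ε * B j) * e j)).im * m j l
        + ε * (conj (A l * e l) * (A j * e j)).im * N j l)

section Bilinear

variable {ι : Type*} {ε : ℝ} {X : ℝ} {A B e : ι → ℝ → ℂ} {G : ι → ℂ} {k : ι → ℝ → ℝ} {k' : ι → ℝ}

/-- The derivatives of the two exponentials combine to the factor `i (k_j - k_l) / ε`, which turns
the imaginary part into a real part. The remaining terms carry no negative power of `ε`. -/
theorem hasDerivAt_im_conj_mul (j l : ι) (hA : ∀ j, HasDerivAt (A j) (B j X) X)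
    (he : ∀ j, HasDerivAt (e j) (Complex.I * (k j X / ε : ℝ) * e j X) X) :
    HasDerivAt (fun X => (conj (A l X * e l X) * (A j X * e j X)).im)
      ((k j X - k l X) / ε * (conj (A l X * e l X) * (A j X * e j X)).re
        + (conj (B l X * e l X) * (A j X * e j X) + conj (A l X * e l X) * (B j X * e j X)).im)
      X := by
  have h := ((((hA l).mul (he l)).complex_conj).mul ((hA j).mul (he j))).complex_im
  refine h.congr_deriv ?_
  simp only [Pi.mul_apply, map_mul, map_add, Complex.conj_I, Complex.conj_ofReal]
  have : ∀ q x y : ℂ, ∀ t : ℝ, q = (t : ℂ) * (Complex.I * x) + y →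
      q.im = t * x.re + y.im := by
    rintro q x y t rfl
    simp
  refine this _ _ _ _ ?_
  push_cast
  ring

/-- The factor `i (k_j - k_l) / ε` from the exponentials acts on `i k_j A_j`, giving the singular
term, and on `ε B_j`, giving a term of order one. Only the former is kept apart. -/
theorem hasDerivAt_im_conj_mul_flux (hε : 0 < ε) (j l : ι)
    (hA : ∀ j, HasDerivAt (A j) (B j X) X) (hB : ∀ j, HasDerivAt (B j) (G j) X)
    (hk : ∀ j, HasDerivAt (k j) (k' j) X)
    (he : ∀ j, HasDerivAt (e j) (Complex.I * (k j X / ε : ℝ) * e j X) X) :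
    HasDerivAt (fun X => (conj (A l X * e l X)
        * ((Complex.I * k j X * A j X + ε * B j X) * e j X)).im)
      (-(k j X * (k j X - k l X) / ε) * (conj (A l X * e l X) * (A j X * e j X)).im
        + (conj (B l X * e l X) * ((Complex.I * k j X * A j X + ε * B j X) * e j X)
          + conj (A l X * e l X) * ((Complex.I * k' j * A j X + Complex.I * k j X * B j X
            + ε * G j + Complex.I * (k j X - k l X : ℝ) * B j X) * e j X)).im)
      X := by
  have hkc : HasDerivAt (fun X => (k j X : ℂ)) (k' j : ℂ) X := (hk j).ofReal_comp
  have h := ((((hA l).mul (he l)).complex_conj).mul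
    ((((hkc.const_mul Complex.I).mul (hA j)).add ((hB j).const_mul (ε : ℂ))).mul
      (he j))).complex_im
  refine h.congr_deriv ?_
  simp only [Pi.mul_apply, Pi.add_apply, map_mul, map_add, Complex.conj_I, Complex.conj_ofReal]
  have : ∀ q x y : ℂ, ∀ t : ℝ, q = (t : ℂ) * x + y → q.im = t * x.im + y.im := by
    rintro q x y t rfl
    simp
  refine this _ _ _ _ ?_
  have hε' : (ε : ℂ) ≠ 0 := by exact_mod_cast hε.ne'
  push_cast
  field_simp
  linear_combination ((k j X : ℂ) * (k j X - k l X) * (starRingEnd ℂ) (A l X)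
    * (starRingEnd ℂ) (e l X) * A j X * e j X) * Complex.I_sq

/-- On the diagonal the exponentials cancel. Since `Im(B^* i k A) = Im(A^* i k B)` and `B^* B` is
real, the order-one part is `A_j^*` times the transport part `2 i k_j A_{j,X} + i k_{j,X} A_j` of
the parabolic equation. -/
theorem hasDerivAt_im_conj_mul_diag (j : ι)
    (hA : ∀ j, HasDerivAt (A j) (B j X) X) (hB : ∀ j, HasDerivAt (B j) (G j) X)
    (hk : ∀ j, HasDerivAt (k j) (k' j) X) :
    HasDerivAt (fun X => (conj (A j X) * (Complex.I * k j X * A j X + ε * B j X)).im)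
      ((conj (A j X) * (2 * Complex.I * k j X * B j X + Complex.I * k' j * A j X)).im
        + ε * (conj (A j X) * G j).im) X := by
  have hkc : HasDerivAt (fun X => (k j X : ℂ)) (k' j : ℂ) X := (hk j).ofReal_comp
  have h := (((hA j).complex_conj).mul
    (((hkc.const_mul Complex.I).mul (hA j)).add ((hB j).const_mul (ε : ℂ)))).complex_im
  refine h.congr_deriv ?_
  simp only [Pi.mul_apply, Pi.add_apply, Complex.mul_im, Complex.add_im, Complex.add_re,
    Complex.mul_re, Complex.conj_re, Complex.conj_im, Complex.I_re, Complex.I_im,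
    Complex.ofReal_re, Complex.ofReal_im, Complex.re_ofNat, Complex.im_ofNat]
  ring

end Bilinear

theorem norm_mul_norm_le {x y : ℂ} {S : ℝ} (hx : ‖x‖ ^ 2 ≤ S) (hy : ‖y‖ ^ 2 ≤ S) :
    ‖x‖ * ‖y‖ ≤ S := by nlinarith [sq_nonneg (‖x‖ - ‖y‖)]

section Slope

variable {ι : Type*} [Fintype ι] {ε b c X S : ℝ} {A B e : ι → ℝ → ℂ} {G : ι → ℂ}
  {k : ι → ℝ → ℝ} {k' : ι → ℝ} {m N : ι → ι → ℝ → ℝ} {m' N' β : ι → ι → ℝ}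

/-- The slope of the flux density is bounded by `b ^ 2 c S`, and it is that of the transversal
flux up to terms of order `ε`. -/
theorem slopeBound_fluxDensity (hε : 0 < ε) (hε1 : ε ≤ 1) (hb : 1 ≤ b) (hc : 1 ≤ c)
    (hA : ∀ j, HasDerivAt (A j) (B j X) X) (hB : ∀ j, HasDerivAt (B j) (G j) X)
    (hk : ∀ j, HasDerivAt (k j) (k' j) X)
    (he : ∀ j, HasDerivAt (e j) (Complex.I * (k j X / ε : ℝ) * e j X) X)
    (he1 : ∀ j, ‖e j X‖ = 1)
    (hm : ∀ j l, HasDerivAt (m j l) (m' j l) X)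
    (hN : ∀ j l, SlopeBound (N j l) (N' j l) (β j l) X)
    (hβ : ∀ j l, 0 ≤ β j l) (hβc : ∀ j l, β j l ≤ c)
    (hS : ∀ j, ‖A j X‖ ^ 2 ≤ S ∧ ‖B j X‖ ^ 2 ≤ S ∧ ‖G j‖ ^ 2 ≤ S)
    (hkb : ∀ j, |k j X| ≤ b) (hkb' : ∀ j, |k' j| ≤ b)
    (hmc : ∀ j l, |m j l X| ≤ c * ε) (hmc' : ∀ j l, |m' j l| ≤ c * ε)
    (hNc : ∀ j l, |N j l X| ≤ c) (hNc' : ∀ j l, |N' j l| ≤ c) :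
    ∃ d b₀, SlopeBound (fun X => fluxDensity ε (fun j => k j X) (fun j => A j X)
        (fun j => B j X) (fun j => e j X) (fun j l => m j l X) (fun j l => N j l X)) d b₀ X ∧
      0 ≤ b₀ ∧ |d| + b₀ ≤ (20 * Fintype.card ι ^ 2 + 4 * Fintype.card ι) * b ^ 2 * c * S ∧
      ((∀ j l, β j l = 0) → b₀ = 0) ∧
      ∀ (m₁ C a : ι → ι → ℝ) (Z : ι → ℂ), (∀ j l, |m j l X - ε * m₁ j l| ≤ c * ε ^ 2) →
        (∀ j l, |N j l X - C j l| ≤ c * ε) →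
        (∀ l j, a l j + k j X * (k j X - k l X) * m₁ j l
          = a j l + k l X * (k l X - k j X) * m₁ l j) →
        (∀ l, 2 * Complex.I * k l X * B l X + Complex.I * k' l * A l X + Z l
          + ∑ j, ((a l j : ℂ) - Complex.I * k j X * ((C l j - C j l : ℝ) : ℂ)) * A j X
            * (e j X * conj (e l X)) = 0) →
        |d + ∑ j, (conj (A j X) * Z j).im| + b₀
          ≤ (20 * Fintype.card ι ^ 2 + 4 * Fintype.card ι) * b ^ 2 * c * S * ε := by
  -- The bilinear forms entering the density. The parts `rv` and `ru` are what remains of the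
  -- derivatives of `v` and `u` once the terms with `1/ε` are removed.
  set v : ι → ι → ℝ → ℝ := fun j l X => (conj (A l X * e l X) * (A j X * e j X)).im with hv
  set w : ι → ι → ℝ := fun j l => (conj (A l X * e l X) * (A j X * e j X)).re with hw
  set u : ι → ι → ℝ → ℝ := fun j l X =>
    (conj (A l X * e l X) * ((Complex.I * k j X * A j X + ε * B j X) * e j X)).im with hu
  set rv : ι → ι → ℝ := fun j l =>
    (conj (B l X * e l X) * (A j X * e j X) + conj (A l X * e l X) * (B j X * e j X)).im with hrv
  set ru : ι → ι → ℝ := fun j l =>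
    (conj (B l X * e l X) * ((Complex.I * k j X * A j X + ε * B j X) * e j X)
      + conj (A l X * e l X) * ((Complex.I * k' j * A j X + Complex.I * k j X * B j X
        + ε * G j + Complex.I * (k j X - k l X : ℝ) * B j X) * e j X)).im with hru
  have hεc : ‖(ε : ℂ)‖ ≤ 1 := by simpa [abs_of_pos hε] using hε1
  have hkk : ∀ j l, |k j X - k l X| ≤ 2 * b := fun j l =>
    (abs_sub_le_of_le (hkb j) (hkb l)).trans_eq (by ring)
  -- bounds for the bilinear expressions
  have hvS : ∀ j l, |v j l X| ≤ S := fun j l => by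
    refine (Complex.abs_im_le_norm _).trans ?_
    simpa [he1] using norm_mul_norm_le (hS l).1 (hS j).1
  have hwS : ∀ j l, |w j l| ≤ S := fun j l => by
    refine (Complex.abs_re_le_norm _).trans ?_
    simpa [he1] using norm_mul_norm_le (hS l).1 (hS j).1
  have hS0 : ∀ j : ι, 0 ≤ S := fun j => (sq_nonneg _).trans (hS j).1
  have hrvS : ∀ j l, |rv j l| ≤ 2 * S := fun j l => by
    refine (Complex.abs_im_le_norm _).trans ((norm_add_le _ _).trans ?_)
    have h1 := norm_mul_norm_le (hS l).2.1 (hS j).1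
    have h2 := norm_mul_norm_le (hS l).1 (hS j).2.1
    simp only [norm_mul, RCLike.norm_conj, he1, mul_one]
    linarith
  have hflux : ∀ j, ∀ x : ℂ, ‖x‖ ^ 2 ≤ S →
      ‖x‖ * ‖Complex.I * k j X * A j X + ε * B j X‖ ≤ 2 * b * S := fun j x hx => by
    have h1 := norm_mul_norm_le hx (hS j).1
    have h2 := norm_mul_norm_le hx (hS j).2.1
    have h3 : ‖Complex.I * k j X * A j X + ε * B j X‖ ≤ b * ‖A j X‖ + 1 * ‖B j X‖ := by
      refine (norm_add_le _ _).trans ?_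
      simp only [norm_mul, Complex.norm_I, one_mul]
      gcongr
      · simpa using hkb j
      · simpa using mul_le_mul_of_nonneg_right hεc (norm_nonneg (B j X))
    calc _ ≤ ‖x‖ * (b * ‖A j X‖ + 1 * ‖B j X‖) := by gcongr
      _ = b * (‖x‖ * ‖A j X‖) + 1 * (‖x‖ * ‖B j X‖) := by ring
      _ ≤ b * S + b * S := by
        have := hS0 j
        gcongr
      _ = _ := by ring
  have huS : ∀ j l, |u j l X| ≤ 2 * b * S := fun j l => by
    refine (Complex.abs_im_le_norm _).trans ?_
    simpa only [norm_mul, RCLike.norm_conj, he1, mul_one] using hflux j (A l X) (hS l).1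
  have hruS : ∀ j l, |ru j l| ≤ 7 * b * S := fun j l => by
    refine (Complex.abs_im_le_norm _).trans ((norm_add_le _ _).trans ?_)
    have h1 := hflux j (B l X) (hS l).2.1
    have h2 : ‖Complex.I * k' j * A j X + Complex.I * k j X * B j X
        + ε * G j + Complex.I * (k j X - k l X : ℝ) * B j X‖
        ≤ b * ‖A j X‖ + b * ‖B j X‖ + 1 * ‖G j‖ + 2 * b * ‖B j X‖ := by
      refine (norm_add_le _ _).trans (add_le_add ((norm_add_le _ _).trans
        (add_le_add ((norm_add_le _ _).trans (add_le_add ?_ ?_)) ?_)) ?_)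
      · simp only [norm_mul, Complex.norm_I, one_mul]
        gcongr
        simpa using hkb' j
      · simp only [norm_mul, Complex.norm_I, one_mul]
        gcongr
        simpa using hkb j
      · simp only [norm_mul]
        gcongr
      · simp only [norm_mul, Complex.norm_I, one_mul]
        gcongr
        simpa only [Complex.norm_real, Real.norm_eq_abs] using hkk j l
    have h3 := norm_mul_norm_le (hS l).1 (hS j).1
    have h4 := norm_mul_norm_le (hS l).1 (hS j).2.1
    have h5 := norm_mul_norm_le (hS l).1 (hS j).2.2
    have hS0 := hS0 j
    simp only [norm_mul _ (e _ X), norm_mul (conj _), RCLike.norm_conj, he1, mul_one] at h2 ⊢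
    calc _ ≤ 2 * b * S + ‖A l X‖ * (b * ‖A j X‖ + b * ‖B j X‖ + 1 * ‖G j‖ + 2 * b * ‖B j X‖) := by
          gcongr
      _ = 2 * b * S + (b * (‖A l X‖ * ‖A j X‖) + b * (‖A l X‖ * ‖B j X‖) + 1 * (‖A l X‖ * ‖G j‖)
          + 2 * b * (‖A l X‖ * ‖B j X‖)) := by ring
      _ ≤ 2 * b * S + (b * S + b * S + b * S + 2 * b * S) := by gcongr
      _ = _ := by ring
  have hdiag : ∀ j, |(conj (A j X) * (2 * Complex.I * k j X * B j X
      + Complex.I * k' j * A j X)).im| ≤ 3 * b * S := fun j => by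
    refine (Complex.abs_im_le_norm _).trans ?_
    have h3 := norm_mul_norm_le (hS j).1 (hS j).1
    have h4 := norm_mul_norm_le (hS j).1 (hS j).2.1
    have h2 : ‖2 * Complex.I * k j X * B j X + Complex.I * k' j * A j X‖
        ≤ 2 * b * ‖B j X‖ + b * ‖A j X‖ := by
      refine (norm_add_le _ _).trans (add_le_add ?_ ?_)
      · simp only [norm_mul, Complex.norm_I, mul_one, Complex.norm_ofNat]
        gcongr
        simpa using hkb j
      · simp only [norm_mul, Complex.norm_I, one_mul]
        gcongr
        simpa using hkb' j
    rw [norm_mul, RCLike.norm_conj]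
    calc _ ≤ ‖A j X‖ * (2 * b * ‖B j X‖ + b * ‖A j X‖) := by gcongr
      _ = 2 * b * (‖A j X‖ * ‖B j X‖) + b * (‖A j X‖ * ‖A j X‖) := by ring
      _ ≤ 2 * b * S + b * S := by gcongr
      _ = _ := by ring
  have hAG : ∀ j, |ε * (conj (A j X) * G j).im| ≤ ε * S := fun j => by
    refine abs_mul_le_of_le (abs_of_pos hε).le ((Complex.abs_im_le_norm _).trans ?_)
    rw [norm_mul, RCLike.norm_conj]
    exact norm_mul_norm_le (hS j).1 (hS j).2.2
  -- the slopes
  have hv' := fun j l => hasDerivAt_im_conj_mul (X := X) j l hA he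
  have hu' := fun j l => hasDerivAt_im_conj_mul_flux (X := X) hε j l hA hB hk he
  have hd' := fun j => hasDerivAt_im_conj_mul_diag (X := X) (ε := ε) j hA hB hk
  set dd : ι → ι → ℝ := fun j l =>
    (-(k j X * (k j X - k l X) / ε) * v j l X + ru j l) * m j l X + u j l X * m' j l
      + (ε * ((k j X - k l X) / ε * w j l + rv j l) * N j l X + ε * v j l X * N' j l) with hdd
  have hterm : ∀ j l, SlopeBound (fun X => u j l X * m j l X + ε * v j l X * N j l X) (dd j l)
      (|ε * v j l X| * β j l) X := fun j l => by
    have := ((hu' j l).mul (hm j l)).slopeBound.add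
      ((hN j l).mul_hasDerivAt ((hv' j l).const_mul ε) (hβ j l))
    rw [zero_add] at this
    exact this
  set gg : ι → ℝ := fun j => (conj (A j X) * (2 * Complex.I * k j X * B j X
      + Complex.I * k' j * A j X)).im with hgg
  set ag : ι → ℝ := fun j => ε * (conj (A j X) * G j).im with hag
  have htot := (SlopeBound.sum Finset.univ fun j _ => (hd' j).slopeBound).add
    (SlopeBound.sum Finset.univ fun j _ => SlopeBound.sum Finset.univ fun l _ => hterm j l)
  rw [Finset.sum_const_zero, zero_add] at htot
  have hb1 : ∀ j l, |ε * v j l X| * β j l ≤ c * S * ε := fun j l => by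
    have := hS0 j
    rw [abs_mul, abs_of_pos hε]
    calc ε * |v j l X| * β j l ≤ ε * S * c :=
          mul_le_mul (by gcongr; exact hvS j l) (hβc j l) (hβ j l) (by positivity)
      _ = _ := by ring
  have hbsum : ∑ j, ∑ l, |ε * v j l X| * β j l ≤ (Fintype.card ι : ℝ) ^ 2 * (c * S * ε) := by
    refine (le_abs_self _).trans (abs_sum_sum_le fun j l => ?_)
    rw [abs_of_nonneg (mul_nonneg (abs_nonneg _) (hβ j l))]
    exact hb1 j l
  have hb0 : (0 : ℝ) ≤ b := by linarith
  have hc0 : (0 : ℝ) ≤ c := by linarith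
  have hb2 : 1 ≤ b ^ 2 := by nlinarith
  have hbb : b ≤ b ^ 2 := by nlinarith
  have hεa : |ε| ≤ ε := (abs_of_pos hε).le
  -- The powers `1/ε` are absorbed: in the first group by `m = O(ε)`, in the second by the factor
  -- `ε` in front of `N`.
  have hddeq : ∀ j l, dd j l = -(k j X * (k j X - k l X)) * v j l X * (m j l X / ε)
      + ru j l * m j l X + u j l X * m' j l
      + ((k j X - k l X) * w j l * N j l X + ε * rv j l * N j l X + ε * v j l X * N' j l) :=
    fun j l => by
      simp only [hdd]
      field_simp
  have hmε : ∀ j l, |m j l X / ε| ≤ c := fun j l => by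
    rw [abs_div, abs_of_pos hε, div_le_iff₀ hε]
    exact hmc j l
  have hkk2 : ∀ j l, |-(k j X * (k j X - k l X))| ≤ b * (2 * b) := fun j l => by
    rw [abs_neg]
    exact abs_mul_le_of_le (hkb j) (hkk j l)
  have hSb : ∀ _ : ι, S * c ≤ b ^ 2 * c * S ∧ b * S * c ≤ b ^ 2 * c * S ∧ 0 ≤ b ^ 2 * c * S ∧
      b * S ≤ b ^ 2 * c * S ∧ S ≤ b ^ 2 * c * S := fun j => by
    have hS0 := hS0 j
    have h1 : 0 ≤ S * c := by positivity
    have h2 : b * S ≤ b * S * c := by nlinarith [mul_nonneg hb0 hS0]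
    have h3 : S * c ≤ b ^ 2 * (S * c) := by nlinarith
    have h4 : b * (S * c) ≤ b ^ 2 * (S * c) := by gcongr
    have h5 : S ≤ S * c := by nlinarith
    have e : b ^ 2 * c * S = b ^ 2 * (S * c) := by ring
    rw [e]
    refine ⟨h3, by linarith, by positivity, by linarith, by linarith⟩
  refine ⟨_, _, htot, ?_, ?_, ?_, ?_⟩
  · exact Finset.sum_nonneg fun j _ => Finset.sum_nonneg fun l _ =>
      mul_nonneg (abs_nonneg _) (hβ j l)
  · have hddb : ∀ j l, |dd j l| ≤ 19 * (b ^ 2 * c * S) := fun j l => by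
      have hS0 := hS0 j
      obtain ⟨k1, k2, k3, -, -⟩ := hSb j
      rw [hddeq]
      calc _ ≤ b * (2 * b) * S * c + 7 * b * S * (c * 1) + 2 * b * S * (c * 1)
            + (2 * b * S * c + 1 * (2 * S) * c + 1 * S * c) := by
            have hm1 : |m j l X| ≤ c * 1 := (hmc j l).trans (by gcongr)
            have hm2 : |m' j l| ≤ c * 1 := (hmc' j l).trans (by gcongr)
            have hε2 : |ε| ≤ 1 := hεa.trans hε1
            exact abs_add_le_of_le (abs_add_le_of_le (abs_add_le_of_le
              (abs_mul_le_of_le (abs_mul_le_of_le (hkk2 j l) (hvS j l)) (hmε j l))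
              (abs_mul_le_of_le (hruS j l) hm1)) (abs_mul_le_of_le (huS j l) hm2))
              (abs_add_le_of_le (abs_add_le_of_le
                (abs_mul_le_of_le (abs_mul_le_of_le (hkk j l) (hwS j l)) (hNc j l))
                (abs_mul_le_of_le (abs_mul_le_of_le hε2 (hrvS j l)) (hNc j l)))
                (abs_mul_le_of_le (abs_mul_le_of_le hε2 (hvS j l)) (hNc' j l)))
        _ = 2 * (b ^ 2 * c * S) + 11 * (b * S * c) + 3 * (S * c) := by ring
        _ ≤ _ := by linarith
    have hgb : ∀ j, |gg j + ag j| ≤ 4 * (b ^ 2 * c * S) := fun j => by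
      have hS0 := hS0 j
      obtain ⟨-, -, -, k4, k5⟩ := hSb j
      have : ε * S ≤ 1 * S := by gcongr
      exact (abs_add_le_of_le (hdiag j) (hAG j)).trans (by linarith)
    have h1 := abs_add_le_of_le (abs_sum_le hgb) (abs_sum_sum_le hddb)
    refine (add_le_add h1 hbsum).trans ?_
    -- Nonnegativity of `S` is known only through some mode; without modes both sides vanish.
    rcases isEmpty_or_nonempty ι with hι | ⟨⟨j⟩⟩
    · simp
    · obtain ⟨k1, -⟩ := hSb j
      have hS0 := hS0 j
      have : c * S * ε ≤ S * c := by
        calc c * S * ε ≤ c * S * 1 := by gcongr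
          _ = _ := by ring
      calc _ ≤ (Fintype.card ι : ℝ) * (4 * (b ^ 2 * c * S))
            + (Fintype.card ι : ℝ) ^ 2 * (19 * (b ^ 2 * c * S))
            + (Fintype.card ι : ℝ) ^ 2 * (b ^ 2 * c * S) :=
            add_le_add le_rfl (mul_le_mul_of_nonneg_left (this.trans k1) (by positivity))
        _ = _ := by ring
  · intro h
    simp [h]
  · intro m₁ C a Z hm₁ hC ha hZ
    have hvanti : ∀ j l, v j l X = -v l j X := fun j l => by
      simp only [hv, Complex.mul_im, map_mul, Complex.conj_re, Complex.conj_im, Complex.mul_re]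
      ring
    have hwsymm : ∀ j l, w j l = w l j := fun j l => by
      simp only [hw, Complex.mul_im, map_mul, Complex.conj_re, Complex.conj_im, Complex.mul_re]
      ring
    -- The imaginary part of the equation of mode `l` multiplied by `A_l^*`. Here `Z` stands for
    -- `A_{YY}`.
    have hpde : ∀ l, gg l + (conj (A l X) * Z l).im
        = ∑ j, (-(a l j * v j l X) + k j X * (C l j - C j l) * w j l) := fun l => by
      have h1 : gg l + (conj (A l X) * Z l).im
          = -(∑ j, conj (A l X) * (((a l j : ℂ) - Complex.I * k j X * ((C l j - C j l : ℝ) : ℂ))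
              * A j X * (e j X * conj (e l X)))).im := by
        rw [← Finset.mul_sum, ← Complex.neg_im, hgg, ← Complex.add_im]
        congr 1
        linear_combination (conj (A l X)) * hZ l
      rw [h1, Complex.im_sum, ← Finset.sum_neg_distrib]
      refine Finset.sum_congr rfl fun j _ => ?_
      have h2 : conj (A l X) * (((a l j : ℂ) - Complex.I * k j X * ((C l j - C j l : ℝ) : ℂ))
              * A j X * (e j X * conj (e l X)))
          = (a l j : ℂ) * (conj (A l X * e l X) * (A j X * e j X))
            - ((k j X * (C l j - C j l) : ℝ) : ℂ)
              * (Complex.I * (conj (A l X * e l X) * (A j X * e j X))) := by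
        rw [map_mul]
        push_cast
        ring
      rw [h2, Complex.sub_im, Complex.im_ofReal_mul, Complex.im_ofReal_mul, Complex.I_mul_im]
      simp only [hv, hw]
      ring
    -- The slope terms after subtraction of their limits, with `m₁` for `m / ε` and `C` for `N`;
    -- every summand is now of order `ε`.
    set r : ι → ι → ℝ := fun j l =>
      -(k j X * (k j X - k l X)) * v j l X * (m j l X / ε - m₁ j l)
      + ru j l * m j l X + u j l X * m' j l
      + ((k j X - k l X) * w j l * (N j l X - C j l) + ε * rv j l * N j l X
        + ε * v j l X * N' j l) with hr
    -- The heart of the cancellation. The antisymmetric `v j l` has the coefficient `-(a l j + k_j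
    -- (k_j - k_l) m₁ j l)`, symmetric by `ha`; the symmetric `w j l` has the coefficient `k_j C l j
    -- - k_l C j l`, which is antisymmetric.
    have hanti : ∑ j, ∑ l, ((-(a l j * v j l X) + k j X * (C l j - C j l) * w j l)
        - k j X * (k j X - k l X) * v j l X * m₁ j l + (k j X - k l X) * w j l * C j l) = 0 := by
      refine sum_sum_eq_zero_of_antisymm fun j l => ?_
      rw [hvanti l j, hwsymm l j]
      linear_combination (-v j l X) * ha l j
    have hsum : ∑ j, (gg j + ag j) + ∑ j, ∑ l, dd j l + ∑ j, (conj (A j X) * Z j).im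
        = ∑ j, ag j + ∑ j, ∑ l, r j l := by
      have h1 : ∑ j, gg j + ∑ j, (conj (A j X) * Z j).im
          = ∑ j, ∑ l, (-(a l j * v j l X) + k j X * (C l j - C j l) * w j l) := by
        rw [← Finset.sum_add_distrib, Finset.sum_congr rfl fun l _ => hpde l, Finset.sum_comm]
      have h2 : ∑ j, ∑ l, dd j l = ∑ j, ∑ l, r j l
          - ∑ j, ∑ l, (-(a l j * v j l X) + k j X * (C l j - C j l) * w j l)
          + ∑ j, ∑ l, ((-(a l j * v j l X) + k j X * (C l j - C j l) * w j l)
        - k j X * (k j X - k l X) * v j l X * m₁ j l + (k j X - k l X) * w j l * C j l) := by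
        simp only [← Finset.sum_sub_distrib, ← Finset.sum_add_distrib]
        refine Finset.sum_congr rfl fun j _ => Finset.sum_congr rfl fun l _ => ?_
        rw [hddeq]
        simp only [hr]
        ring
      rw [hanti] at h2
      rw [Finset.sum_add_distrib, h2]
      linarith
    have hm₁' : ∀ j l, |m j l X / ε - m₁ j l| ≤ c * ε := fun j l => by
      have : m j l X / ε - m₁ j l = (m j l X - ε * m₁ j l) / ε := by field_simp
      rw [this, abs_div, abs_of_pos hε, div_le_iff₀ hε]
      exact (hm₁ j l).trans_eq (by ring)
    have hrb : ∀ j l, |r j l| ≤ 19 * (b ^ 2 * c * S) * ε := fun j l => by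
      have hS0 := hS0 j
      obtain ⟨k1, k2, k3, -, -⟩ := hSb j
      calc _ ≤ b * (2 * b) * S * (c * ε) + 7 * b * S * (c * ε) + 2 * b * S * (c * ε)
            + (2 * b * S * (c * ε) + ε * (2 * S) * c + ε * S * c) :=
            abs_add_le_of_le (abs_add_le_of_le (abs_add_le_of_le
              (abs_mul_le_of_le (abs_mul_le_of_le (hkk2 j l) (hvS j l)) (hm₁' j l))
              (abs_mul_le_of_le (hruS j l) (hmc j l))) (abs_mul_le_of_le (huS j l) (hmc' j l)))
              (abs_add_le_of_le (abs_add_le_of_le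
                (abs_mul_le_of_le (abs_mul_le_of_le (hkk j l) (hwS j l)) (hC j l))
                (abs_mul_le_of_le (abs_mul_le_of_le hεa (hrvS j l)) (hNc j l)))
                (abs_mul_le_of_le (abs_mul_le_of_le hεa (hvS j l)) (hNc' j l)))
        _ = (2 * (b ^ 2 * c * S) + 11 * (b * S * c) + 3 * (S * c)) * ε := by ring
        _ ≤ _ := by gcongr; linarith
    rw [hsum]
    refine (add_le_add (abs_add_le_of_le (abs_sum_le hAG) (abs_sum_sum_le hrb)) hbsum).trans ?_
    rcases isEmpty_or_nonempty ι with hι | ⟨⟨j⟩⟩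
    · simp
    · obtain ⟨k1, -, k3, -, k5⟩ := hSb j
      calc _ = ((Fintype.card ι : ℝ) * S
            + (Fintype.card ι : ℝ) ^ 2 * (19 * (b ^ 2 * c * S))
            + (Fintype.card ι : ℝ) ^ 2 * (S * c)) * ε := by ring
        _ ≤ ((Fintype.card ι : ℝ) * (4 * (b ^ 2 * c * S))
            + (Fintype.card ι : ℝ) ^ 2 * (19 * (b ^ 2 * c * S))
            + (Fintype.card ι : ℝ) ^ 2 * (b ^ 2 * c * S)) * ε := by gcongr; linarith
        _ = _ := by ring

end Slope

end ModePE

/-! ### Matrix elements of the modes and the flux density of a solution. -/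

namespace ModePE
namespace Modes

variable {n : ℕ} {ι : Type*}

/-- The oscillating exponential `exp (i θ_j / ε)`. -/
noncomputable def expθ (D : Modes ι) (ε : ℝ) (j : ι) (X : ℝ) : ℂ :=
  Complex.exp (Complex.I * ((D.θ j X / ε : ℝ) : ℂ))

/-- The matrix elements `∫ γ φ_{jX} φ_l dz`. -/
noncomputable def elemN (D : Modes ι) (W : Medium n) (H ε : ℝ) (p : Fin (n + 1)) (j l : ι)
    (X Y : ℝ) : ℝ := D.C W H j l X + W.corr H ε p (D.φXφ j l) X Y

/-- The density with respect to `Y` of the energy flux in the strip `p`. -/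
noncomputable def stripFlux [Fintype ι] (D : Modes ι) (W : Medium n) (H ε : ℝ)
    (A : Fin (n + 1) → ι → ℝ → ℝ → ℂ) (p : Fin (n + 1)) (X Y : ℝ) : ℝ :=
  fluxDensity ε (fun j => D.k j X) (fun j => A p j X Y) (fun j => dX (A p j) X Y)
    (fun j => D.expθ ε j X) (fun j l => W.corr H ε p (D.φφ j l) X Y)
    (fun j l => D.elemN W H ε p j l X Y)

/-- The sum of the squares of the amplitudes and of their derivatives. -/
noncomputable def ampSq [Fintype ι] (A : Fin (n + 1) → ι → ℝ → ℝ → ℂ) (p : Fin (n + 1))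
    (X Y : ℝ) : ℝ :=
  ∑ j, (‖A p j X Y‖ ^ 2 + ‖deriv (fun X' => A p j X' Y) X‖ ^ 2
    + ‖iteratedDeriv 2 (fun X' => A p j X' Y) X‖ ^ 2)

/-- The flux of energy in the direction of `Y`. -/
noncomputable def sideFlux [Fintype ι] (A : Fin (n + 1) → ι → ℝ → ℝ → ℂ) (p : Fin (n + 1))
    (X Y : ℝ) : ℝ :=
  ∑ j, (conj (A p j X Y) * deriv (A p j X) Y).im

/-- A bounded medium, its modes, and a solution of the mode parabolic equations in it. -/
structure Admissible [Fintype ι] (D : Modes ι) (W : Medium n) (H L ε K : ℝ)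
    (A : Fin (n + 1) → ι → ℝ → ℝ → ℂ) : Prop where
  H_pos : 0 < H
  ε_pos : 0 < ε
  ε_le : ε ≤ 1
  regular : W.Regular H L ε
  bounded : W.BoundedBy H L K
  spectral : D.IsSpectral W H L
  modes_bounded : D.BoundedBy W H L K
  ν_real : ∀ p ∈ W.wet, ∀ s, ∀ X ∈ Ioo 0 L, ∀ Y ∈ W.strip p X, ∀ z ∈ Icc (-H) 0,
    (W.ν p s X Y z).im = 0
  solution : D.IsSolution W H L ε A

/-- Bound for the matrix elements. -/
noncomputable def elemConst (H K : ℝ) : ℝ := (8 * H + 70) * max K 1 ^ 5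

/-- Bound for the slope of the flux density. -/
noncomputable def slopeConst (ι : Type*) [Fintype ι] (H K : ℝ) : ℝ :=
  (20 * (Fintype.card ι : ℝ) ^ 2 + 4 * Fintype.card ι) * max K 1 ^ 2 * elemConst H K

theorem one_le_elemConst {H : ℝ} (hH : 0 < H) (K : ℝ) : 1 ≤ elemConst H K := by
  have h1 : 1 ≤ max K 1 ^ 5 := one_le_pow₀ (le_max_right _ _)
  unfold elemConst
  nlinarith

theorem slopeConst_nonneg (ι : Type*) [Fintype ι] {H : ℝ} (hH : 0 < H) (K : ℝ) :
    0 ≤ slopeConst ι H K := by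
  have := one_le_elemConst hH K
  unfold slopeConst
  positivity

variable {D : Modes ι} {W : Medium n} {H L ε K X Y : ℝ} {p : Fin (n + 1)}

theorem norm_expθ (j : ι) : ‖D.expθ ε j X‖ = 1 := by
  rw [expθ, mul_comm, Complex.norm_exp_ofReal_mul_I]

theorem expθ_mul_conj (j l : ι) : D.expθ ε j X * conj (D.expθ ε l X)
    = Complex.exp (Complex.I / (ε : ℂ) * ((D.θ j X - D.θ l X : ℝ) : ℂ)) := by
  rw [expθ, expθ, ← Complex.exp_conj, ← Complex.exp_add]
  congr 1
  simp only [map_mul, Complex.conj_I, Complex.conj_ofReal]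
  push_cast
  ring

theorem C_eq (j l : ι) :
    D.C W H j l X = W.vint H X fun s z => W.γ0 s X z * D.φXφ j l s X z := by
  simp only [C, φXφ, dX, mul_assoc]

theorem dX_dX {E : Type*} [NormedAddCommGroup E] [NormedSpace ℝ E] (w : ℝ → ℝ → E) (X z : ℝ) :
    dX (dX w) X z = iteratedDeriv 2 (fun X' => w X' z) X := by
  rw [iteratedDeriv_succ, iteratedDeriv_one]
  rfl

namespace Admissible

variable [Fintype ι] {A : Fin (n + 1) → ι → ℝ → ℝ → ℂ}

theorem hasDerivAt_expθ (h : Admissible D W H L ε K A) (hX : X ∈ Ioo 0 L) (j : ι) :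
    HasDerivAt (D.expθ ε j) (Complex.I * ((D.k j X / ε : ℝ) : ℂ) * D.expθ ε j X) X := by
  have h1 := ((((h.spectral.θ_deriv j X hX).div_const ε).ofReal_comp).const_mul Complex.I).cexp
  refine h1.congr_deriv ?_
  rw [mul_comm, expθ]

theorem hasDerivAt_k (h : Admissible D W H L ε K A) (hX : X ∈ Ioo 0 L) (j : ι) :
    HasDerivAt (D.k j) (deriv (D.k j) X) X :=
  (((h.spectral.k_smooth j).contDiffAt (isOpen_Ioo.mem_nhds hX)).differentiableAt
    one_ne_zero).hasDerivAt

theorem smooth_A (h : Admissible D W H L ε K A) (hp : p ∈ W.wet) (j : ι) :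
    SmoothStrip 2 L (A p j) := h.solution.smooth p hp j

theorem modes_bound (h : Admissible D W H L ε K A) (hX : X ∈ Ioo 0 L) (s : Layer) (j : ι) {z : ℝ}
    (hz : z ∈ W.layerClosed H X s) :
    |D.φ s j X z| ≤ max K 1 ∧ |deriv (D.φ s j X) z| ≤ max K 1 ∧
      |dX (D.φ s j) X z| ≤ max K 1 ∧ |dX (dX (D.φ s j)) X z| ≤ max K 1 := by
  have hb := h.modes_bounded.φ_bound s j X hX z hz
  rw [dX_dX]
  exact ⟨hb.1.trans (le_max_left _ _), hb.2.1.trans (le_max_left _ _),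
    hb.2.2.1.trans (le_max_left _ _), hb.2.2.2.trans (le_max_left _ _)⟩

theorem φφ_bound (h : Admissible D W H L ε K A) (hX : X ∈ Ioo 0 L) (j l : ι) (s : Layer) {z : ℝ}
    (hz : z ∈ W.layerClosed H X s) :
    |D.φφ j l s X z| ≤ 2 * max K 1 ^ 2 ∧ |dX (D.φφ j l s) X z| ≤ 2 * max K 1 ^ 2 ∧
      |deriv (D.φφ j l s X) z| ≤ 2 * max K 1 ^ 2 := by
  obtain ⟨j1, j2, j3, -⟩ := h.modes_bound hX s j hz
  obtain ⟨l1, l2, l3, -⟩ := h.modes_bound hX s l hz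
  have e1 : dX (D.φφ j l s) X z = _ :=
    SmoothStrip.dX_mul (h.spectral.smooth_one s j) (h.spectral.smooth_one s l) hX z
  have e2 : deriv (D.φφ j l s X) z = _ :=
    (((h.spectral.smooth_one s j).hasDerivAt_snd le_rfl hX z).mul
      ((h.spectral.smooth_one s l).hasDerivAt_snd le_rfl hX z)).deriv
  rw [e1, e2]
  refine ⟨(abs_mul_le_of_le j1 l1).trans (by nlinarith [sq_nonneg (max K 1)]),
    (abs_add_le_of_le (abs_mul_le_of_le j3 l1) (abs_mul_le_of_le j1 l3)).trans_eq (by ring),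
    (abs_add_le_of_le (abs_mul_le_of_le j2 l1) (abs_mul_le_of_le j1 l2)).trans_eq (by ring)⟩

theorem φXφ_bound (h : Admissible D W H L ε K A) (hX : X ∈ Ioo 0 L) (j l : ι) (s : Layer) {z : ℝ}
    (hz : z ∈ W.layerClosed H X s) :
    |D.φXφ j l s X z| ≤ 2 * max K 1 ^ 2 ∧ |dX (D.φXφ j l s) X z| ≤ 2 * max K 1 ^ 2 := by
  obtain ⟨j1, j2, j3, j4⟩ := h.modes_bound hX s j hz
  obtain ⟨l1, l2, l3, -⟩ := h.modes_bound hX s l hz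
  have e1 : dX (D.φXφ j l s) X z = _ :=
    SmoothStrip.dX_mul (h.spectral.smooth_dX s j) (h.spectral.smooth_one s l) hX z
  rw [e1]
  refine ⟨(abs_mul_le_of_le j3 l1).trans (by nlinarith [sq_nonneg (max K 1)]),
    (abs_add_le_of_le (abs_mul_le_of_le j4 l1) (abs_mul_le_of_le j3 l3)).trans_eq (by ring)⟩

/-- The Leibniz rule across the moving `h0`. No corner arises, because `γ0` and `φ_{jX}` jump at the
same level `h0`. -/
theorem C_bound (h : Admissible D W H L ε K A) (hX : X ∈ Ioo 0 L) (j l : ι) :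
    |D.C W H j l X| ≤ 4 * H * max K 1 ^ 5 ∧
      ∃ d, HasDerivAt (D.C W H j l) d X ∧ |d| ≤ (4 * H + 4) * max K 1 ^ 5 := by
  have hB1 : 1 ≤ max K 1 := le_max_right _ _
  set B := max K 1 with hB
  have hB0 : 0 ≤ B := by linarith
  have hb : ∀ s, ∀ z ∈ W.layerClosed H X s,
      |(fun s X z => W.γ0 s X z * D.φXφ j l s X z) s X z| ≤ 2 * B ^ 3 ∧
      |dX ((fun s X z => W.γ0 s X z * D.φXφ j l s X z) s) X z| ≤ 4 * B ^ 3 := fun s z hz => by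
    have h1 := h.bounded.γ0_bound s X hX z
      (W.layerClosed_subset (h.regular.h0_mem X hX) hz)
    have h2 := h.φXφ_bound hX j l s hz
    have hKB : K ≤ B := le_max_left _ _
    refine ⟨(abs_mul_le_of_le (h1.1.trans hKB) h2.1).trans_eq (by ring), ?_⟩
    have e1 := SmoothStrip.dX_mul (h.regular.smooth_γ0 s) (h.spectral.smooth_φXφ j l s) hX z
    simp only [e1]
    exact (abs_add_le_of_le (abs_mul_le_of_le (h1.2.1.trans hKB) h2.1)
      (abs_mul_le_of_le (h1.1.trans hKB) h2.2)).trans_eq (by ring)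
  have hB35 : B ^ 3 ≤ B ^ 5 := pow_le_pow_right₀ hB1 (by norm_num)
  have hB45 : B ^ 4 ≤ B ^ 5 := pow_le_pow_right₀ hB1 (by norm_num)
  have hH := h.H_pos
  have hHB : H * B ^ 3 ≤ H * B ^ 5 := by gcongr
  have hHB0 : 0 ≤ H * B ^ 5 := by positivity
  constructor
  · rw [C_eq]
    refine (W.abs_vint_le (h.regular.h0_mem X hX) fun s z hz => (hb s z hz).1).trans ?_
    linarith
  · refine ⟨_, ?_, (Medium.abs_vint_slope_le h.regular h.bounded (le_max_left K 1) hX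
        (w := fun s X z => W.γ0 s X z * D.φXφ j l s X z) hb).trans ?_⟩
    · have := W.hasDerivAt_vint (H := H) (w := fun s X z => W.γ0 s X z * D.φXφ j l s X z)
        (fun s => (h.regular.smooth_γ0 s).mul (h.spectral.smooth_φXφ j l s)) hX
        (h.regular.hasDerivAt_h0 hX)
      refine this.congr_of_eventuallyEq (Eventually.of_forall fun x => ?_)
      exact C_eq j l
    · rw [← hB]
      nlinarith

/-- Verifies the hypotheses of `slopeBound_fluxDensity`. The elements with `φ_j φ_l` are
differentiable with slope `O(ε)`; those with `φ_{jX} φ_l` have slopes of order one and possibly a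
corner. -/
theorem exists_slopeBound_elem (h : Admissible D W H L ε K A) (hX : X ∈ Ioo 0 L) (hp : p ∈ W.wet)
    (hY : Y ∈ W.strip p X) (j l : ι) :
    (|W.corr H ε p (D.φφ j l) X Y| ≤ elemConst H K * ε ∧
      |W.corr H ε p (D.φφ j l) X Y - ε * W.corrLead H p (D.φφ j l) X Y|
        ≤ elemConst H K * ε ^ 2 ∧
      ∃ d, HasDerivAt (fun X => W.corr H ε p (D.φφ j l) X Y) d X ∧ |d| ≤ elemConst H K * ε) ∧
    |D.elemN W H ε p j l X Y - D.C W H j l X| ≤ elemConst H K * ε ∧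
    |D.elemN W H ε p j l X Y| ≤ elemConst H K ∧
    ∃ d b, SlopeBound (fun X => D.elemN W H ε p j l X Y) d b X ∧ 0 ≤ b ∧ b ≤ elemConst H K ∧
      |d| ≤ elemConst H K ∧ ((W.h1 p X Y = 0 → dX (W.h1 p) X Y = 0) → b = 0) := by
  have hB1 : 1 ≤ max K 1 := le_max_right _ _
  have hH := h.H_pos
  have hε := h.ε_pos
  have b1 := Medium.corr_bounds hH h.regular h.bounded hε h.ε_le (le_max_left K 1)
    hB1 hX hp hY (h.spectral.smooth_φφ j l) fun s z hz =>
      ⟨(h.φφ_bound hX j l s hz).1, (h.φφ_bound hX j l s hz).2.1⟩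
  have b2 := Medium.corr_bounds hH h.regular h.bounded hε h.ε_le (le_max_left K 1)
    hB1 hX hp hY (h.spectral.smooth_φXφ j l) fun s z hz => h.φXφ_bound hX j l s hz
  obtain ⟨b3, d', hd', hd'b⟩ := h.C_bound hX j l
  set B := max K 1 with hB
  -- The constant of `corr_bounds` with `U = 2B²`, the common bound for the products and their
  -- derivatives. It equals `(4H + 60) B⁵`, and `elemConst` leaves room for the bounds of `C` as
  -- well.
  set c := (2 * H + 30) * B ^ 3 * (2 * B ^ 2) with hc
  have hB0 : 0 ≤ B := by linarith
  have hB5 : 0 ≤ B ^ 5 := by positivity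
  have hHB5 : 0 ≤ H * B ^ 5 := by positivity
  have hE : elemConst H K = 8 * (H * B ^ 5) + 70 * B ^ 5 := by rw [elemConst]; ring
  have hc' : c = 4 * (H * B ^ 5) + 60 * B ^ 5 := by rw [hc]; ring
  have hcE : c ≤ elemConst H K := by rw [hE, hc']; linarith
  have hcε : c * ε ≤ c := mul_le_of_le_one_right (by rw [hc']; positivity) h.ε_le
  obtain ⟨m1, d1, s1, hs1, -, -, -, -, hfine⟩ := b1
  -- Continuity of the modes across `h0` removes the corner, so that the slope bound is a genuine
  -- derivative.
  obtain ⟨rfl, d1b, m1b⟩ := hfine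
    (by simp only [φφ, h.spectral.continuous _ X hX]) fun s z hz => (h.φφ_bound hX j l s hz).2.2
  obtain ⟨n1, d2, s2, hs2, n2, n3, n4, n5, -⟩ := b2
  refine ⟨⟨m1.trans (by gcongr), m1b.trans (by gcongr), d1, slopeBound_zero_iff.1 hs1,
    d1b.trans (by gcongr)⟩, ?_, ?_, d' + d2, 0 + s2, hd'.slopeBound.add hs2, by linarith, ?_, ?_, ?_⟩
  · rw [elemN, add_sub_cancel_left]
    exact n1.trans (by gcongr)
  · refine (abs_add_le_of_le b3 n1).trans ?_
    rw [hE]; linarith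
  · rw [hE]; linarith
  · refine (abs_add_le_of_le hd'b n3).trans ?_
    rw [hE]; linarith
  · intro hnc
    rw [n5 hnc, zero_add]

/-- The slope of the density of the flux in the direction of `X`. -/
theorem exists_slopeBound_stripFlux (h : Admissible D W H L ε K A) (hX : X ∈ Ioo 0 L)
    (hp : p ∈ W.wet) (hY : Y ∈ W.strip p X) :
    ∃ d b, SlopeBound (fun X => D.stripFlux W H ε A p X Y) d b X ∧ 0 ≤ b ∧
      |d| + b ≤ slopeConst ι H K * ampSq A p X Y ∧
      ((W.h1 p X Y = 0 → dX (W.h1 p) X Y = 0) → b = 0) ∧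
      |d + ∑ j, (conj (A p j X Y) * iteratedDeriv 2 (A p j X) Y).im| + b
        ≤ slopeConst ι H K * ampSq A p X Y * ε := by
  choose hM hNC hN dN bN hNs hb0 hbc hdc hnc using h.exists_slopeBound_elem hX hp hY
  choose hM1 hM2 dM hMd hMdc using hM
  have hS : ∀ j, ‖A p j X Y‖ ^ 2 ≤ ampSq A p X Y ∧ ‖dX (A p j) X Y‖ ^ 2 ≤ ampSq A p X Y ∧
      ‖iteratedDeriv 2 (fun X' => A p j X' Y) X‖ ^ 2 ≤ ampSq A p X Y := fun j => by
    have := Finset.single_le_sum (f := fun j => ‖A p j X Y‖ ^ 2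
      + ‖deriv (fun X' => A p j X' Y) X‖ ^ 2 + ‖iteratedDeriv 2 (fun X' => A p j X' Y) X‖ ^ 2)
      (fun j _ => by positivity) (Finset.mem_univ j)
    have h1 := sq_nonneg ‖A p j X Y‖
    have h2 := sq_nonneg ‖deriv (fun X' => A p j X' Y) X‖
    have h3 := sq_nonneg ‖iteratedDeriv 2 (fun X' => A p j X' Y) X‖
    rw [ampSq]
    simp only [dX]
    refine ⟨?_, ?_, ?_⟩ <;> linarith
  obtain ⟨d, b, hs, hb, hdb, hz, hfine⟩ := slopeBound_fluxDensity (ε := ε) (b := max K 1)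
    (c := elemConst H K) (X := X) (S := ampSq A p X Y) (A := fun j X => A p j X Y)
    (B := fun j X => dX (A p j) X Y) (e := fun j X => D.expθ ε j X)
    (G := fun j => iteratedDeriv 2 (fun X' => A p j X' Y) X)
    (k := D.k) (k' := fun j => deriv (D.k j) X)
    (m := fun j l X => W.corr H ε p (D.φφ j l) X Y)
    (N := fun j l X => D.elemN W H ε p j l X Y) h.ε_pos h.ε_le (le_max_right _ _)
    (one_le_elemConst h.H_pos K)
    (fun j => (h.smooth_A hp j).hasDerivAt_fst one_le_two hX Y)
    (fun j => by
      have := ((h.smooth_A hp j).dX (m := 1) (by norm_num)).hasDerivAt_fst le_rfl hX Y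
      rwa [dX_dX] at this)
    (fun j => h.hasDerivAt_k hX j) (fun j => h.hasDerivAt_expθ hX j) (fun j => norm_expθ j)
    hMd hNs hb0 hbc hS (fun j => (h.modes_bounded.k_bound j X hX).1.trans (le_max_left _ _))
    (fun j => (h.modes_bounded.k_bound j X hX).2.trans (le_max_left _ _)) hM1 hMdc hN hdc
  refine ⟨d, b, hs, hb, hdb, fun hn => hz fun j l => hnc j l hn, ?_⟩
  -- Absence of absorption enters here: only for real `ν` is the coupling matrix of the required
  -- form.
  obtain ⟨a, ha1, ha2⟩ := h.spectral.exists_α_eq h.regular hX (p := p) (Y := Y)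
    fun s z hz => h.ν_real p hp s X hX Y hY z hz
  refine hfine (fun j l => W.corrLead H p (D.φφ j l) X Y) (fun j l => D.C W H j l X) a
    (fun j => iteratedDeriv 2 (A p j X) Y) hM2 hNC ha2 fun l => ?_
  have := h.solution.equation p hp l X hX Y hY
  simp only [ha1, ← expθ_mul_conj] at this
  exact this

end Admissible

end Modes
end ModePE

/-! ### Geometry of the strips. -/

namespace ModePE

/-- Integral over an interval whose left end moves. -/
theorem SlopeBound.intervalIntegral_left {m x₀ e' : ℝ} {e : ℝ → ℝ} (he : HasDerivAt e e' x₀)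
    (hm : e x₀ < m) {f : ℝ → ℝ → ℝ} {g q b : ℝ → ℝ}
    (hg : IntegrableOn g (Ioo (e x₀) m))
    (hq : AEStronglyMeasurable q (volume.restrict (Ioo (e x₀) m)))
    (hb : IntegrableOn b (Ioo (e x₀) m))
    (hcont : ∀ᶠ x in 𝓝 x₀, Continuous (f x))
    (hcont' : ContinuousAt (fun p : ℝ × ℝ => f p.1 p.2) (x₀, e x₀))
    (hlip : ∀ᶠ x in 𝓝 x₀, ∀ Y, Y < m → (∀ x' ∈ uIcc x₀ x, e x' < Y) →
      |f x Y - f x₀ Y| ≤ g Y * |x - x₀|)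
    (hslope : ∀ᵐ Y, Y ∈ Ioo (e x₀) m → SlopeBound (fun x => f x Y) (q Y) (b Y) x₀) :
    IntegrableOn q (Ioo (e x₀) m) ∧
      SlopeBound (fun x => ∫ Y in e x..m, f x Y)
        ((∫ Y in Ioo (e x₀) m, q Y) - e' * f x₀ (e x₀)) (∫ Y in Ioo (e x₀) m, b Y) x₀ := by
  -- The reflection `Y ↦ -Y` turns a moving left end into a moving right end.
  have hmp := Measure.measurePreserving_neg (volume : Measure ℝ)
  have hemb : MeasurableEmbedding (Neg.neg : ℝ → ℝ) := (Homeomorph.neg ℝ).measurableEmbedding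
  have hpre : (Neg.neg : ℝ → ℝ) ⁻¹' Ioo (e x₀) m = Ioo (-m) (-e x₀) := by
    ext x
    simp only [mem_preimage, mem_Ioo]
    constructor <;> rintro ⟨h1, h2⟩ <;> constructor <;> linarith
  have hint : ∀ u : ℝ → ℝ, IntegrableOn (fun Y => u (-Y)) (Ioo (-m) (-e x₀)) ↔
      IntegrableOn u (Ioo (e x₀) m) := fun u => by
    rw [← hpre]
    exact hmp.integrableOn_comp_preimage hemb
  have hval : ∀ u : ℝ → ℝ, ∫ Y in Ioo (-m) (-e x₀), u (-Y) = ∫ Y in Ioo (e x₀) m, u Y :=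
    fun u => by
      rw [← hpre]
      exact hmp.setIntegral_preimage_emb hemb u _
  obtain ⟨h1, h2⟩ := SlopeBound.intervalIntegral (m := -m) (e := fun x => -e x) (e' := -e')
    (f := fun x Y => f x (-Y)) (g := fun Y => g (-Y)) (q := fun Y => q (-Y))
    (b := fun Y => b (-Y)) he.neg (neg_lt_neg hm) ((hint g).2 hg)
    (by
      rw [← hpre]
      exact hq.comp_quasiMeasurePreserving
        (hmp.restrict_preimage measurableSet_Ioo).quasiMeasurePreserving)
    ((hint b).2 hb) (hcont.mono fun x hx => hx.comp continuous_neg)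
    (by
      have hc : ContinuousAt (fun q : ℝ × ℝ => (q.1, -q.2)) (x₀, -e x₀) := by
        fun_prop
      refine ContinuousAt.comp (g := fun p : ℝ × ℝ => f p.1 p.2) (f := fun q : ℝ × ℝ => (q.1, -q.2)) (x := (x₀, -e x₀)) ?_ hc
      simpa using hcont')
    (hlip.mono fun x hx Y hY hY' => hx (-Y) (by linarith) fun x' hx' => by
      have := hY' x' hx'
      linarith)
    (by
      filter_upwards [hmp.quasiMeasurePreserving.ae hslope] with Y hY hY'
      exact hY ⟨by linarith [hY'.2], by linarith [hY'.1]⟩)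
  refine ⟨(hint q).1 h1, ?_⟩
  rw [hval, hval] at h2
  convert h2.congr (g := fun x => ∫ Y in e x..m, f x Y) (Eventually.of_forall fun x => ?_) using 1
  · simp only [neg_neg]
    ring
  · simp

namespace Medium

variable {n : ℕ} {W : Medium n} {H L ε K X m : ℝ} {p : Fin (n + 1)}

theorem isOpen_strip : IsOpen (W.strip p X) := by
  have : W.strip p X = ⋂ i : Fin n, {Y | (i.castSucc < p → W.curve i X < Y) ∧
      (p ≤ i.castSucc → Y < W.curve i X)} := by
    ext Y
    simp [strip]
  rw [this]
  refine isOpen_iInter_of_finite fun i => ?_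
  rcases lt_or_ge i.castSucc p with h | h
  · simpa [h, not_le.2 h] using! isOpen_Ioi
  · simpa [h, not_lt.2 h] using! isOpen_Iio

theorem measurableSet_strip : MeasurableSet (W.strip p X) := isOpen_strip.measurableSet

theorem strip_disjoint {p' : Fin (n + 1)} {Y : ℝ} (h : Y ∈ W.strip p X)
    (h' : Y ∈ W.strip p' X) : p = p' := by
  by_contra hne
  wlog hlt : p < p' generalizing p p'
  · exact this h' h (Ne.symm hne) (lt_of_le_of_ne (not_lt.1 hlt) (Ne.symm hne))
  have hn : (p : ℕ) < n := by have := p'.2; have : (p : ℕ) < p' := hlt; omega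
  have h1 := (h ⟨p, hn⟩).2 (by simp)
  have h2 := (h' ⟨p, hn⟩).1 hlt
  exact lt_asymm h1 h2

theorem eventually_mem_strip (hW : W.Regular H L ε) (hX : X ∈ Ioo 0 L) (hm : m ∈ W.strip p X) :
    ∀ᶠ X' in 𝓝 X, m ∈ W.strip p X' := by
  simp only [strip, mem_ofPred_eq, eventually_all]
  intro i
  have hc : ContinuousAt (W.curve i) X :=
    (hW.curve_smooth i).continuousOn.continuousAt (isOpen_Ioo.mem_nhds hX)
  rcases lt_or_ge i.castSucc p with h | h
  · filter_upwards [hc.eventually_lt_const ((hm i).1 h)] with x hx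
    exact ⟨fun _ => hx, fun h' => absurd h (not_lt.2 h')⟩
  · filter_upwards [hc.eventually_const_lt ((hm i).2 h)] with x hx
    exact ⟨fun h' => absurd h (not_le.2 h'), fun _ => hx⟩

/-- A strip is cut at an interior point `m`, so that each half is either a fixed half-line or an
interval with one moving end. This and the following three lemmas identify the halves. -/
theorem strip_inter_Ioi_last (hm : m ∈ W.strip (Fin.last n) X) :
    W.strip (Fin.last n) X ∩ Ioi m = Ioi m := by
  refine inter_eq_right.2 fun Y hY i => ⟨fun h => ((hm i).1 h).trans hY, fun h => ?_⟩
  exact absurd i.castSucc_lt_last (not_lt.2 h)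

theorem strip_inter_Iio_zero (hm : m ∈ W.strip 0 X) : W.strip 0 X ∩ Iio m = Iio m := by
  refine inter_eq_right.2 fun Y hY i => ⟨fun h => ?_, fun h => lt_trans hY ((hm i).2 h)⟩
  exact absurd h (Fin.not_lt_zero _)

theorem strip_inter_Ioi_castSucc (hc : StrictMono fun i => W.curve i X) {i : Fin n}
    (hm : m ∈ W.strip i.castSucc X) : W.strip i.castSucc X ∩ Ioi m = Ioo m (W.curve i X) := by
  ext Y
  constructor
  · rintro ⟨h1, h2⟩
    exact ⟨h2, (h1 i).2 le_rfl⟩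
  · rintro ⟨h1, h2⟩
    refine ⟨fun i' => ⟨fun h => ((hm i').1 h).trans h1, fun h => h2.trans_le (hc.monotone ?_)⟩, h1⟩
    exact Fin.castSucc_le_castSucc_iff.1 h

theorem strip_inter_Iio_succ (hc : StrictMono fun i => W.curve i X) {i : Fin n}
    (hm : m ∈ W.strip i.succ X) : W.strip i.succ X ∩ Iio m = Ioo (W.curve i X) m := by
  ext Y
  constructor
  · rintro ⟨h1, h2⟩
    exact ⟨(h1 i).1 Fin.castSucc_lt_succ, h2⟩
  · rintro ⟨h1, h2⟩
    refine ⟨fun i' => ⟨fun h => lt_of_le_of_lt (hc.monotone ?_) h1,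
      fun h => lt_trans h2 ((hm i').2 h)⟩, h2⟩
    simp only [Fin.lt_def, Fin.val_castSucc, Fin.val_succ] at h
    exact Fin.le_def.2 (by omega)

/-- A point slightly to the right of the left wall, or far to the left if there is none. It serves
as the cutting point. -/
theorem strip_nonempty (hc : StrictMono fun i => W.curve i X) : (W.strip p X).Nonempty := by
  have hfin := fun s : Set (Fin n) => s.toFinite.image (fun i => W.curve i X)
  by_cases h1 : ∃ i : Fin n, i.castSucc < p
  · obtain ⟨i₁, hi₁⟩ := h1
    have hp : p ≠ 0 := Fin.ne_zero_of_lt hi₁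
    obtain ⟨i, rfl⟩ := Fin.exists_succ_eq.2 hp
    have hlt : ∀ j : Fin n, i.succ ≤ j.castSucc → W.curve i X < W.curve j X := fun j hj => hc (by
      simp only [Fin.le_def, Fin.val_castSucc, Fin.val_succ] at hj
      exact Fin.lt_def.2 (by omega))
    have hev : ∀ᶠ Y in 𝓝[>] (W.curve i X), ∀ j : Fin n, i.succ ≤ j.castSucc → Y < W.curve j X := by
      rw [eventually_all]
      intro j
      by_cases hj : i.succ ≤ j.castSucc
      · filter_upwards [nhdsWithin_le_nhds (Iio_mem_nhds (hlt j hj))] with Y hY _ using hY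
      · exact Eventually.of_forall fun Y h => absurd h hj
    obtain ⟨Y, hY, hY'⟩ := (hev.and self_mem_nhdsWithin).exists
    refine ⟨Y, fun j => ⟨fun h => lt_of_le_of_lt (hc.monotone ?_) hY', hY j⟩⟩
    simp only [Fin.lt_def, Fin.val_castSucc, Fin.val_succ] at h
    exact Fin.le_def.2 (by omega)
  · push Not at h1
    obtain ⟨Y, hY⟩ := (hfin univ).bddBelow
    refine ⟨Y - 1, fun j => ⟨fun h => absurd h (not_lt.2 (h1 j)), fun _ => ?_⟩⟩
    have := hY (mem_image_of_mem _ (mem_univ j))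
    linarith

/-- Allows estimates known inside the open strips to be carried to the walls by continuity. -/
theorem curve_mem_closure_castSucc (hc : StrictMono fun i => W.curve i X) (i : Fin n) :
    W.curve i X ∈ closure (W.strip i.castSucc X) := by
  obtain ⟨m, hm⟩ := strip_nonempty (p := i.castSucc) hc
  have h1 := (hm i).2 le_rfl
  refine closure_mono (inter_subset_left (t := Ioi m)) ?_
  rw [strip_inter_Ioi_castSucc hc hm, closure_Ioo h1.ne]
  exact right_mem_Icc.2 h1.le

theorem curve_mem_closure_succ (hc : StrictMono fun i => W.curve i X) (i : Fin n) :
    W.curve i X ∈ closure (W.strip i.succ X) := by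
  obtain ⟨m, hm⟩ := strip_nonempty (p := i.succ) hc
  have h1 := (hm i).1 Fin.castSucc_lt_succ
  refine closure_mono (inter_subset_left (t := Iio m)) ?_
  rw [strip_inter_Iio_succ hc hm, closure_Ioo h1.ne]
  exact left_mem_Icc.2 h1.le

theorem setIntegral_strip_eq {f : ℝ → ℝ} (hf : IntegrableOn f (W.strip p X)) (m : ℝ) :
    ∫ Y in W.strip p X, f Y
      = (∫ Y in W.strip p X ∩ Iio m, f Y) + ∫ Y in W.strip p X ∩ Ioi m, f Y := by
  have h1 : (W.strip p X ∩ Iio m ∪ W.strip p X ∩ Ioi m : Set ℝ) =ᵐ[volume] W.strip p X := by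
    rw [← inter_union_distrib_left, Iio_union_Ioi]
    have : ({m}ᶜ : Set ℝ) =ᵐ[volume] univ := by
      rw [ae_eq_univ, compl_compl]
      exact Real.volume_singleton
    have h2 := (ae_eq_refl (W.strip p X)).inter this
    rwa [inter_univ] at h2
  rw [← setIntegral_congr_set h1, setIntegral_union]
  · exact disjoint_left.2 fun Y hY hY' => lt_asymm (mem_Iio.1 hY.2) (mem_Ioi.1 hY'.2)
  · exact measurableSet_strip.inter measurableSet_Ioi
  · exact hf.mono_set inter_subset_left
  · exact hf.mono_set inter_subset_left

end Medium

end ModePE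

/-! ### Integrals over strips: fundamental theorem and Leibniz rule. -/

namespace ModePE

/-- The value at the right end of the strip `p` (zero if there is none). -/
def endR {n : ℕ} (g : Fin n → ℝ) (p : Fin (n + 1)) : ℝ :=
  Fin.lastCases (motive := fun _ => ℝ) 0 g p

/-- The value at the left end of the strip `p` (zero if there is none). -/
def endL {n : ℕ} (g : Fin n → ℝ) (p : Fin (n + 1)) : ℝ :=
  Fin.cases (motive := fun _ => ℝ) 0 g p

@[simp] theorem endR_last {n : ℕ} (g : Fin n → ℝ) : endR g (Fin.last n) = 0 := by simp [endR]

@[simp] theorem endR_castSucc {n : ℕ} (g : Fin n → ℝ) (i : Fin n) : endR g i.castSucc = g i := by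
  simp [endR]

@[simp] theorem endL_zero {n : ℕ} (g : Fin n → ℝ) : endL g 0 = 0 := rfl

@[simp] theorem endL_succ {n : ℕ} (g : Fin n → ℝ) (i : Fin n) : endL g i.succ = g i := rfl

theorem eventually_forall_uIcc {P : ℝ → Prop} {x₀ : ℝ} (h : ∀ᶠ x in 𝓝 x₀, P x) :
    ∀ᶠ x in 𝓝 x₀, ∀ x' ∈ uIcc x₀ x, P x' := by
  obtain ⟨δ, hδ, hball⟩ := Metric.eventually_nhds_iff_ball.1 h
  filter_upwards [Metric.ball_mem_nhds x₀ hδ] with x hx x' hx'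
  refine hball x' ?_
  rw [Metric.mem_ball, Real.dist_eq] at hx ⊢
  exact (abs_sub_left_of_mem_uIcc hx').trans_lt hx

namespace Medium

variable {n : ℕ} {W : Medium n} {H L ε X : ℝ} {p : Fin (n + 1)}

/-- An unbounded end contributes nothing: an integrable function with integrable derivative tends to
zero at infinity. -/
theorem integral_strip_of_hasDerivAt (hc : StrictMono fun i => W.curve i X) {I I' : ℝ → ℝ}
    (hI : ∀ Y, HasDerivAt I (I' Y) Y) (hint : IntegrableOn I (W.strip p X))
    (hint' : IntegrableOn I' (W.strip p X)) :
    ∫ Y in W.strip p X, I' Y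
      = endR (fun i => I (W.curve i X)) p - endL (fun i => I (W.curve i X)) p := by
  obtain ⟨m, hm⟩ := strip_nonempty (p := p) hc
  rw [setIntegral_strip_eq hint' m]
  have hfin : ∀ a b, a ≤ b → IntegrableOn I' (Ioo a b) → ∫ Y in Ioo a b, I' Y = I b - I a :=
    fun a b hab hi => by
      rw [← integral_Ioc_eq_integral_Ioo, ← intervalIntegral.integral_of_le hab]
      refine intervalIntegral.integral_eq_sub_of_hasDerivAt (fun Y _ => hI Y) ?_
      rwa [intervalIntegrable_iff_integrableOn_Ioo_of_le hab]
  have hR : ∫ Y in W.strip p X ∩ Ioi m, I' Y = endR (fun i => I (W.curve i X)) p - I m := by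
    have i1 := hint.mono_set (inter_subset_left (t := Ioi m))
    have i2 := hint'.mono_set (inter_subset_left (t := Ioi m))
    induction p using Fin.lastCases with
    | last =>
      rw [strip_inter_Ioi_last hm] at i1 i2 ⊢
      rw [endR_last]
      exact integral_Ioi_of_hasDerivAt_of_tendsto' (fun Y _ => hI Y) i2
        (tendsto_zero_of_hasDerivAt_of_integrableOn_Ioi (fun Y _ => hI Y) i2 i1)
    | cast i =>
      rw [strip_inter_Ioi_castSucc hc hm] at i2 ⊢
      rw [endR_castSucc]
      exact hfin _ _ ((hm i).2 le_rfl).le i2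
  have hL : ∫ Y in W.strip p X ∩ Iio m, I' Y = I m - endL (fun i => I (W.curve i X)) p := by
    have i1 := hint.mono_set (inter_subset_left (t := Iio m))
    have i2 := hint'.mono_set (inter_subset_left (t := Iio m))
    induction p using Fin.cases with
    | zero =>
      rw [strip_inter_Iio_zero hm] at i1 i2 ⊢
      rw [← integrableOn_Iic_iff_integrableOn_Iio] at i1 i2
      rw [endL_zero, ← integral_Iic_eq_integral_Iio]
      exact integral_Iic_of_hasDerivAt_of_tendsto' (fun Y _ => hI Y) i2
        (tendsto_zero_of_hasDerivAt_of_integrableOn_Iic (fun Y _ => hI Y) i2 i1)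
    | succ i =>
      rw [strip_inter_Iio_succ hc hm] at i2 ⊢
      rw [endL_succ]
      exact hfin _ _ ((hm i).1 Fin.castSucc_lt_succ).le i2
  rw [hR, hL]
  ring

theorem Regular.hasDerivAt_curve (hW : W.Regular H L ε) (hX : X ∈ Ioo 0 L) (i : Fin n) :
    HasDerivAt (W.curve i) (deriv (W.curve i) X) X :=
  (((hW.curve_smooth i).contDiffAt (isOpen_Ioo.mem_nhds hX)).differentiableAt
    one_ne_zero).hasDerivAt

/-- Leibniz rule for the integral over a strip. -/
theorem slopeBound_integral_strip (hW : W.Regular H L ε) (hX : X ∈ Ioo 0 L) {f : ℝ → ℝ → ℝ}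
    {G q b : ℝ → ℝ} (hG : Integrable G)
    (hf : ContinuousOn (fun q : ℝ × ℝ => f q.1 q.2) (Ioo 0 L ×ˢ univ))
    (hbound : ∀ᶠ x in 𝓝 X, ∀ Y ∈ W.strip p x, |f x Y| ≤ G Y)
    (hlip : ∀ᶠ x in 𝓝 X, ∀ Y, (∀ x' ∈ uIcc X x, Y ∈ W.strip p x') →
      |f x Y - f X Y| ≤ G Y * |x - X|)
    (hq : AEStronglyMeasurable q (volume.restrict (W.strip p X)))
    (hb : IntegrableOn b (W.strip p X))
    (hslope : ∀ᵐ Y, Y ∈ W.strip p X → SlopeBound (fun x => f x Y) (q Y) (b Y) X) :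
    IntegrableOn q (W.strip p X) ∧
      SlopeBound (fun x => ∫ Y in W.strip p x, f x Y)
        ((∫ Y in W.strip p X, q Y)
          + endR (fun i => deriv (W.curve i) X * f X (W.curve i X)) p
          - endL (fun i => deriv (W.curve i) X * f X (W.curve i X)) p)
        (∫ Y in W.strip p X, b Y) X := by
  -- By continuity of the walls `m` remains in the strip for nearby stations, so the same cut can be
  -- used for all of them.
  obtain ⟨m, hm⟩ := strip_nonempty (p := p) (hW.curve_lt X hX)
  have hnear : ∀ᶠ x in 𝓝 X, x ∈ Ioo 0 L := isOpen_Ioo.mem_nhds hX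
  have hmx := eventually_mem_strip hW hX hm
  have hcx : ∀ᶠ x in 𝓝 X, Continuous (f x) := hnear.mono fun x hx =>
    hf.comp_continuous (f := fun Y => (x, Y)) (by fun_prop) fun _ => ⟨hx, mem_univ _⟩
  have hcat : ∀ Y, ContinuousAt (fun q : ℝ × ℝ => f q.1 q.2) (X, Y) := fun Y =>
    hf.continuousAt ((ModePE.isOpen_strip L).mem_nhds ⟨hX, mem_univ _⟩)
  have hfint : ∀ᶠ x in 𝓝 X, IntegrableOn (f x) (W.strip p x) := by
    filter_upwards [hcx, hbound] with x hx hbx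
    refine hG.integrableOn.mono' hx.aestronglyMeasurable ?_
    rw [ae_restrict_iff' measurableSet_strip]
    exact Eventually.of_forall fun Y hY => hbx Y hY
  have hR : IntegrableOn q (W.strip p X ∩ Ioi m) ∧
      SlopeBound (fun x => ∫ Y in W.strip p x ∩ Ioi m, f x Y)
        ((∫ Y in W.strip p X ∩ Ioi m, q Y)
          + endR (fun i => deriv (W.curve i) X * f X (W.curve i X)) p)
        (∫ Y in W.strip p X ∩ Ioi m, b Y) X := by
    have hq' := hq.mono_set (inter_subset_left (t := Ioi m))
    have hb' := hb.mono_set (inter_subset_left (t := Ioi m))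
    have hs' : ∀ᵐ Y, Y ∈ W.strip p X ∩ Ioi m →
      SlopeBound (fun x => f x Y) (q Y) (b Y) X := by
      filter_upwards [hslope] with Y hY hY' using hY hY'.1
    induction p using Fin.lastCases with
    | last =>
      have he : ∀ᶠ x in 𝓝 X, W.strip (Fin.last n) x ∩ Ioi m = Ioi m :=
        hmx.mono fun x hx => strip_inter_Ioi_last hx
      rw [strip_inter_Ioi_last hm] at hq' hb' hs' ⊢
      rw [endR_last, add_zero]
      obtain ⟨h1, h2⟩ := SlopeBound.setIntegral measurableSet_Ioi hG.integrableOn hq' hb'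
        (by
          filter_upwards [hfint, he] with x hx hex
          rw [← hex]
          exact hx.mono_set inter_subset_left)
        (by
          -- The Lipschitz bound is available only for points which belong to the strip at all
          -- stations between `X` and `x`; the half-line does.
          filter_upwards [hlip, eventually_forall_uIcc he] with x hx hex Y hY
          refine hx Y fun x' hx' => ?_
          rw [← hex x' hx'] at hY
          exact hY.1) hs'
      refine ⟨h1, h2.congr ?_⟩
      filter_upwards [he] with x hx
      rw [hx]
    | cast i =>
      have hmx' : ∀ᶠ x in 𝓝 X, m ∈ W.strip i.castSucc x ∧ x ∈ Ioo 0 L := hmx.and hnear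
      have he : ∀ᶠ x in 𝓝 X, W.strip i.castSucc x ∩ Ioi m = Ioo m (W.curve i x) :=
        hmx'.mono fun x hx => strip_inter_Ioi_castSucc (hW.curve_lt x hx.2) hx.1
      rw [he.self_of_nhds] at hq' hb' hs' ⊢
      rw [endR_castSucc]
      obtain ⟨h1, h2⟩ := SlopeBound.intervalIntegral (hW.hasDerivAt_curve hX i)
        ((hm i).2 le_rfl) hG.integrableOn hq' hb' hcx (hcat _)
        (by
          filter_upwards [hlip, eventually_forall_uIcc he] with x hx hex Y hY hY'
          refine hx Y fun x' hx' => ?_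
          have : Y ∈ Ioo m (W.curve i x') := ⟨hY, hY' x' hx'⟩
          rw [← hex x' hx'] at this
          exact this.1) hs'
      refine ⟨h1, h2.congr ?_⟩
      filter_upwards [he, hmx] with x hx hmx
      rw [hx, intervalIntegral.integral_of_le ((hmx i).2 le_rfl).le, integral_Ioc_eq_integral_Ioo]
  have hL : IntegrableOn q (W.strip p X ∩ Iio m) ∧
      SlopeBound (fun x => ∫ Y in W.strip p x ∩ Iio m, f x Y)
        ((∫ Y in W.strip p X ∩ Iio m, q Y)
          - endL (fun i => deriv (W.curve i) X * f X (W.curve i X)) p)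
        (∫ Y in W.strip p X ∩ Iio m, b Y) X := by
    have hq' := hq.mono_set (inter_subset_left (t := Iio m))
    have hb' := hb.mono_set (inter_subset_left (t := Iio m))
    have hs' : ∀ᵐ Y, Y ∈ W.strip p X ∩ Iio m →
      SlopeBound (fun x => f x Y) (q Y) (b Y) X := by
      filter_upwards [hslope] with Y hY hY' using hY hY'.1
    induction p using Fin.cases with
    | zero =>
      have he : ∀ᶠ x in 𝓝 X, W.strip 0 x ∩ Iio m = Iio m :=
        hmx.mono fun x hx => strip_inter_Iio_zero hx
      rw [strip_inter_Iio_zero hm] at hq' hb' hs' ⊢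
      rw [endL_zero, sub_zero]
      obtain ⟨h1, h2⟩ := SlopeBound.setIntegral measurableSet_Iio hG.integrableOn hq' hb'
        (by
          filter_upwards [hfint, he] with x hx hex
          rw [← hex]
          exact hx.mono_set inter_subset_left)
        (by
          filter_upwards [hlip, eventually_forall_uIcc he] with x hx hex Y hY
          refine hx Y fun x' hx' => ?_
          rw [← hex x' hx'] at hY
          exact hY.1) hs'
      refine ⟨h1, h2.congr ?_⟩
      filter_upwards [he] with x hx
      rw [hx]
    | succ i =>
      have hmx' : ∀ᶠ x in 𝓝 X, m ∈ W.strip i.succ x ∧ x ∈ Ioo 0 L := hmx.and hnear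
      have he : ∀ᶠ x in 𝓝 X, W.strip i.succ x ∩ Iio m = Ioo (W.curve i x) m :=
        hmx'.mono fun x hx => strip_inter_Iio_succ (hW.curve_lt x hx.2) hx.1
      rw [he.self_of_nhds] at hq' hb' hs' ⊢
      rw [endL_succ]
      obtain ⟨h1, h2⟩ := SlopeBound.intervalIntegral_left (hW.hasDerivAt_curve hX i)
        ((hm i).1 Fin.castSucc_lt_succ) hG.integrableOn hq' hb' hcx (hcat _)
        (by
          filter_upwards [hlip, eventually_forall_uIcc he] with x hx hex Y hY hY'
          refine hx Y fun x' hx' => ?_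
          have : Y ∈ Ioo (W.curve i x') m := ⟨hY' x' hx', hY⟩
          rw [← hex x' hx'] at this
          exact this.1) hs'
      refine ⟨h1, h2.congr ?_⟩
      filter_upwards [he, hmx] with x hx hmx
      rw [hx, intervalIntegral.integral_of_le ((hmx i).1 Fin.castSucc_lt_succ).le,
        integral_Ioc_eq_integral_Ioo]
  have hqi : IntegrableOn q (W.strip p X) := by
    have h1 : IntegrableOn q (W.strip p X ∩ Iio m ∪ W.strip p X ∩ Ioi m ∪ {m}) :=
      (hL.1.union hR.1).union (by simp)
    refine h1.mono_set fun Y hY => ?_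
    rcases lt_trichotomy Y m with h | h | h
    · exact Or.inl (Or.inl ⟨hY, h⟩)
    · exact Or.inr h
    · exact Or.inl (Or.inr ⟨hY, h⟩)
  refine ⟨hqi, ?_⟩
  have h1 := hL.2.add hR.2
  rw [← setIntegral_strip_eq hb m] at h1
  rw [setIntegral_strip_eq hqi m]
  have e : ∀ a c d e : ℝ, a + c + d - e = (a - e) + (c + d) := fun a c d e => by ring
  rw [e]
  refine h1.congr ?_
  filter_upwards [hfint] with x hx using setIntegral_strip_eq hx m

end Medium
end ModePE

/-! ### Size, leading term and continuity of the flux density. -/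

namespace ModePE

theorem endR_sub {n : ℕ} (f g : Fin n → ℝ) (p : Fin (n + 1)) :
    endR (fun i => f i - g i) p = endR f p - endR g p := by
  induction p using Fin.lastCases <;> simp

theorem endL_sub {n : ℕ} (f g : Fin n → ℝ) (p : Fin (n + 1)) :
    endL (fun i => f i - g i) p = endL f p - endL g p := by
  induction p using Fin.cases <;> simp

/-- Summation of the contributions of the ends of the strips by walls. -/
theorem sum_endR_sub_endL {n : ℕ} (s : Set (Fin (n + 1))) [DecidablePred (· ∈ s)]
    (g : Fin (n + 1) → Fin n → ℝ) :
    ∑ p, (if p ∈ s then endR (g p) p - endL (g p) p else 0)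
      = ∑ i : Fin n, ((if i.castSucc ∈ s then g i.castSucc i else 0)
        - (if i.succ ∈ s then g i.succ i else 0)) := by
  have h1 : ∀ p, (if p ∈ s then endR (g p) p - endL (g p) p else 0)
      = (if p ∈ s then endR (g p) p else 0) - (if p ∈ s then endL (g p) p else 0) := fun p => by
    split_ifs <;> simp
  simp only [h1, Finset.sum_sub_distrib]
  congr 1
  · rw [Fin.sum_univ_castSucc]
    simp
  · rw [Fin.sum_univ_succ]
    simp

/-- The complex energy flux, of which `fluxDensity` is the imaginary part. -/
noncomputable def complexFlux {ι : Type*} [Fintype ι] (ε : ℝ) (k : ι → ℝ) (A B e : ι → ℂ)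
    (m N : ι → ι → ℝ) : ℂ :=
  ∑ j, conj (A j) * (Complex.I * k j * A j + ε * B j)
    + ∑ j, ∑ l, (conj (A l * e l) * ((Complex.I * k j * A j + ε * B j) * e j) * m j l
        + ε * (conj (A l * e l) * (A j * e j)) * N j l)

section Values

variable {ι : Type*} [Fintype ι] {ε b c S : ℝ} {k : ι → ℝ} {A B e : ι → ℂ} {m N : ι → ι → ℝ}

theorem complexFlux_im : (complexFlux ε k A B e m N).im = fluxDensity ε k A B e m N := by
  rw [complexFlux, fluxDensity, Complex.add_im, Complex.im_sum, Complex.im_sum]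
  congr 1
  refine Finset.sum_congr rfl fun j _ => ?_
  rw [Complex.im_sum]
  refine Finset.sum_congr rfl fun l _ => ?_
  rw [Complex.add_im, Complex.im_mul_ofReal, Complex.im_mul_ofReal, Complex.im_ofReal_mul]

theorem norm_sum_sum_le {F : ι → ι → ℂ} {c : ℝ}
    (h : ∀ j l, ‖F j l‖ ≤ c) : ‖∑ j, ∑ l, F j l‖ ≤ (Fintype.card ι : ℝ) ^ 2 * c := by
  have h1 : ∀ j, ‖∑ l, F j l‖ ≤ Fintype.card ι * c := fun j => by
    refine (norm_sum_le _ _).trans ?_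
    simpa using Finset.sum_le_sum fun l (_ : l ∈ Finset.univ) => h j l
  refine (norm_sum_le _ _).trans ?_
  have := Finset.sum_le_sum fun j (_ : j ∈ Finset.univ) => h1 j
  simp only [Finset.sum_const, Finset.card_univ, nsmul_eq_mul] at this
  calc _ ≤ _ := this
    _ = _ := by ring

/-- The leading term is the part of the diagonal without `ε`; everything else carries a factor `ε`,
either explicitly or through `m`. No smallness of `N` is needed. -/
theorem norm_complexFlux_sub_le (hε : 0 < ε) (hε1 : ε ≤ 1) (hb : 1 ≤ b) (hc : 1 ≤ c)
    (he : ∀ j, ‖e j‖ = 1) (hA : ∀ j, ‖A j‖ ^ 2 ≤ S) (hB : ∀ j, ‖B j‖ ^ 2 ≤ S)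
    (hk : ∀ j, |k j| ≤ b) (hm : ∀ j l, |m j l| ≤ c * ε) (hN : ∀ j l, |N j l| ≤ c) :
    ‖complexFlux ε k A B e m N - Complex.I * ((∑ j, k j * ‖A j‖ ^ 2 : ℝ) : ℂ)‖
      ≤ ((Fintype.card ι : ℝ) + 3 * (Fintype.card ι : ℝ) ^ 2) * (b * c) * S * ε := by
  have e1 : complexFlux ε k A B e m N - Complex.I * ((∑ j, k j * ‖A j‖ ^ 2 : ℝ) : ℂ)
      = ∑ j, ε * (conj (A j) * B j)
        + ∑ j, ∑ l, (conj (A l * e l) * ((Complex.I * k j * A j + ε * B j) * e j) * m j l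
        + ε * (conj (A l * e l) * (A j * e j)) * N j l) := by
    rw [complexFlux, add_sub_right_comm]
    congr 1
    rw [Complex.ofReal_sum, Finset.mul_sum, ← Finset.sum_sub_distrib]
    refine Finset.sum_congr rfl fun j _ => ?_
    have : ((k j * ‖A j‖ ^ 2 : ℝ) : ℂ) = k j * (conj (A j) * A j) := by
      rw [Complex.conj_mul']
      push_cast
      rfl
    rw [this]
    ring
  rw [e1]
  have hεn : ‖(ε : ℂ)‖ = ε := by simp [abs_of_pos hε]
  have h1 : ∀ j, ‖(ε : ℂ) * (conj (A j) * B j)‖ ≤ ε * S := fun j => by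
    rw [norm_mul, norm_mul, RCLike.norm_conj, hεn]
    have := norm_mul_norm_le (hA j) (hB j)
    gcongr
  have h2 : ∀ j l, ‖conj (A l * e l) * ((Complex.I * k j * A j + ε * B j) * e j) * m j l
        + ε * (conj (A l * e l) * (A j * e j)) * N j l‖ ≤ 3 * (b * c) * S * ε := fun j l => by
    have n1 := norm_mul_norm_le (hA l) (hA j)
    have n2 := norm_mul_norm_le (hA l) (hB j)
    have hS0 : 0 ≤ S := (sq_nonneg _).trans (hA j)
    have n3 : ‖Complex.I * k j * A j + ε * B j‖ ≤ b * ‖A j‖ + 1 * ‖B j‖ := by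
      refine (norm_add_le _ _).trans ?_
      simp only [norm_mul, Complex.norm_I, one_mul]
      gcongr
      · simpa using hk j
      · rw [hεn]; exact mul_le_of_le_one_left (norm_nonneg _) hε1
    refine (norm_add_le _ _).trans ?_
    simp only [norm_mul, RCLike.norm_conj, he, mul_one, Complex.norm_real, Real.norm_eq_abs,
      abs_of_pos hε]
    calc _ ≤ ‖A l‖ * (b * ‖A j‖ + 1 * ‖B j‖) * (c * ε) + ε * (‖A l‖ * ‖A j‖) * c := by
          gcongr
          · exact hm j l
          · exact hN j l
      _ = (b * (‖A l‖ * ‖A j‖) + 1 * (‖A l‖ * ‖B j‖)) * (c * ε) + ε * (‖A l‖ * ‖A j‖) * c := by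
          ring
      _ ≤ (b * S + b * S) * (c * ε) + ε * (b * S) * c := by
          have h3 : S ≤ b * S := le_mul_of_one_le_left hS0 hb
          have hb0 : 0 ≤ b := zero_le_one.trans hb
          have hc0 : 0 ≤ c := zero_le_one.trans hc
          have n4 : b * (‖A l‖ * ‖A j‖) + 1 * (‖A l‖ * ‖B j‖) ≤ b * S + b * S :=
            add_le_add (mul_le_mul_of_nonneg_left n1 hb0) (by rw [one_mul]; exact n2.trans h3)
          exact add_le_add (mul_le_mul_of_nonneg_right n4 (by positivity))
            (mul_le_mul_of_nonneg_right (mul_le_mul_of_nonneg_left (n1.trans h3) hε.le) hc0)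
      _ = _ := by ring
  refine (norm_add_le _ _).trans ((add_le_add ((norm_sum_le _ _).trans
    (Finset.sum_le_sum fun j _ => h1 j)) (norm_sum_sum_le h2)).trans ?_)
  simp only [Finset.sum_const, Finset.card_univ, nsmul_eq_mul]
  rcases isEmpty_or_nonempty ι with hι | ⟨⟨j⟩⟩
  · simp
  · have hS0 : 0 ≤ S := (sq_nonneg _).trans (hA j)
    have : S ≤ b * c * S := le_mul_of_one_le_left hS0 (one_le_mul_of_one_le_of_one_le hb hc)
    calc _ ≤ (Fintype.card ι : ℝ) * (ε * (b * c * S))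
          + (Fintype.card ι : ℝ) ^ 2 * (3 * (b * c) * S * ε) := by gcongr
      _ = _ := by ring

end Values

namespace Modes

variable {n : ℕ} {ι : Type*} [Fintype ι] {D : Modes ι} {W : Medium n} {H L ε K X Y : ℝ}
  {p : Fin (n + 1)} {A : Fin (n + 1) → ι → ℝ → ℝ → ℂ}

/-- The density with respect to `Y` of the complex energy flux in the strip `p`. -/
noncomputable def stripFluxC (D : Modes ι) (W : Medium n) (H ε : ℝ)
    (A : Fin (n + 1) → ι → ℝ → ℝ → ℂ) (p : Fin (n + 1)) (X Y : ℝ) : ℂ :=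
  complexFlux ε (fun j => D.k j X) (fun j => A p j X Y) (fun j => dX (A p j) X Y)
    (fun j => D.expθ ε j X) (fun j l => W.corr H ε p (D.φφ j l) X Y)
    (fun j l => D.elemN W H ε p j l X Y)

/-- The sum of the squares of the amplitudes and of their first derivatives. -/
noncomputable def ampSq₁ (A : Fin (n + 1) → ι → ℝ → ℝ → ℂ) (p : Fin (n + 1)) (X Y : ℝ) : ℝ :=
  ∑ j, (‖A p j X Y‖ ^ 2 + ‖dX (A p j) X Y‖ ^ 2)

/-- The leading term of the flux density. -/
noncomputable def leadFlux (D : Modes ι) (A : Fin (n + 1) → ι → ℝ → ℝ → ℂ) (p : Fin (n + 1))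
    (X Y : ℝ) : ℝ :=
  ∑ j, D.k j X * ‖A p j X Y‖ ^ 2

/-- Bound for the flux density. -/
noncomputable def fluxConst (ι : Type*) [Fintype ι] (H K : ℝ) : ℝ :=
  ((Fintype.card ι : ℝ) + 3 * (Fintype.card ι : ℝ) ^ 2) * (max K 1 * elemConst H K)

theorem fluxConst_nonneg {H : ℝ} (hH : 0 < H) (K : ℝ) : 0 ≤ fluxConst ι H K := by
  have := one_le_elemConst hH K
  unfold fluxConst
  positivity

theorem stripFluxC_im : (D.stripFluxC W H ε A p X Y).im = D.stripFlux W H ε A p X Y :=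
  complexFlux_im

theorem ampSq₁_nonneg : 0 ≤ ampSq₁ A p X Y := Finset.sum_nonneg fun _ _ => by positivity

theorem ampSq_nonneg : 0 ≤ ampSq A p X Y := Finset.sum_nonneg fun _ _ => by positivity

theorem ampSq₁_le_ampSq : ampSq₁ A p X Y ≤ ampSq A p X Y :=
  Finset.sum_le_sum fun _ _ => le_add_of_nonneg_right (by positivity)

theorem le_ampSq₁ (j : ι) :
    ‖A p j X Y‖ ^ 2 ≤ ampSq₁ A p X Y ∧ ‖dX (A p j) X Y‖ ^ 2 ≤ ampSq₁ A p X Y := by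
  have := Finset.single_le_sum (f := fun j => ‖A p j X Y‖ ^ 2 + ‖dX (A p j) X Y‖ ^ 2)
      (fun j _ => by positivity) (Finset.mem_univ j)
  have h1 := sq_nonneg ‖A p j X Y‖
  have h2 := sq_nonneg ‖dX (A p j) X Y‖
  rw [ampSq₁]
  constructor <;> linarith

namespace Admissible

theorem norm_stripFluxC_sub_le (h : Admissible D W H L ε K A) (hX : X ∈ Ioo 0 L) (hp : p ∈ W.wet)
    (hY : Y ∈ W.strip p X) :
    ‖D.stripFluxC W H ε A p X Y - Complex.I * D.leadFlux A p X Y‖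
      ≤ fluxConst ι H K * ampSq₁ A p X Y * ε := by
  rw [leadFlux]
  exact norm_complexFlux_sub_le h.ε_pos h.ε_le (le_max_right _ _)
    (one_le_elemConst h.H_pos K) (fun j => norm_expθ j) (fun j => (le_ampSq₁ j).1)
    (fun j => (le_ampSq₁ j).2)
    (fun j => (h.modes_bounded.k_bound j X hX).1.trans (le_max_left _ _))
    (fun j l => (h.exists_slopeBound_elem hX hp hY j l).1.1)
    (fun j l => (h.exists_slopeBound_elem hX hp hY j l).2.2.1)

theorem abs_leadFlux_le (h : Admissible D W H L ε K A) (hX : X ∈ Ioo 0 L) :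
    |D.leadFlux A p X Y| ≤ fluxConst ι H K * ampSq₁ A p X Y := by
  have h1 : |D.leadFlux A p X Y| ≤ Fintype.card ι * (max K 1 * ampSq₁ A p X Y) :=
    abs_sum_le fun j => abs_mul_le_of_le
      ((h.modes_bounded.k_bound j X hX).1.trans (le_max_left _ _))
      (by rw [abs_of_nonneg (by positivity)]; exact (le_ampSq₁ j).1)
  have h2 := one_le_elemConst h.H_pos K
  have h3 : 0 ≤ max K 1 := zero_le_one.trans (le_max_right _ _)
  have h4 : 0 ≤ ampSq₁ A p X Y := ampSq₁_nonneg
  refine h1.trans ?_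
  calc (Fintype.card ι : ℝ) * (max K 1 * ampSq₁ A p X Y)
      = (Fintype.card ι : ℝ) * (max K 1 * 1) * ampSq₁ A p X Y := by ring
    _ ≤ fluxConst ι H K * ampSq₁ A p X Y := by
        unfold fluxConst
        gcongr
        have : (0 : ℝ) ≤ 3 * (Fintype.card ι : ℝ) ^ 2 := by positivity
        linarith

theorem norm_stripFluxC_le (h : Admissible D W H L ε K A) (hX : X ∈ Ioo 0 L) (hp : p ∈ W.wet)
    (hY : Y ∈ W.strip p X) :
    ‖D.stripFluxC W H ε A p X Y‖ ≤ 2 * fluxConst ι H K * ampSq A p X Y := by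
  have h1 := h.norm_stripFluxC_sub_le hX hp hY
  have h2 := h.abs_leadFlux_le (p := p) (Y := Y) hX
  have h3 := fluxConst_nonneg (ι := ι) h.H_pos K
  have h4 : 0 ≤ ampSq₁ A p X Y := ampSq₁_nonneg
  have h5 : ampSq₁ A p X Y ≤ ampSq A p X Y := ampSq₁_le_ampSq
  calc ‖D.stripFluxC W H ε A p X Y‖
      = ‖(D.stripFluxC W H ε A p X Y - Complex.I * D.leadFlux A p X Y)
          + Complex.I * D.leadFlux A p X Y‖ := by ring_nf
    _ ≤ fluxConst ι H K * ampSq₁ A p X Y * ε + fluxConst ι H K * ampSq₁ A p X Y := by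
        refine (norm_add_le _ _).trans (add_le_add h1 ?_)
        simpa using h2
    _ ≤ fluxConst ι H K * ampSq₁ A p X Y * 1 + fluxConst ι H K * ampSq₁ A p X Y := by
        have := h.ε_le
        gcongr
    _ = 2 * fluxConst ι H K * ampSq₁ A p X Y := by ring
    _ ≤ _ := by gcongr

theorem continuousOn_stripFluxC (h : Admissible D W H L ε K A) (hp : p ∈ W.wet) :
    ContinuousOn (fun q : ℝ × ℝ => D.stripFluxC W H ε A p q.1 q.2) (Ioo 0 L ×ˢ univ) := by
  have hfst : ∀ {F : Type _} [TopologicalSpace F] {g : ℝ → F}, ContinuousOn g (Ioo 0 L) →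
      ContinuousOn (fun q : ℝ × ℝ => g q.1) (Ioo 0 L ×ˢ univ) := fun hg =>
    hg.comp continuousOn_fst fun q hq => hq.1
  have hA : ∀ j, ContinuousOn (fun q : ℝ × ℝ => A p j q.1 q.2) (Ioo 0 L ×ˢ univ) := fun j =>
    (h.smooth_A hp j).continuousOn
  have hB : ∀ j, ContinuousOn (fun q : ℝ × ℝ => dX (A p j) q.1 q.2) (Ioo 0 L ×ˢ univ) := fun j =>
    ((h.smooth_A hp j).dX (m := 1) (by norm_num)).continuousOn
  have hk : ∀ j, ContinuousOn (fun q : ℝ × ℝ => ((D.k j q.1 : ℝ) : ℂ)) (Ioo 0 L ×ˢ univ) :=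
    fun j => Complex.continuous_ofReal.comp_continuousOn
      (hfst (h.spectral.k_smooth j).continuousOn)
  have he : ∀ j, ContinuousOn (fun q : ℝ × ℝ => D.expθ ε j q.1) (Ioo 0 L ×ˢ univ) := fun j =>
    hfst fun x hx => (h.hasDerivAt_expθ hx j).continuousAt.continuousWithinAt
  have hm : ∀ j l, ContinuousOn (fun q : ℝ × ℝ => ((W.corr H ε p (D.φφ j l) q.1 q.2 : ℝ) : ℂ))
      (Ioo 0 L ×ˢ univ) := fun j l => Complex.continuous_ofReal.comp_continuousOn
    (Medium.continuousOn_corr h.regular p fun s => (h.spectral.smooth_φφ j l s).continuousOn)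
  have hN : ∀ j l, ContinuousOn (fun q : ℝ × ℝ => ((D.elemN W H ε p j l q.1 q.2 : ℝ) : ℂ))
      (Ioo 0 L ×ˢ univ) := fun j l => Complex.continuous_ofReal.comp_continuousOn
    ((hfst fun x hx => by
      obtain ⟨d, hd, -⟩ := (h.C_bound hx j l).2
      exact hd.continuousAt.continuousWithinAt).add
    (Medium.continuousOn_corr h.regular p fun s => (h.spectral.smooth_φXφ j l s).continuousOn))
  have hconj : ∀ {g : ℝ × ℝ → ℂ}, ContinuousOn g (Ioo 0 L ×ˢ univ) →
      ContinuousOn (fun q => conj (g q)) (Ioo 0 L ×ˢ univ) := fun hg =>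
    Complex.continuous_conj.comp_continuousOn hg
  refine ContinuousOn.add (continuousOn_finsetSum _ fun j _ => ?_)
    (continuousOn_finsetSum _ fun j _ => continuousOn_finsetSum _ fun l _ => ?_)
  · exact (hconj (hA j)).mul (((continuousOn_const.mul (hk j)).mul (hA j)).add
      (continuousOn_const.mul (hB j)))
  · exact (((hconj ((hA l).mul (he l))).mul ((((continuousOn_const.mul (hk j)).mul (hA j)).add
      (continuousOn_const.mul (hB j))).mul (he j))).mul (hm j l)).add
      ((continuousOn_const.mul ((hconj ((hA l).mul (he l))).mul ((hA j).mul (he j)))).mul (hN j l))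

theorem continuousOn_stripFlux (h : Admissible D W H L ε K A) (hp : p ∈ W.wet) :
    ContinuousOn (fun q : ℝ × ℝ => D.stripFlux W H ε A p q.1 q.2) (Ioo 0 L ×ˢ univ) := by
  simp only [← stripFluxC_im]
  exact Complex.continuous_im.comp_continuousOn (h.continuousOn_stripFluxC hp)

end Admissible

end Modes
end ModePE

/-! ### The flux through one strip. -/

namespace ModePE

/-- A function which is Lipschitz at a point has a bounded derivative there. -/
theorem SlopeBound.abs_deriv_le {f : ℝ → ℝ} {d d' b c x₀ : ℝ} (h : SlopeBound f d b x₀)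
    (hb : 0 ≤ b) (hc : |d| + b ≤ c) (hd : HasDerivAt f d' x₀) : |d'| ≤ c := by
  refine le_of_forall_gt_imp_ge_of_dense fun r hr => ?_
  exact hd.le_of_lip' (((add_nonneg (abs_nonneg d) hb).trans hc).trans hr.le)
    (h.abs_sub_le (hc.trans_lt hr))

namespace Medium

variable {n : ℕ} {W : Medium n} {X : ℝ}

open Classical in
theorem integral_sum_strip {E : Type*} [NormedAddCommGroup E] [NormedSpace ℝ E]
    {f : Fin (n + 1) → ℝ → E} (hf : ∀ p ∈ W.wet, IntegrableOn (f p) (W.strip p X)) :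
    Integrable (fun Y => ∑ p, if p ∈ W.wet ∧ Y ∈ W.strip p X then f p Y else 0) ∧
    ∫ Y, (∑ p, if p ∈ W.wet ∧ Y ∈ W.strip p X then f p Y else 0)
      = ∑ p, if p ∈ W.wet then ∫ Y in W.strip p X, f p Y else 0 := by
  have h1 : ∀ p, Integrable (fun Y => if p ∈ W.wet ∧ Y ∈ W.strip p X then f p Y else 0) ∧
      ∫ Y, (if p ∈ W.wet ∧ Y ∈ W.strip p X then f p Y else 0)
        = if p ∈ W.wet then ∫ Y in W.strip p X, f p Y else 0 := fun p => by
    by_cases hp : p ∈ W.wet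
    · have e : (fun Y => if p ∈ W.wet ∧ Y ∈ W.strip p X then f p Y else 0)
          = (W.strip p X).indicator (f p) := by
        funext Y
        simp [hp, indicator]
      rw [e, if_pos hp, integral_indicator measurableSet_strip]
      exact ⟨(integrable_indicator_iff measurableSet_strip).2 (hf p hp), rfl⟩
    · simp [hp]
  refine ⟨integrable_finsetSum _ fun p _ => (h1 p).1, ?_⟩
  rw [integral_finsetSum _ fun p _ => (h1 p).1]
  exact Finset.sum_congr rfl fun p _ => (h1 p).2

end Medium

namespace Modes

variable {n : ℕ} {ι : Type*} [Fintype ι] {D : Modes ι} {W : Medium n} {H L ε K X Y : ℝ}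
  {p : Fin (n + 1)} {A : Fin (n + 1) → ι → ℝ → ℝ → ℂ}

namespace Admissible

/-- Locally uniform domination of the amplitudes by an integrable function. -/
theorem exists_dominating (h : Admissible D W H L ε K A) (hX : X ∈ Ioo 0 L) :
    ∃ G : ℝ → ℝ, Integrable G ∧ ∀ᶠ x in 𝓝 X, ∀ p ∈ W.wet, ∀ Y ∈ W.strip p x,
      ampSq A p x Y ≤ G Y ∧ |sideFlux A p x Y| ≤ G Y := by
  obtain ⟨δ, hδ, g, hg, hdom⟩ := h.solution.decay X hX
  refine ⟨fun Y => Fintype.card ι * g Y, hg.const_mul _, ?_⟩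
  filter_upwards [isOpen_Ioo.mem_nhds hX, Metric.ball_mem_nhds X hδ] with x hx hx' p hp Y hY
  have hd := hdom x hx (by simpa [Real.dist_eq] using hx') p hp Y hY
  constructor
  · refine (le_abs_self _).trans (abs_sum_le fun j => ?_)
    rw [abs_of_nonneg (by positivity)]
    have := hd j
    have h2 := sq_nonneg ‖deriv (A p j x) Y‖
    linarith
  · refine abs_sum_le fun j => (Complex.abs_im_le_norm _).trans ?_
    rw [norm_mul, RCLike.norm_conj]
    have := hd j
    have h1 := sq_nonneg ‖deriv (fun X' => A p j X' Y) x‖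
    have h2 := sq_nonneg ‖iteratedDeriv 2 (fun X' => A p j X' Y) x‖
    nlinarith [sq_nonneg (‖A p j x Y‖ - ‖deriv (A p j x) Y‖), sq_nonneg ‖A p j x Y‖,
      sq_nonneg ‖deriv (A p j x) Y‖]

theorem continuous_ampSq (h : Admissible D W H L ε K A) (hX : X ∈ Ioo 0 L) (hp : p ∈ W.wet) :
    Continuous (ampSq A p X) := by
  refine continuous_finsetSum _ fun j _ => ?_
  have h1 := (h.smooth_A hp j).continuous_snd hX
  have h2 := ((h.smooth_A hp j).dX (m := 1) (by norm_num)).continuous_snd hX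
  have h3 := (((h.smooth_A hp j).dX (m := 1) (by norm_num)).dX (m := 0) (by norm_num)).continuous_snd
    hX
  have e : ∀ Y, iteratedDeriv 2 (fun X' => A p j X' Y) X = dX (dX (A p j)) X Y := fun Y =>
    (dX_dX _ _ _).symm
  simp only [e]
  exact ((h1.norm.pow 2).add (h2.norm.pow 2)).add (h3.norm.pow 2)

/-- In the product rule the term `A_Y^* A_Y` is real and drops out. The derivative is what the
leading part of the flux density loses in the direction of `X`. -/
theorem hasDerivAt_sideFlux (h : Admissible D W H L ε K A) (hX : X ∈ Ioo 0 L) (hp : p ∈ W.wet)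
    (Y : ℝ) : HasDerivAt (sideFlux A p X)
      (∑ j, (conj (A p j X Y) * iteratedDeriv 2 (A p j X) Y).im) Y := by
  refine HasDerivAt.fun_sum fun j _ => ?_
  have h1 := (h.smooth_A hp j).hasDerivAt_snd one_le_two hX Y
  have h2 := ((h.smooth_A hp j).deriv_snd (m := 1) (by norm_num)).hasDerivAt_snd le_rfl hX Y
  refine (h1.complex_conj.mul h2).complex_im.congr_deriv ?_
  have e : deriv (fun z => deriv (A p j X) z) Y = iteratedDeriv 2 (A p j X) Y := by
    rw [iteratedDeriv_succ, iteratedDeriv_one]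
  rw [e, Complex.add_im, Complex.conj_mul', ← Complex.ofReal_pow, Complex.ofReal_im, zero_add]

theorem integrableOn_of_le (h : Admissible D W H L ε K A) (hX : X ∈ Ioo 0 L) (hp : p ∈ W.wet)
    {E : Type*} [NormedAddCommGroup E] {f : ℝ → E} (hf : Continuous f) {c : ℝ} (hc : 0 ≤ c)
    (hfc : ∀ Y ∈ W.strip p X, ‖f Y‖ ≤ c * ampSq A p X Y) : IntegrableOn f (W.strip p X) := by
  obtain ⟨G, hG, hGx⟩ := h.exists_dominating hX
  refine (hG.const_mul c).integrableOn.mono' hf.aestronglyMeasurable ?_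
  rw [ae_restrict_iff' Medium.measurableSet_strip]
  exact Eventually.of_forall fun Y hY => (hfc Y hY).trans
    (mul_le_mul_of_nonneg_left (hGx.self_of_nhds p hp Y hY).1 hc)

theorem integrableOn_ampSq (h : Admissible D W H L ε K A) (hX : X ∈ Ioo 0 L) (hp : p ∈ W.wet) :
    IntegrableOn (ampSq A p X) (W.strip p X) :=
  h.integrableOn_of_le hX hp (h.continuous_ampSq hX hp) zero_le_one fun Y _ => by
    rw [one_mul, Real.norm_of_nonneg ampSq_nonneg]

theorem integrableOn_stripFluxC (h : Admissible D W H L ε K A) (hX : X ∈ Ioo 0 L)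
    (hp : p ∈ W.wet) : IntegrableOn (D.stripFluxC W H ε A p X) (W.strip p X) :=
  h.integrableOn_of_le hX hp ((h.continuousOn_stripFluxC hp).comp_continuous
    (f := fun Y => (X, Y)) (by fun_prop) fun _ => ⟨hX, mem_univ _⟩)
    (mul_nonneg zero_le_two (fluxConst_nonneg h.H_pos K)) fun _ hY => h.norm_stripFluxC_le hX hp hY

/-- The Leibniz rule for the flux through a strip. -/
theorem slopeBound_integral_stripFlux_of (h : Admissible D W H L ε K A) (hX : X ∈ Ioo 0 L)
    (hp : p ∈ W.wet) {q b : ℝ → ℝ}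
    (hq : AEStronglyMeasurable q (volume.restrict (W.strip p X)))
    (hb : IntegrableOn b (W.strip p X))
    (hslope : ∀ᵐ Y, Y ∈ W.strip p X →
      SlopeBound (fun x => D.stripFlux W H ε A p x Y) (q Y) (b Y) X) :
    IntegrableOn q (W.strip p X) ∧
      SlopeBound (fun x => ∫ Y in W.strip p x, D.stripFlux W H ε A p x Y)
        ((∫ Y in W.strip p X, q Y)
          + endR (fun i => deriv (W.curve i) X * D.stripFlux W H ε A p X (W.curve i X)) p
          - endL (fun i => deriv (W.curve i) X * D.stripFlux W H ε A p X (W.curve i X)) p)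
        (∫ Y in W.strip p X, b Y) X := by
  obtain ⟨G, hG, hGx⟩ := h.exists_dominating hX
  have hf0 := fluxConst_nonneg (ι := ι) h.H_pos K
  have hs0 := slopeConst_nonneg ι h.H_pos K
  have hnear : ∀ᶠ x in 𝓝 X, x ∈ Ioo 0 L := isOpen_Ioo.mem_nhds hX
  have hev := hnear.and hGx
  refine Medium.slopeBound_integral_strip h.regular hX
    (G := fun Y => (2 * fluxConst ι H K + slopeConst ι H K) * G Y) (hG.const_mul _)
    (h.continuousOn_stripFlux hp) ?_ ?_ hq hb hslope
  · filter_upwards [hev] with x hx Y hY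
    have h1 := (hx.2 p hp Y hY).1
    have h0 : 0 ≤ ampSq A p x Y := ampSq_nonneg
    calc |D.stripFlux W H ε A p x Y| ≤ ‖D.stripFluxC W H ε A p x Y‖ := by
          rw [← stripFluxC_im]; exact Complex.abs_im_le_norm _
      _ ≤ 2 * fluxConst ι H K * ampSq A p x Y := h.norm_stripFluxC_le hx.1 hp hY
      _ ≤ (2 * fluxConst ι H K + slopeConst ι H K) * G Y :=
          mul_le_mul (by linarith) h1 h0 (by positivity)
  -- The mean value inequality along the stations between `X` and `x`, at fixed `Y` which never
  -- leaves the strip; the local domination makes the slope bound uniform.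
  · filter_upwards [eventually_forall_uIcc hev] with x hx Y hY
    refine SlopeBound.abs_image_sub_le (f := fun x => D.stripFlux W H ε A p x Y)
      (s := uIcc X x) ordConnected_uIcc (fun x' hx' => ?_) left_mem_uIcc right_mem_uIcc
    obtain ⟨d, b', h1, -, h2, -⟩ := h.exists_slopeBound_stripFlux (hx x' hx').1 hp (hY x' hx')
    refine ⟨d, b', h1, h2.trans ?_⟩
    exact mul_le_mul (by linarith) ((hx x' hx').2 p hp Y (hY x' hx')).1 ampSq_nonneg (by positivity)

/-- The slope of the flux through a strip, by the conservation law for the leading terms. -/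
theorem slopeBound_integral_stripFlux (h : Admissible D W H L ε K A) (hX : X ∈ Ioo 0 L)
    (hp : p ∈ W.wet) :
    SlopeBound (fun x => ∫ Y in W.strip p x, D.stripFlux W H ε A p x Y)
      (endR (fun i => deriv (W.curve i) X * D.stripFlux W H ε A p X (W.curve i X)
          - sideFlux A p X (W.curve i X)) p
        - endL (fun i => deriv (W.curve i) X * D.stripFlux W H ε A p X (W.curve i X)
          - sideFlux A p X (W.curve i X)) p)
      (slopeConst ι H K * ε * ∫ Y in W.strip p X, ampSq A p X Y) X := by
  set q : ℝ → ℝ := fun Y => ∑ j, (conj (A p j X Y) * iteratedDeriv 2 (A p j X) Y).im with hq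
  have hside := h.hasDerivAt_sideFlux hX hp
  have hqm : AEStronglyMeasurable q (volume.restrict (W.strip p X)) := by
    have : q = deriv (sideFlux A p X) := funext fun Y => (hside Y).deriv.symm
    rw [this]
    exact (measurable_deriv _).aestronglyMeasurable
  -- The pointwise slopes are merely chosen and need not depend measurably on `Y`. Prescribing the
  -- slope `-q` instead, with the `O(ε)` discrepancy in `b`, avoids the question.
  obtain ⟨h1, h2⟩ := h.slopeBound_integral_stripFlux_of hX hp (q := fun Y => -q Y)
    (b := fun Y => slopeConst ι H K * ε * ampSq A p X Y) hqm.neg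
    ((h.integrableOn_ampSq hX hp).const_mul _)
    (Eventually.of_forall fun Y hY => by
      obtain ⟨d, b, hs, -, -, -, hd⟩ := h.exists_slopeBound_stripFlux hX hp hY
      refine (hs.change_slope _).mono ?_
      rw [sub_neg_eq_add]
      refine hd.trans_eq (by ring))
  have hiq : IntegrableOn q (W.strip p X) := by simpa using! h1.neg
  obtain ⟨G, hG, hGx⟩ := h.exists_dominating hX
  have hiside : IntegrableOn (sideFlux A p X) (W.strip p X) := by
    refine hG.integrableOn.mono' (continuous_iff_continuousAt.2 fun Y =>
      (hside Y).continuousAt).aestronglyMeasurable ?_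
    rw [ae_restrict_iff' Medium.measurableSet_strip]
    exact Eventually.of_forall fun Y hY => (hGx.self_of_nhds p hp Y hY).2
  -- The transversal flux is integrated exactly and leaves only wall terms.
  have h3 := Medium.integral_strip_of_hasDerivAt (h.regular.curve_lt X hX) hside hiside hiq
  rw [integral_neg, h3, integral_const_mul] at h2
  convert h2 using 1
  rw [endR_sub, endL_sub]
  ring

/-- Without crossings of the interface with its unperturbed position, the flux through a strip is
differentiable. -/
theorem differentiableAt_integral_stripFlux (h : Admissible D W H L ε K A) (hX : X ∈ Ioo 0 L)
    (hp : p ∈ W.wet) (hn : W.NoCrossing X) :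
    DifferentiableAt ℝ (fun x => ∫ Y in W.strip p x, D.stripFlux W H ε A p x Y) X := by
  set f := D.stripFlux W H ε A p with hf
  -- For almost every `Y` there is no crossing with nonzero relative speed, so the corner vanishes.
  have hd : ∀ᵐ Y, Y ∈ W.strip p X →
      HasDerivAt (fun x => f x Y) (deriv (fun x => f x Y) X) X := by
    filter_upwards [hn p hp] with Y hY hYs
    obtain ⟨d, b, hs, -, -, hb, -⟩ := h.exists_slopeBound_stripFlux hX hp hYs
    rw [hb (hY hYs), slopeBound_zero_iff] at hs
    exact hs.differentiableAt.hasDerivAt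
  have hqm : AEStronglyMeasurable (fun Y => deriv (fun x => f x Y) X)
      (volume.restrict (W.strip p X)) := by
    classical
    have hc : ∀ x ∈ Ioo 0 L, Continuous (f x) := fun x hx =>
      (h.continuousOn_stripFlux hp).comp_continuous (f := fun Y => (x, Y)) (by fun_prop)
        fun _ => ⟨hx, mem_univ _⟩
    -- The derivative is measurable as a limit of difference quotients, which are continuous in `Y`
    -- for stations inside `(0, L)`; elsewhere they are replaced by zero.
    refine aestronglyMeasurable_of_tendsto_ae (𝓝[≠] X)
      (f := fun x Y => if x ∈ Ioo 0 L then slope (fun x => f x Y) X x else 0) (fun x => ?_) ?_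
    · split_ifs with hx
      · simp only [slope_def_field]
        exact (((hc x hx).sub (hc X hX)).div_const _).aestronglyMeasurable
      · exact aestronglyMeasurable_const
    · rw [ae_restrict_iff' Medium.measurableSet_strip]
      filter_upwards [hd] with Y hY hYs
      refine (hasDerivAt_iff_tendsto_slope.1 (hY hYs)).congr' ?_
      filter_upwards [nhdsWithin_le_nhds (isOpen_Ioo.mem_nhds hX)] with x hx
      rw [if_pos hx]
  obtain ⟨-, h2⟩ := h.slopeBound_integral_stripFlux_of hX hp hqm (b := fun _ => 0)
    integrableOn_zero (hd.mono fun Y hY hYs => (hY hYs).slopeBound)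
  rw [integral_zero, slopeBound_zero_iff] at h2
  exact h2.differentiableAt

end Admissible

end Modes
end ModePE

/-! ### Walls and the total flux. -/

namespace ModePE
namespace Modes

variable {n : ℕ} {ι : Type*} [Fintype ι] {D : Modes ι} {W : Medium n} {H L ε K X Y : ℝ}
  {p : Fin (n + 1)} {A : Fin (n + 1) → ι → ℝ → ℝ → ℂ}

open Classical in
/-- The flux through the plane `X = const`, in the slow variable `Y`. -/
noncomputable def totalFlux (D : Modes ι) (W : Medium n) (H ε : ℝ)
    (A : Fin (n + 1) → ι → ℝ → ℝ → ℂ) (X : ℝ) : ℝ :=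
  ∑ p, if p ∈ W.wet then ∫ Y in W.strip p X, D.stripFlux W H ε A p X Y else 0

/-- Bound for the slope of the flux. -/
noncomputable def totalConst (ι : Type*) [Fintype ι] (n : ℕ) (H K : ℝ) : ℝ :=
  (2 * n * fluxConst ι H K * Fintype.card ι + slopeConst ι H K) * max K 1

namespace Admissible

/-- The condition for the leading part of the flux at a boundary. -/
theorem leadFlux_eq_sideFlux (h : Admissible D W H L ε K A) (hX : X ∈ Ioo 0 L) (i : Fin n)
    (hip : p = i.castSucc ∧ i.succ ∉ W.wet ∨ p = i.succ ∧ i.castSucc ∉ W.wet) (hp : p ∈ W.wet) :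
    deriv (W.curve i) X * D.leadFlux A p X (W.curve i X) = sideFlux A p X (W.curve i X) := by
  rw [leadFlux, sideFlux, Finset.mul_sum]
  refine Finset.sum_congr rfl fun j _ => ?_
  obtain ⟨h1, h2⟩ := h.solution.boundary i p hip hp j X hX
  -- At a soft wall both sides vanish with the amplitude. At a rigid one `A_Y = i c_X k A`, so
  -- `Im(A^* A_Y) = c_X k |A|²`.
  by_cases hi : i ∈ W.soft
  · simp [h2 hi]
  · have e : conj (A p j X (W.curve i X)) * deriv (A p j X) (W.curve i X)
        = Complex.I * ((deriv (W.curve i) X * (D.k j X * ‖A p j X (W.curve i X)‖ ^ 2) : ℝ) : ℂ) := by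
      rw [sub_eq_zero.1 (h1 hi)]
      push_cast
      rw [← Complex.conj_mul']
      ring
    rw [e, Complex.I_mul_im, Complex.ofReal_re]

/-- The estimate inside the strip is a closed condition on continuous functions of `Y`, hence it
persists at the walls, where it is used. -/
theorem abs_stripFlux_sub_le (h : Admissible D W H L ε K A) (hX : X ∈ Ioo 0 L) (hp : p ∈ W.wet)
    (hY : Y ∈ closure (W.strip p X)) :
    |D.stripFlux W H ε A p X Y - D.leadFlux A p X Y| ≤ fluxConst ι H K * ampSq₁ A p X Y * ε := by
  have c0 : ∀ j, Continuous fun Y => A p j X Y := fun j => (h.smooth_A hp j).continuous_snd hX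
  have c1 : ∀ j, Continuous fun Y => dX (A p j) X Y := fun j =>
    ((h.smooth_A hp j).dX (m := 1) (by norm_num)).continuous_snd hX
  have c2 : Continuous (D.stripFlux W H ε A p X) :=
    (h.continuousOn_stripFlux hp).comp_continuous (f := fun Y => (X, Y)) (by fun_prop)
      fun _ => ⟨hX, mem_univ _⟩
  have c3 : Continuous (D.leadFlux A p X) := by
    unfold leadFlux
    fun_prop
  have c4 : Continuous (ampSq₁ A p X) := by
    unfold ampSq₁
    fun_prop
  refine closure_minimal (s := W.strip p X)
    (t := {Y | |D.stripFlux W H ε A p X Y - D.leadFlux A p X Y|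
      ≤ fluxConst ι H K * ampSq₁ A p X Y * ε}) (fun Y hY => ?_)
    (isClosed_le (c2.sub c3).abs ((continuous_const.mul c4).mul continuous_const)) hY
  have h1 := (Complex.abs_im_le_norm _).trans (h.norm_stripFluxC_sub_le hX hp hY)
  rwa [Complex.sub_im, Complex.I_mul_im, Complex.ofReal_re, stripFluxC_im] at h1

open Classical in
/-- The energy lost at a wall. -/
theorem abs_wall_le (h : Admissible D W H L ε K A) (hA : AmplitudeBound W L ε K A)
    (hX : X ∈ Ioo 0 L) (i : Fin n) :
    |(if i.castSucc ∈ W.wet then deriv (W.curve i) X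
          * D.stripFlux W H ε A i.castSucc X (W.curve i X)
          - sideFlux A i.castSucc X (W.curve i X) else 0)
      - (if i.succ ∈ W.wet then deriv (W.curve i) X
          * D.stripFlux W H ε A i.succ X (W.curve i X)
          - sideFlux A i.succ X (W.curve i X) else 0)|
      ≤ 2 * (fluxConst ι H K * Fintype.card ι * max K 1 * (ε * √ε)) := by
  have hf0 := fluxConst_nonneg (ι := ι) h.H_pos K
  have hε := h.ε_pos
  set w := fluxConst ι H K * Fintype.card ι * max K 1 * (ε * √ε) with hw
  have hw0 : 0 ≤ w := by have : 0 ≤ max K 1 := zero_le_one.trans (le_max_right _ _); positivity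
  -- One factor `ε` comes from the non-leading part of the density, the factor `√ε` from the
  -- hypothesis on the traces at inclined walls.
  have hwall : ∀ p ∈ W.wet, (p = i.castSucc ∨ p = i.succ) →
      |deriv (W.curve i) X * D.stripFlux W H ε A p X (W.curve i X)
        - deriv (W.curve i) X * D.leadFlux A p X (W.curve i X)| ≤ w := fun p hp hip => by
    have hcl : W.curve i X ∈ closure (W.strip p X) := by
      rcases hip with rfl | rfl
      · exact Medium.curve_mem_closure_castSucc (h.regular.curve_lt X hX) i
      · exact Medium.curve_mem_closure_succ (h.regular.curve_lt X hX) i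
    have h1 : |deriv (W.curve i) X| * ampSq₁ A p X (W.curve i X)
        ≤ Fintype.card ι * (max K 1 * √ε) := by
      rw [ampSq₁, Finset.mul_sum]
      refine (Finset.sum_le_sum (g := fun _ => max K 1 * √ε) fun j _ => ?_).trans (by simp)
      refine (hA.walls X hX i p hp hip j).trans ?_
      have := le_max_left K 1
      gcongr
    rw [← mul_sub, abs_mul]
    calc _ ≤ |deriv (W.curve i) X| * (fluxConst ι H K * ampSq₁ A p X (W.curve i X) * ε) := by
          have := h.abs_stripFlux_sub_le hX hp hcl
          gcongr
      _ = fluxConst ι H K * ε * (|deriv (W.curve i) X| * ampSq₁ A p X (W.curve i X)) := by ring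
      _ ≤ fluxConst ι H K * ε * (Fintype.card ι * (max K 1 * √ε)) := by gcongr
      _ = w := by rw [hw]; ring
  -- At an interface the leading and transversal fluxes from the two sides coincide, which leaves
  -- two remainders. At a boundary the leading flux balances the transversal one and leaves a single
  -- remainder.
  by_cases h1 : i.castSucc ∈ W.wet <;> by_cases h2 : i.succ ∈ W.wet
  · rw [if_pos h1, if_pos h2]
    have e1 : D.leadFlux A i.castSucc X (W.curve i X) = D.leadFlux A i.succ X (W.curve i X) := by
      simp only [leadFlux, (h.solution.interface i h1 h2 _ X hX).1]
    have e2 : sideFlux A i.castSucc X (W.curve i X) = sideFlux A i.succ X (W.curve i X) := by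
      simp only [sideFlux, (h.solution.interface i h1 h2 _ X hX).1,
        (h.solution.interface i h1 h2 _ X hX).2]
    have b1 := hwall _ h1 (Or.inl rfl)
    have b2 := hwall _ h2 (Or.inr rfl)
    rw [e1] at b1
    rw [e2, sub_sub_sub_cancel_right, two_mul]
    exact (abs_sub_le _ _ _).trans (add_le_add b1 (by rwa [abs_sub_comm]))
  · rw [if_pos h1, if_neg h2, sub_zero,
      ← h.leadFlux_eq_sideFlux hX i (Or.inl ⟨rfl, h2⟩) h1]
    have := hwall _ h1 (Or.inl rfl)
    linarith
  · rw [if_neg h1, if_pos h2, zero_sub, abs_neg,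
      ← h.leadFlux_eq_sideFlux hX i (Or.inr ⟨rfl, h1⟩) h2]
    have := hwall _ h2 (Or.inr rfl)
    linarith
  · rw [if_neg h1, if_neg h2]
    simpa using hw0

open Classical in
-- The hypothesis bounds integrals over `y`; the factor `√ε` is the Jacobian of `Y = √ε y`.
theorem sum_integral_ampSq_le (h : Admissible D W H L ε K A) (hA : AmplitudeBound W L ε K A)
    (hX : X ∈ Ioo 0 L) :
    ∑ p, (if p ∈ W.wet then ∫ Y in W.strip p X, ampSq A p X Y else 0) ≤ max K 1 * √ε := by
  have hε := h.ε_pos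
  have h1 := hA.bulk (X / ε) ⟨div_pos hX.1 hε, by have := hX.2; gcongr⟩
  rw [mul_div_cancel₀ X hε.ne'] at h1
  have h2 := Medium.integral_sum_strip (W := W) (X := X) (f := fun p => ampSq A p X)
    fun p hp => h.integrableOn_ampSq hX hp
  have h3 := Measure.integral_comp_mul_left
    (fun Y => ∑ p, if p ∈ W.wet ∧ Y ∈ W.strip p X then ampSq A p X Y else 0) √ε
  have hs : 0 < √ε := Real.sqrt_pos.2 hε
  rw [h2.2, abs_of_pos (inv_pos.2 hs), smul_eq_mul] at h3
  have h4 : (√ε)⁻¹ * ∑ p, (if p ∈ W.wet then ∫ Y in W.strip p X, ampSq A p X Y else 0) ≤ K := by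
    rw [← h3]
    exact h1
  calc _ = (√ε)⁻¹ * (∑ p, (if p ∈ W.wet then ∫ Y in W.strip p X, ampSq A p X Y else 0)) * √ε := by
        field_simp
    _ ≤ max K 1 * √ε := by
        have := h4.trans (le_max_left K 1)
        gcongr

/-- The slope of the flux is of order `ε √ε`. -/
theorem exists_slopeBound_totalFlux (h : Admissible D W H L ε K A)
    (hA : AmplitudeBound W L ε K A) (hX : X ∈ Ioo 0 L) :
    ∃ d b, SlopeBound (D.totalFlux W H ε A) d b X ∧ 0 ≤ b ∧
      |d| + b ≤ totalConst ι n H K * (ε * √ε) := by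
  classical
  have hε := h.ε_pos
  have hs0 := slopeConst_nonneg ι h.H_pos K
  refine ⟨_, _, SlopeBound.sum Finset.univ
    (f := fun p x => if p ∈ W.wet then ∫ Y in W.strip p x, D.stripFlux W H ε A p x Y else 0)
    (d := fun p => if p ∈ W.wet then
      endR (fun i => deriv (W.curve i) X * D.stripFlux W H ε A p X (W.curve i X)
          - sideFlux A p X (W.curve i X)) p
        - endL (fun i => deriv (W.curve i) X * D.stripFlux W H ε A p X (W.curve i X)
          - sideFlux A p X (W.curve i X)) p else 0)
    (b := fun p => slopeConst ι H K * ε *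
      if p ∈ W.wet then ∫ Y in W.strip p X, ampSq A p X Y else 0) fun p _ => ?_, ?_, ?_⟩
  · by_cases hp : p ∈ W.wet
    · simpa only [hp, if_true] using h.slopeBound_integral_stripFlux hX hp
    · simpa only [hp, if_false, mul_zero] using (hasDerivAt_const X (0 : ℝ)).slopeBound
  · refine Finset.sum_nonneg fun p _ => mul_nonneg (by positivity) ?_
    split_ifs
    · exact integral_nonneg fun _ => ampSq_nonneg
    · exact le_rfl
  · rw [sum_endR_sub_endL, ← Finset.mul_sum]
    have h1 := h.sum_integral_ampSq_le hA hX
    have h2 := Finset.sum_le_sum fun i (_ : i ∈ Finset.univ) => h.abs_wall_le hA hX i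
    simp only [Finset.sum_const, Finset.card_univ, Fintype.card_fin, nsmul_eq_mul] at h2
    calc _ ≤ n * (2 * (fluxConst ι H K * Fintype.card ι * max K 1 * (ε * √ε)))
          + slopeConst ι H K * ε * (max K 1 * √ε) :=
          add_le_add ((Finset.abs_sum_le_sum_abs _ _).trans h2)
            (mul_le_mul_of_nonneg_left h1 (by positivity))
      _ = _ := by rw [totalConst]; ring

theorem differentiableAt_totalFlux (h : Admissible D W H L ε K A) (hX : X ∈ Ioo 0 L)
    (hn : W.NoCrossing X) : DifferentiableAt ℝ (D.totalFlux W H ε A) X := by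
  classical
  refine DifferentiableAt.fun_sum fun p _ => ?_
  by_cases hp : p ∈ W.wet
  · simpa only [hp, if_true] using h.differentiableAt_integral_stripFlux hX hp hn
  · simp only [hp, if_false]
    exact differentiableAt_const _

end Admissible

end Modes
end ModePE

/-! ### From the acoustic field to the flux in slow variables. -/

namespace ModePE

theorem Medium.γ_eq {n : ℕ} {W : Medium n} {ε x y : ℝ} {p : Fin (n + 1)}
    (hY : √ε * y ∈ W.strip p (ε * x)) (z : ℝ) :
    W.γ ε x y z = if W.h ε p (ε * x) (√ε * y) < z then W.γtot ε p (√ε * y) .upper (ε * x) z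
      else W.γtot ε p (√ε * y) .lower (ε * x) z := by
  rw [γ, Finset.sum_eq_single p]
  · simp only [if_pos hY, γtot]
  · exact fun p' _ hp' => if_neg fun hY' => hp' (strip_disjoint hY' hY)
  · exact fun hp => absurd (Finset.mem_univ p) hp

namespace Modes

variable {n : ℕ} {ι : Type*} {D : Modes ι} {W : Medium n} {H L ε K x y z : ℝ}
  {p : Fin (n + 1)} {A : Fin (n + 1) → ι → ℝ → ℝ → ℂ}

theorem physA_eq (hp : p ∈ W.wet) (hY : √ε * y ∈ W.strip p (ε * x)) (j : ι) :
    physA W ε A j x y = A p j (ε * x) (√ε * y) := by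
  rw [physA, Finset.sum_eq_single p]
  · exact if_pos ⟨hp, hY⟩
  · exact fun p' _ hp' => if_neg fun h => hp' (Medium.strip_disjoint h.2 hY)
  · exact fun hp => absurd (Finset.mem_univ p) hp

theorem physA_eq_zero (h : ∀ p ∈ W.wet, √ε * y ∉ W.strip p (ε * x)) (j : ι) :
    physA W ε A j x y = 0 :=
  Finset.sum_eq_zero fun p _ => if_neg fun hp => h p hp.1 hp.2

variable [Fintype ι]

namespace Admissible

/-- The derivative of the acoustic field off the unperturbed interface. -/
theorem hasDerivAt_P (h : Admissible D W H L ε K A) (hX : ε * x ∈ Ioo 0 L) (hp : p ∈ W.wet)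
    (hY : √ε * y ∈ W.strip p (ε * x)) (hz : z ≠ W.h0 (ε * x)) :
    HasDerivAt (fun x => D.P W ε A x y z)
      (∑ j, ((Complex.I * D.k j (ε * x) * A p j (ε * x) (√ε * y)
            + ε * dX (A p j) (ε * x) (√ε * y)) * D.expθ ε j (ε * x)
          * ((if W.h0 (ε * x) < z then D.φ .upper j (ε * x) z else D.φ .lower j (ε * x) z : ℝ) : ℂ)
        + ε * A p j (ε * x) (√ε * y) * D.expθ ε j (ε * x)
          * ((if W.h0 (ε * x) < z then dX (D.φ .upper j) (ε * x) z
              else dX (D.φ .lower j) (ε * x) z : ℝ) : ℂ))) x := by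
  have ht : Tendsto (fun x => ε * x) (𝓝 x) (𝓝 (ε * x)) :=
    (continuous_const.mul continuous_id).tendsto x
  have hstrip := ht.eventually (Medium.eventually_mem_strip h.regular hX hY)
  -- A level off the unperturbed interface stays in the same layer for nearby `x`, so a single
  -- smooth piece of the modes is differentiated.
  have hlayer : ∃ s : Layer, (∀ {α : Type} (a b : α), (if W.h0 (ε * x) < z then a else b)
        = Layer.casesOn s a b) ∧
      ∀ᶠ x in 𝓝 x, ∀ j, D.physφ W ε j x z = D.φ s j (ε * x) z := by
    have hc := (h.regular.hasDerivAt_h0 hX).continuousAt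
    rcases lt_or_gt_of_ne hz with hlt | hlt
    · refine ⟨.lower, fun a b => if_neg hlt.le.not_gt, ?_⟩
      filter_upwards [ht.eventually (hc.eventually_const_lt hlt)] with x hx j
      exact if_neg hx.le.not_gt
    · refine ⟨.upper, fun a b => if_pos hlt, ?_⟩
      filter_upwards [ht.eventually (hc.eventually_lt_const hlt)] with x hx j
      exact if_pos hx
  obtain ⟨s, hs, hφ⟩ := hlayer
  have hε := h.ε_pos.ne'
  have e : (fun x => D.P W ε A x y z) =ᶠ[𝓝 x]
      fun x => ∑ j, A p j (ε * x) (√ε * y) * D.expθ ε j (ε * x) * (D.φ s j (ε * x) z : ℂ) := by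
    filter_upwards [hstrip, hφ] with x hx hφx
    simp only [P, physA_eq hp hx, hφx, expθ]
  refine HasDerivAt.congr_of_eventuallyEq (HasDerivAt.fun_sum fun j _ => ?_) e
  have hm : HasDerivAt (fun x => ε * x) ε x := by simpa using (hasDerivAt_id x).const_mul ε
  have h1 := (((h.smooth_A hp j).hasDerivAt_fst one_le_two hX (√ε * y)).mul
    (h.hasDerivAt_expθ hX j)).mul
    ((h.spectral.smooth_one s j).hasDerivAt_fst le_rfl hX z).ofReal_comp
  refine (h1.scomp x hm).congr_deriv ?_
  have hεC : (ε : ℂ) ≠ 0 := Complex.ofReal_ne_zero.2 hε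
  rw [hs, hs]
  simp only [Pi.mul_apply, Complex.real_smul, Complex.ofReal_div]
  cases s <;> field_simp <;> ring

/-- Integration of the flux density over the depth of the waveguide. -/
theorem integral_depth (h : Admissible D W H L ε K A) (hX : ε * x ∈ Ioo 0 L) (hp : p ∈ W.wet)
    (hY : √ε * y ∈ W.strip p (ε * x)) :
    ∫ z in (-H)..0, (W.γ ε x y z : ℂ) * deriv (fun x' => D.P W ε A x' y z) x
      * conj (D.P W ε A x y z) = D.stripFluxC W H ε A p (ε * x) (√ε * y) := by
  classical
  set X := ε * x with hXdef
  set Y := √ε * y with hYdef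
  set g : ℝ → ℝ := fun z => if W.h ε p X Y < z then W.γtot ε p Y .upper X z
      else W.γtot ε p Y .lower X z with hg
  set u : ι → ι → ℝ → ℝ := fun j l z =>
    if W.h0 X < z then D.φφ j l .upper X z else D.φφ j l .lower X z with hu
  set v : ι → ι → ℝ → ℝ := fun j l z =>
    if W.h0 X < z then D.φXφ j l .upper X z else D.φXφ j l .lower X z with hv
  set a : ι → ι → ℂ := fun j l => conj (A p l X Y * D.expθ ε l X)
    * ((Complex.I * D.k j X * A p j X Y + ε * dX (A p j) X Y) * D.expθ ε j X) with ha
  set b : ι → ι → ℂ := fun j l => ε * (conj (A p l X Y * D.expθ ε l X)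
    * (A p j X Y * D.expθ ε j X)) with hb
  have hU := fun j l => Medium.integral_γ_mul h.regular hX hp hY (u := D.φφ j l)
    fun s => (h.spectral.smooth_φφ j l s).continuous_snd hX
  have hV := fun j l => Medium.integral_γ_mul h.regular hX hp hY (u := D.φXφ j l)
    fun s => (h.spectral.smooth_φXφ j l s).continuous_snd hX
  -- The integrand as a double sum over the modes, with coefficients independent of `z`. The
  -- excluded level is a null set.
  have hpt : ∀ z, z ≠ W.h0 X → (W.γ ε x y z : ℂ) * deriv (fun x' => D.P W ε A x' y z) x
      * conj (D.P W ε A x y z)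
      = ∑ j, ∑ l, (a j l * ((g z * u j l z : ℝ) : ℂ) + b j l * ((g z * v j l z : ℝ) : ℂ)) := by
    intro z hz
    rw [(h.hasDerivAt_P hX hp hY hz).deriv, Medium.γ_eq hY, P, map_sum, mul_assoc,
      Finset.sum_mul_sum, Finset.mul_sum]
    refine Finset.sum_congr rfl fun j _ => ?_
    rw [Finset.mul_sum]
    refine Finset.sum_congr rfl fun l _ => ?_
    rw [physA_eq hp hY]
    simp only [physφ, ha, hb, hg, hu, hv, ← hXdef, ← hYdef, φφ, φXφ, map_mul, Complex.conj_ofReal,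
      ← expθ.eq_def]
    rcases lt_or_ge (W.h0 X) z with h1 | h1
    · simp only [if_pos h1]
      push_cast
      ring
    · simp only [if_neg (not_lt.2 h1)]
      push_cast
      ring
  have hi1 : ∀ j l, IntervalIntegrable (fun z => a j l * ((g z * u j l z : ℝ) : ℂ)) volume (-H) 0 :=
    fun j l =>
    IntervalIntegrable.const_mul ⟨(hU j l).1.1.ofReal, (hU j l).1.2.ofReal⟩ _
  have hi2 : ∀ j l, IntervalIntegrable (fun z => b j l * ((g z * v j l z : ℝ) : ℂ)) volume (-H) 0 :=
    fun j l =>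
    IntervalIntegrable.const_mul ⟨(hV j l).1.1.ofReal, (hV j l).1.2.ofReal⟩ _
  have hi3 : ∀ j l, IntervalIntegrable (fun z => a j l * ((g z * u j l z : ℝ) : ℂ)
      + b j l * ((g z * v j l z : ℝ) : ℂ)) volume (-H) 0 := fun j l => (hi1 j l).add (hi2 j l)
  have hi4 : ∀ j, IntervalIntegrable (fun z => ∑ l, (a j l * ((g z * u j l z : ℝ) : ℂ)
      + b j l * ((g z * v j l z : ℝ) : ℂ))) volume (-H) 0 := fun j => by
    have := IntervalIntegrable.sum Finset.univ fun l _ => hi3 j l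
    rwa [Finset.sum_fn] at this
  have hae : ∀ᵐ z : ℝ, z ≠ W.h0 X := by
    rw [ae_iff]
    simp
  rw [intervalIntegral.integral_congr_ae (hae.mono fun z hz _ => hpt z hz),
    intervalIntegral.integral_finsetSum fun j _ => hi4 j]
  have hjl : ∀ j l, ∫ z in (-H)..0, (a j l * ((g z * u j l z : ℝ) : ℂ)
      + b j l * ((g z * v j l z : ℝ) : ℂ))
      = (if j = l then a j l else 0) + (a j l * (W.corr H ε p (D.φφ j l) X Y : ℂ)
        + b j l * (D.elemN W H ε p j l X Y : ℂ)) := fun j l => by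
    rw [intervalIntegral.integral_add (hi1 j l) (hi2 j l), intervalIntegral.integral_const_mul,
      intervalIntegral.integral_const_mul, intervalIntegral.integral_ofReal,
      intervalIntegral.integral_ofReal, (hU j l).2, (hV j l).2,
      h.spectral.orthonormal h.regular hX, ← C_eq, elemN]
    split_ifs <;> push_cast <;> ring
  -- The Kronecker delta from orthonormality selects the diagonal, where the exponentials cancel.
  have hdiag : ∀ j, a j j = conj (A p j X Y) * (Complex.I * D.k j X * A p j X Y
      + ε * dX (A p j) X Y) := fun j => by
    have h1 : conj (D.expθ ε j X) * D.expθ ε j X = 1 := by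
      rw [Complex.conj_mul', norm_expθ]
      simp
    simp only [ha, map_mul]
    linear_combination (conj (A p j X Y) * (Complex.I * D.k j X * A p j X Y
      + ε * dX (A p j) X Y)) * h1
  rw [stripFluxC, complexFlux, ← Finset.sum_add_distrib]
  refine Finset.sum_congr rfl fun j _ => ?_
  rw [intervalIntegral.integral_finsetSum fun l _ => hi3 j l, Finset.sum_congr rfl fun l _ =>
    hjl j l, Finset.sum_add_distrib, Finset.sum_ite_eq, if_pos (Finset.mem_univ j), hdiag]

/-- The energy flux in terms of the slow variables. -/
theorem J_eq (h : Admissible D W H L ε K A) (hX : ε * x ∈ Ioo 0 L) (ω : ℝ) :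
    D.J W H ω ε A x = 1 / (2 * ω) * ((√ε)⁻¹ * D.totalFlux W H ε A (ε * x)) := by
  classical
  have hs : 0 < √ε := Real.sqrt_pos.2 h.ε_pos
  have hint : ∀ y, ∫ z in (-H)..0, (W.γ ε x y z : ℂ) * deriv (fun x' => D.P W ε A x' y z) x
      * conj (D.P W ε A x y z)
      = (fun Y => ∑ p, if p ∈ W.wet ∧ Y ∈ W.strip p (ε * x) then
          D.stripFluxC W H ε A p (ε * x) Y else 0) (√ε * y) := fun y => by
    by_cases hy : ∃ p ∈ W.wet, √ε * y ∈ W.strip p (ε * x)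
    · obtain ⟨p, hp, hY⟩ := hy
      rw [h.integral_depth hX hp hY]
      refine Eq.symm ((Finset.sum_eq_single p ?_ ?_).trans (if_pos ⟨hp, hY⟩))
      · exact fun p' _ hp' => if_neg fun h' => hp' (Medium.strip_disjoint h'.2 hY)
      · exact fun hp => absurd (Finset.mem_univ p) hp
    · push Not at hy
      -- Outside the open wet strips, walls included, the factor `P^*` vanishes, so the value
      -- assigned to the `x`-derivative is irrelevant.
      have hP : ∀ z, D.P W ε A x y z = 0 := fun z =>
        Finset.sum_eq_zero fun j _ => by rw [physA_eq_zero hy, zero_mul, zero_mul]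
      simp only [hP, map_zero, mul_zero, intervalIntegral.integral_zero]
      exact (Finset.sum_eq_zero fun p _ => if_neg fun hp => hy p hp.1 hp.2).symm
  rw [J]
  simp only [hint]
  rw [Measure.integral_comp_mul_left (fun Y => ∑ p, if p ∈ W.wet ∧ Y ∈ W.strip p (ε * x) then
      D.stripFluxC W H ε A p (ε * x) Y else 0), (Medium.integral_sum_strip fun p hp =>
    h.integrableOn_stripFluxC hX hp).2, abs_of_pos (inv_pos.2 hs), Complex.smul_im, smul_eq_mul,
    Complex.im_sum, totalFlux]
  congr 2
  refine Finset.sum_congr rfl fun p _ => ?_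
  split_ifs with hp
  · simp only [← stripFluxC_im]
    exact (integral_im (h.integrableOn_stripFluxC hX hp)).symm
  · rfl

end Admissible

end Modes
end ModePE

/-! ### Conclusion for the energy flux. -/

namespace ModePE
namespace Modes
namespace Admissible

variable {n : ℕ} {ι : Type*} [Fintype ι] {D : Modes ι} {W : Medium n} {H L ε K x ω : ℝ}
  {A : Fin (n + 1) → ι → ℝ → ℝ → ℂ}

theorem mul_mem_Ioo (h : Admissible D W H L ε K A) (hx : x ∈ Ioo 0 (L / ε)) :
    ε * x ∈ Ioo 0 L :=
  ⟨mul_pos h.ε_pos hx.1, by rw [mul_comm]; exact (lt_div_iff₀ h.ε_pos).1 hx.2⟩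

theorem J_eventuallyEq (h : Admissible D W H L ε K A) (hx : x ∈ Ioo 0 (L / ε)) :
    D.J W H ω ε A =ᶠ[𝓝 x] fun x => 1 / (2 * ω) * (√ε)⁻¹ * D.totalFlux W H ε A (ε * x) := by
  filter_upwards [isOpen_Ioo.mem_nhds hx] with x hx
  rw [h.J_eq (h.mul_mem_Ioo hx), mul_assoc]

/-- The slope of the energy flux is of order `ε ^ 2`. -/
theorem exists_slopeBound_J (h : Admissible D W H L ε K A) (hA : AmplitudeBound W L ε K A)
    (hω : 0 < ω) (hx : x ∈ Ioo 0 (L / ε)) :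
    ∃ d b, SlopeBound (D.J W H ω ε A) d b x ∧ 0 ≤ b ∧
      |d| + b ≤ totalConst ι n H K / (2 * ω) * ε ^ 2 := by
  have hε := h.ε_pos
  have hs : 0 < √ε := Real.sqrt_pos.2 hε
  obtain ⟨d, b, hsl, hb, hdb⟩ := h.exists_slopeBound_totalFlux hA (h.mul_mem_Ioo hx)
  have hb' : 0 ≤ ε * b := by positivity
  have ha : 0 ≤ 1 / (2 * ω) * (√ε)⁻¹ := by positivity
  refine ⟨_, _, ((hsl.comp_mul_left hε).const_mul hb' (1 / (2 * ω) * (√ε)⁻¹)).congr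
    (h.J_eventuallyEq hx), by positivity, ?_⟩
  rw [abs_mul (1 / (2 * ω) * (√ε)⁻¹), abs_mul ε, abs_of_nonneg ha, abs_of_pos hε]
  -- The powers are `ε^{-1/2}` from the Jacobian, `ε` from `X = εx` and `ε^{3/2}` from the slope of
  -- the total flux.
  calc _ = 1 / (2 * ω) * (√ε)⁻¹ * ε * (|d| + b) := by ring
    _ ≤ 1 / (2 * ω) * (√ε)⁻¹ * ε * (totalConst ι n H K * (ε * √ε)) := by gcongr
    _ = _ := by field_simp

theorem differentiableAt_J (h : Admissible D W H L ε K A) (hx : x ∈ Ioo 0 (L / ε))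
    (hn : W.NoCrossing (ε * x)) : DifferentiableAt ℝ (D.J W H ω ε A) x := by
  refine DifferentiableAt.congr_of_eventuallyEq ?_ (h.J_eventuallyEq hx)
  have h1 := h.differentiableAt_totalFlux (h.mul_mem_Ioo hx) hn
  exact (h1.comp x (f := fun x => ε * x) (by fun_prop)).const_mul _

end Admissible
end Modes
end ModePE

theorem proposition2 {ι : Type*} [Fintype ι] (n : ℕ) (H ω K : ℝ) (hH : 0 < H) (hω : 0 < ω) :
    ∃ C : ℝ, ∀ (ε L : ℝ) (W : ModePE.Medium n) (D : ModePE.Modes ι)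
      (A : Fin (n + 1) → ι → ℝ → ℝ → ℂ),
      0 < ε → ε ≤ 1 →
      W.Regular H L ε → W.BoundedBy H L K →
      D.IsSpectral W H L → D.BoundedBy W H L K →
      (∀ p ∈ W.wet, ∀ s, ∀ X ∈ Set.Ioo 0 L, ∀ Y ∈ W.strip p X, ∀ z ∈ Set.Icc (-H) 0,
        (W.ν p s X Y z).im = 0) →
      D.IsSolution W H L ε A →
      ModePE.Modes.AmplitudeBound W L ε K A →
      (∀ x ∈ Set.Ioo 0 (L / ε), W.NoCrossing (ε * x) →
        DifferentiableAt ℝ (D.J W H ω ε A) x ∧ |deriv (D.J W H ω ε A) x| ≤ C * ε ^ 2) ∧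
      (∀ x₁ ∈ Set.Ioo 0 (L / ε), ∀ x₂ ∈ Set.Ioo 0 (L / ε),
        |D.J W H ω ε A x₂ - D.J W H ω ε A x₁| ≤ C * ε ^ 2 * |x₂ - x₁|) := by
  refine ⟨ModePE.Modes.totalConst ι n H K / (2 * ω), fun ε L W D A hε hε1 hW hWK hD hDK hν hsol
    hA => ?_⟩
  have h : ModePE.Modes.Admissible D W H L ε K A := ⟨hH, hε, hε1, hW, hWK, hD, hDK, hν, hsol⟩
  refine ⟨fun x hx hn => ?_, fun x₁ hx₁ x₂ hx₂ => ?_⟩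
  · have hd := h.differentiableAt_J (ω := ω) hx hn
    obtain ⟨d, b, hs, hb, hdb⟩ := h.exists_slopeBound_J hA hω hx
    -- The derivative exists by dominated convergence, which does not estimate it; its size comes
    -- from the slope bound at the same point.
    exact ⟨hd, hs.abs_deriv_le hb hdb hd.hasDerivAt⟩
  · refine ModePE.SlopeBound.abs_image_sub_le ordConnected_Ioo (fun x hx => ?_) hx₁ hx₂
    obtain ⟨d, b, hs, -, hdb⟩ := h.exists_slopeBound_J hA hω hx
    exact ⟨d, b, hs, hdb⟩
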